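/- Let $U\subseteq\mathbb R^2$ be open with coordinates $(X^1,X^2)$, write $\partial_a=\partial/\partial X^a$, and let $\lambda^1,\lambda^2:U\to\mathbb R$ be smooth, with $\lambda^1\neq\lambda^2$ everywhere on $U$. Suppose that $$A=\frac{\partial_2\lambda^1}{\lambda^2-\lambda^1},\qquad B=\frac{\partial_1\lambda^2}{\lambda^1-\lambda^2}$$ vanish nowhere on $U$. Consider the hydrodynamic-type system in Riemann invariants $$\partial_tX^1=\lambda^1(X)\,\partial_xX^1,\qquad \partial_tX^2=\lambda^2(X)\,\partial_xX^2. \qquad (1)$$ *Hamiltonian formulations.* A Hamiltonian formulation of (1) on an open set $V\subseteq U$ is an operator $\Omega^{ab}=g^{ab}(X)\,\partial_x+b^{ab}_c(X)\,\partial_xX^c$ with smooth coefficients on $V$ such that - $\{F,G\}=\int_{\mathbb R}\frac{\delta F}{\delta X^a}\,\Omega^{ab}\frac{\delta G}{\delta X^b}\,dx$ is a Poisson bracket on the smooth maps $\mathbb R\to V$, that is, the bracket $\{X^a(x),X^b(y)\}=g^{ab}\delta'(x-y)+b^{ab}_c\,\partial_xX^c\,\delta(x-y)$ of the coordinates (smeared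 with compactly supported smooth test functions) is skew-symmetric and satisfies the Jacobi identity; - (1) can be written as $\partial_tX^a=\Omega^{ab}\,\delta H/\delta X^b$ for some $H[X]=\int h(X)\,dx$ with $h$ smooth on $V$. It is non-degenerate if $\det(g^{ab})\neq0$ everywhere on $V$. *First integrals.* Let $\nabla$ be the torsion-free affine connection on $U$ with $$\Gamma^1_{11}=\partial_1\ln|A|-2B,\quad \Gamma^2_{22}=\partial_2\ln|B|-2A,\quad \Gamma^1_{12}=\Gamma^1_{21}=-\bigl(\tfrac12\partial_2\ln|A|+A\bigr),\quad \Gamma^2_{12}=\Gamma^2_{21}=-\bigl(\tfrac12\partial_1\ln|B|+B\bigr)$$ and all other components zero. A linear first integral of $\nabla$ on $V$ is a smooth one-form $K_a\,dX^a$ on $V$ such that $K_a(X)\dot X^a$ is constant along every affinely parametrised geodesic of $\nabla$ in $V$. For $p\in U$ and an integer $n\ge 0$, say that (1) admits $n$ Hamiltonian formulations near $p$ (or that $\nabla$ admits $n$ linear first integrals near $p$) if on some connected open $V$ with $p\in V\subseteq U$ there are $n$ of them that are linearly independent over $\mathbb R$. **Theorem.** There is a dense open subset $G$ of $U$ such that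 for every $p\in G$ and every $n$: 1. (1) admits $n$ Hamiltonian formulations near $p$ if and only if $\nabla$ admits $n$ linear first integrals near $p$. In particular, the maximal number of independent ones is one, two or three for the former if and only if it is one, two or three, respectively, for the latter. 2. If $n\ge2$, then (1) admits $n$ non-degenerate Hamiltonian formulations near $p$ if and only if $\nabla$ admits $n$ linear first integrals near $p$. Moreover, for every $p\in U$ and every $n$: 3. If (1) admits $n$ Hamiltonian formulations near $p$, then $\nabla$ admits $n$ linear first integrals near $p$. 4. (1) admits $n$ non-degenerate Hamiltonian formulations near $p$ if and only if $\nabla$ admits $n$ linear first integrals near $p$ each of which satisfies $K_1(p)\neq0$ and $K_2(p)\neq0$. -/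

import Mathlib

open scoped ContDiff

noncomputable section

namespace Hydro

/-- Partial derivative `∂_a φ` of a function of `X = (X 0, X 1)`; the indices `1, 2` of the text
are `0, 1` here. -/
def pd (a : Fin 2) (φ : (Fin 2 → ℝ) → ℝ) (X : Fin 2 → ℝ) : ℝ :=
  fderiv ℝ φ X (Pi.single a 1)

/-! ### The affine connection of a hydrodynamic-type system -/

/-- `A = ∂₂λ¹ / (λ² - λ¹)`. -/
def coefA (l : Fin 2 → (Fin 2 → ℝ) → ℝ) (X : Fin 2 → ℝ) : ℝ :=
  pd 1 (l 0) X / (l 1 X - l 0 X)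

/-- `B = ∂₁λ² / (λ¹ - λ²)`. -/
def coefB (l : Fin 2 → (Fin 2 → ℝ) → ℝ) (X : Fin 2 → ℝ) : ℝ :=
  pd 0 (l 1) X / (l 0 X - l 1 X)

/-- `christoffel l c a b` is `Γ^c_{ab}`. Since `Real.log x = log |x|`, the logarithms make sense
wherever `A` and `B` do not vanish, whatever their signs. -/
def christoffel (l : Fin 2 → (Fin 2 → ℝ) → ℝ) (c a b : Fin 2) (X : Fin 2 → ℝ) : ℝ :=
  match c, a, b with
  | 0, 0, 0 => pd 0 (fun Y => Real.log (coefA l Y)) X - 2 * coefB l X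
  | 1, 1, 1 => pd 1 (fun Y => Real.log (coefB l Y)) X - 2 * coefA l X
  | 0, 0, 1 => -(1 / 2 * pd 1 (fun Y => Real.log (coefA l Y)) X + coefA l X)
  | 0, 1, 0 => -(1 / 2 * pd 1 (fun Y => Real.log (coefA l Y)) X + coefA l X)
  | 1, 0, 1 => -(1 / 2 * pd 0 (fun Y => Real.log (coefB l Y)) X + coefB l X)
  | 1, 1, 0 => -(1 / 2 * pd 0 (fun Y => Real.log (coefB l Y)) X + coefB l X)
  | 0, 1, 1 => 0
  | 1, 0, 0 => 0

/-- `γ : (s, t) → V`, with velocity `v`, is an affinely parametrised geodesic of the connection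
with Christoffel symbols `Γ c a b = Γ^c_{ab}`. -/
def IsGeodesic (Γ : Fin 2 → Fin 2 → Fin 2 → (Fin 2 → ℝ) → ℝ) (V : Set (Fin 2 → ℝ)) (s t : ℝ)
    (γ v : ℝ → Fin 2 → ℝ) : Prop :=
  ∀ τ ∈ Set.Ioo s t, γ τ ∈ V ∧ HasDerivAt γ (v τ) τ ∧
    HasDerivAt v (fun c => -∑ a, ∑ b, Γ c a b (γ τ) * v τ a * v τ b) τ

/-- The smooth one-form `K_a dX^a` on `V` gives a linear first integral `κ = K_a(X) Ẋ^a`: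
`dκ/dτ = 0` along every affinely parametrised geodesic in `V`. -/
def IsLinearFirstIntegral (Γ : Fin 2 → Fin 2 → Fin 2 → (Fin 2 → ℝ) → ℝ) (V : Set (Fin 2 → ℝ))
    (K : Fin 2 → (Fin 2 → ℝ) → ℝ) : Prop :=
  (∀ a, ContDiffOn ℝ ∞ (K a) V) ∧
  ∀ (s t : ℝ) (γ v : ℝ → Fin 2 → ℝ), IsGeodesic Γ V s t γ v →
    ∀ τ ∈ Set.Ioo s t, HasDerivAt (fun σ => ∑ a, K a (γ σ) * v σ a) 0 τ

/-- Linear independence over `ℝ` of finitely many one-forms on `V`. -/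
def IndepForms (V : Set (Fin 2 → ℝ)) {n : ℕ} (K : Fin n → Fin 2 → (Fin 2 → ℝ) → ℝ) : Prop :=
  ∀ c : Fin n → ℝ, (∀ X ∈ V, ∀ a, ∑ i, c i * K i a X = 0) → c = 0

/-- Inside `U`, near `p`, the connection has (at least) `n` linearly independent linear first
integrals. -/
def HasFirstIntegrals (Γ : Fin 2 → Fin 2 → Fin 2 → (Fin 2 → ℝ) → ℝ) (U : Set (Fin 2 → ℝ))
    (p : Fin 2 → ℝ) (n : ℕ) : Prop :=
  ∃ V : Set (Fin 2 → ℝ), IsOpen V ∧ IsConnected V ∧ p ∈ V ∧ V ⊆ U ∧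
    ∃ K : Fin n → Fin 2 → (Fin 2 → ℝ) → ℝ,
      (∀ i, IsLinearFirstIntegral Γ V (K i)) ∧ IndepForms V K

/-- The same, with one-forms `K_1 dX^1 + K_2 dX^2` for which `K_1(p) ≠ 0` and `K_2(p) ≠ 0`. -/
def HasFullFirstIntegrals (Γ : Fin 2 → Fin 2 → Fin 2 → (Fin 2 → ℝ) → ℝ) (U : Set (Fin 2 → ℝ))
    (p : Fin 2 → ℝ) (n : ℕ) : Prop :=
  ∃ V : Set (Fin 2 → ℝ), IsOpen V ∧ IsConnected V ∧ p ∈ V ∧ V ⊆ U ∧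
    ∃ K : Fin n → Fin 2 → (Fin 2 → ℝ) → ℝ,
      (∀ i, IsLinearFirstIntegral Γ V (K i)) ∧ (∀ i a, K i a p ≠ 0) ∧ IndepForms V K

/-! ### Hamiltonian formulations of Dubrovin–Novikov type -/

/-- Smooth maps `ℝ → V`, the points of the phase space `Map(ℝ, V)`. -/
def IsCurveIn (V : Set (Fin 2 → ℝ)) (X : ℝ → Fin 2 → ℝ) : Prop :=
  ContDiff ℝ ∞ X ∧ ∀ x, X x ∈ V

/-- Test covectors: `ξ` is the variational derivative of the smeared coordinate functional
`X ↦ ∫ ξ_a(x) X^a(x) dx`. -/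
def IsTest (ξ : ℝ → Fin 2 → ℝ) : Prop :=
  ContDiff ℝ ∞ ξ ∧ HasCompactSupport ξ

/-- `(Ω η)^a = g^{ab} ∂_x η_b + b^{ab}_c (∂_x X^c) η_b` along the curve `X`; here `g a b = g^{ab}`
and `b a e c = b^{ae}_c`. -/
def applyOp (g : Fin 2 → Fin 2 → (Fin 2 → ℝ) → ℝ) (b : Fin 2 → Fin 2 → Fin 2 → (Fin 2 → ℝ) → ℝ)
    (X η : ℝ → Fin 2 → ℝ) (x : ℝ) (a : Fin 2) : ℝ :=
  ∑ e, (g a e (X x) * deriv (fun s => η s e) x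
    + ∑ c, b a e c (X x) * deriv (fun s => X s c) x * η x e)

/-- The variational derivative `δF/δX^c = ∂L/∂X^c - d/dx (∂L/∂X_x^c)`, along `X`, of the functional
`F[X] = ∫ L(x, X(x), X_x(x)) dx`. -/
def varDeriv (L : ℝ → (Fin 2 → ℝ) → (Fin 2 → ℝ) → ℝ) (X : ℝ → Fin 2 → ℝ) (x : ℝ) (c : Fin 2) : ℝ :=
  pd c (fun u => L x u (deriv X x)) (X x) - deriv (fun s => pd c (L s (X s)) (deriv X s)) x

/-- The density `L(x, X, X_x)` of `{F_ξ, F_η}[X] = ∫ ξ_a (Ω η)^a dx`, where `F_ξ`, `F_η` are the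
smeared coordinate functionals of `ξ` and `η`. -/
def bracketDensity (g : Fin 2 → Fin 2 → (Fin 2 → ℝ) → ℝ)
    (b : Fin 2 → Fin 2 → Fin 2 → (Fin 2 → ℝ) → ℝ) (ξ η : ℝ → Fin 2 → ℝ)
    (x : ℝ) (u w : Fin 2 → ℝ) : ℝ :=
  ∑ a, ∑ e, ξ x a * (g a e u * deriv (fun s => η s e) x + ∑ c, b a e c u * w c * η x e)

/-- The bracket `{F, G}[X] = ∫ (δF/δX^a) Ω^{ab} (δG/δX^b) dx`, as a function of the variational
derivatives `φ`, `ψ` of `F` and `G` along `X`. -/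
def bracket (g : Fin 2 → Fin 2 → (Fin 2 → ℝ) → ℝ) (b : Fin 2 → Fin 2 → Fin 2 → (Fin 2 → ℝ) → ℝ)
    (X φ ψ : ℝ → Fin 2 → ℝ) : ℝ :=
  ∫ x, ∑ a, φ x a * applyOp g b X ψ x a

/-- `Ω` is a Poisson structure on `Map(ℝ, V)`: the bracket of the (smeared) coordinates
`{X^a(x), X^e(y)} = g^{ae} δ'(x - y) + b^{ae}_c X^c_x δ(x - y)` is skew-symmetric and satisfies the
Jacobi identity `{{F_ξ, F_η}, F_ζ} + cyclic = 0`. -/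
structure IsPoisson (V : Set (Fin 2 → ℝ)) (g : Fin 2 → Fin 2 → (Fin 2 → ℝ) → ℝ)
    (b : Fin 2 → Fin 2 → Fin 2 → (Fin 2 → ℝ) → ℝ) : Prop where
  smooth_g : ∀ a e, ContDiffOn ℝ ∞ (g a e) V
  smooth_b : ∀ a e c, ContDiffOn ℝ ∞ (b a e c) V
  skew : ∀ X ξ η, IsCurveIn V X → IsTest ξ → IsTest η → bracket g b X ξ η = -bracket g b X η ξ
  jacobi : ∀ X ξ η ζ, IsCurveIn V X → IsTest ξ → IsTest η → IsTest ζ →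
    bracket g b X (varDeriv (bracketDensity g b ξ η) X) ζ
      + bracket g b X (varDeriv (bracketDensity g b η ζ) X) ξ
      + bracket g b X (varDeriv (bracketDensity g b ζ ξ) X) η = 0

/-- The system `∂_t X^a = λ^a(X) ∂_x X^a` on `V` can be written as `∂_t X^a = Ω^{ab} δH/δX^b` with
the Poisson operator `Ω` and some `H[X] = ∫ h(X) dx`: both sides agree along all curves in `V`. -/
def IsHamiltonianFormulation (l : Fin 2 → (Fin 2 → ℝ) → ℝ) (V : Set (Fin 2 → ℝ))
    (g : Fin 2 → Fin 2 → (Fin 2 → ℝ) → ℝ) (b : Fin 2 → Fin 2 → Fin 2 → (Fin 2 → ℝ) → ℝ) : Prop :=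
  IsPoisson V g b ∧
  ∃ h : (Fin 2 → ℝ) → ℝ, ContDiffOn ℝ ∞ h V ∧
    ∀ X, IsCurveIn V X → ∀ x a,
      l a (X x) * deriv (fun s => X s a) x = applyOp g b X (varDeriv (fun _ u _ => h u) X) x a

/-- Linear independence over `ℝ` of the operators `Ω_i = g_i ∂_x + b_i X_x` on `V`. -/
def IndepOps (V : Set (Fin 2 → ℝ)) {n : ℕ} (g : Fin n → Fin 2 → Fin 2 → (Fin 2 → ℝ) → ℝ)
    (b : Fin n → Fin 2 → Fin 2 → Fin 2 → (Fin 2 → ℝ) → ℝ) : Prop :=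
  ∀ c : Fin n → ℝ, (∀ X ∈ V, ∀ a e, ∑ i, c i * g i a e X = 0) →
    (∀ X ∈ V, ∀ a e d, ∑ i, c i * b i a e d X = 0) → c = 0

/-- Inside `U`, near `p`, the system has (at least) `n` linearly independent Hamiltonian
formulations. -/
def HasHamiltonians (l : Fin 2 → (Fin 2 → ℝ) → ℝ) (U : Set (Fin 2 → ℝ))
    (p : Fin 2 → ℝ) (n : ℕ) : Prop :=
  ∃ V : Set (Fin 2 → ℝ), IsOpen V ∧ IsConnected V ∧ p ∈ V ∧ V ⊆ U ∧
    ∃ (g : Fin n → Fin 2 → Fin 2 → (Fin 2 → ℝ) → ℝ)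
      (b : Fin n → Fin 2 → Fin 2 → Fin 2 → (Fin 2 → ℝ) → ℝ),
      (∀ i, IsHamiltonianFormulation l V (g i) (b i)) ∧ IndepOps V g b

/-- The same, with the matrices `g^{ab}` everywhere non-degenerate. -/
def HasNondegHamiltonians (l : Fin 2 → (Fin 2 → ℝ) → ℝ) (U : Set (Fin 2 → ℝ))
    (p : Fin 2 → ℝ) (n : ℕ) : Prop :=
  ∃ V : Set (Fin 2 → ℝ), IsOpen V ∧ IsConnected V ∧ p ∈ V ∧ V ⊆ U ∧
    ∃ (g : Fin n → Fin 2 → Fin 2 → (Fin 2 → ℝ) → ℝ)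
      (b : Fin n → Fin 2 → Fin 2 → Fin 2 → (Fin 2 → ℝ) → ℝ),
      (∀ i, IsHamiltonianFormulation l V (g i) (b i)) ∧
      (∀ i, ∀ X ∈ V, (Matrix.of fun a e => g i a e X).det ≠ 0) ∧ IndepOps V g b

end Hydro

end

open scoped Topology

noncomputable section

namespace Hydro

variable {V : Set (Fin 2 → ℝ)} {f g : (Fin 2 → ℝ) → ℝ} {X : Fin 2 → ℝ} {a b : Fin 2}

/-! ### Calculus of partial derivatives -/

/-! Indices run over 0, 1 as in the code. The Jacobi identity, tested on suitable curves and
covectors, yields the contravariant forms of vanishing torsion and curvature, valid even where `g`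
degenerates. Combined with the existence of a Hamiltonian density and λ⁰ ≠ λ¹, they force `g` to be
diagonal. Since A and B do not vanish, `g` cannot vanish on an open set. It follows that `b` is
determined by `g`, and that the diagonal entries satisfy ∂₁g⁰⁰ = -2A g⁰⁰, ∂₀g¹¹ = -2B g¹¹ and one
flatness equation (`IsHamiltonianFormulation.diagonalData`). Under the crossed substitution K₀ = A
g¹¹, K₁ = B g⁰⁰ these three equations are exactly the Killing equations of the connection
(`isKilling_iff_isFlatPair`). Hence Hamiltonian formulations give first integrals at every point.

Conversely, a solution of the three equations always defines a Poisson operator (`isPoisson_diag`),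
and only the density h has to be found. On a convex set it exists if both entries are nowhere zero
(`exists_density_nondegenerate`), by passing to a parallel frame of the flat metric, and also if one
entry is nowhere zero and the other vanishes identically (`exists_density_degenerate`), where h is
found almost algebraically. The remaining case, an entry with a zero at the point but not
identically zero nearby, is avoided by passing to a dense open set.

Genericity rests on prolongation: (K₀, K₁, ∂₁K₀) solves a closed linear first-order system, so
Killing forms obey unique continuation and span at most three dimensions. If there are two
independent ones, neither component vanishes for all of them on an open set. In any open set, take
the largest number m of first integrals occurring at a point; near some point there are m
Hamiltonian formulations, and maximality of m then gives the equivalences for all n at once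
(`exists_eventually_isGeneric`). -/

theorem smooth_diffAt (hV : IsOpen V) (hf : ContDiffOn ℝ ∞ f V) (hX : X ∈ V) :
    DifferentiableAt ℝ f X :=
  (hf.differentiableOn (by simp)).differentiableAt (hV.mem_nhds hX)

theorem smooth_pd (hV : IsOpen V) (hf : ContDiffOn ℝ ∞ f V) (a : Fin 2) :
    ContDiffOn ℝ ∞ (pd a f) V :=
  ((contDiffOn_infty_iff_fderiv_of_isOpen hV).1 hf).2.clm_apply contDiffOn_const

theorem pd_congr (hV : IsOpen V) (h : ∀ Y ∈ V, f Y = g Y) (hX : X ∈ V) :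
    pd a f X = pd a g X := by
  have : f =ᶠ[𝓝 X] g := Filter.eventually_of_mem (hV.mem_nhds hX) h
  simp [pd, this.fderiv_eq]

theorem pd_const (c : ℝ) : pd a (fun _ => c) X = 0 := by simp [pd]

theorem pd_add (hV : IsOpen V) (hf : ContDiffOn ℝ ∞ f V) (hg : ContDiffOn ℝ ∞ g V) (hX : X ∈ V) :
    pd a (fun Y => f Y + g Y) X = pd a f X + pd a g X := by
  simp [pd, fderiv_fun_add (smooth_diffAt hV hf hX) (smooth_diffAt hV hg hX)]

theorem pd_sub (hV : IsOpen V) (hf : ContDiffOn ℝ ∞ f V) (hg : ContDiffOn ℝ ∞ g V) (hX : X ∈ V) :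
    pd a (fun Y => f Y - g Y) X = pd a f X - pd a g X := by
  simp [pd, fderiv_fun_sub (smooth_diffAt hV hf hX) (smooth_diffAt hV hg hX)]

theorem pd_neg : pd a (fun Y => -f Y) X = -pd a f X := by
  simp [pd, fderiv_fun_neg]

theorem pd_mul (hV : IsOpen V) (hf : ContDiffOn ℝ ∞ f V) (hg : ContDiffOn ℝ ∞ g V) (hX : X ∈ V) :
    pd a (fun Y => f Y * g Y) X = pd a f X * g X + f X * pd a g X := by
  simp [pd, fderiv_fun_mul (smooth_diffAt hV hf hX) (smooth_diffAt hV hg hX)]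
  ring

theorem pd_const_mul (hV : IsOpen V) (c : ℝ) (hf : ContDiffOn ℝ ∞ f V) (hX : X ∈ V) :
    pd a (fun Y => c * f Y) X = c * pd a f X := by
  rw [pd_mul (f := fun _ => c) hV contDiffOn_const hf hX, pd_const]; ring

theorem pd_comp (hV : IsOpen V) {φ : ℝ → ℝ} {φ' : ℝ} (hf : ContDiffOn ℝ ∞ f V) (hX : X ∈ V)
    (hφ : HasDerivAt φ φ' (f X)) : pd a (fun Y => φ (f Y)) X = φ' * pd a f X := by
  have := hφ.comp_hasFDerivAt X (smooth_diffAt hV hf hX).hasFDerivAt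
  simp only [pd]
  rw [show (fun Y => φ (f Y)) = φ ∘ f from rfl, this.fderiv]
  simp

theorem pd_log (hV : IsOpen V) (hf : ContDiffOn ℝ ∞ f V) (hX : X ∈ V) (h0 : f X ≠ 0) :
    pd a (fun Y => Real.log (f Y)) X = pd a f X / f X := by
  rw [pd_comp hV hf hX (Real.hasDerivAt_log h0)]; ring

theorem pd_comm (hV : IsOpen V) (hf : ContDiffOn ℝ ∞ f V) (hX : X ∈ V) (a b : Fin 2) :
    pd a (pd b f) X = pd b (pd a f) X := by
  have hc : ContDiffAt ℝ ∞ f X := hf.contDiffAt (hV.mem_nhds hX)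
  have hs : IsSymmSndFDerivAt ℝ f X :=
    hc.isSymmSndFDerivAt (by
      simp only [minSmoothness_of_isRCLikeNormedField]
      exact WithTop.coe_le_coe.2 (le_top : (2 : ℕ∞) ≤ ⊤))
  have hd : DifferentiableAt ℝ (fderiv ℝ f) X :=
    (((contDiffOn_infty_iff_fderiv_of_isOpen hV).1 hf).2.differentiableOn
      (by simp)).differentiableAt (hV.mem_nhds hX)
  have key : ∀ c d : Fin 2, pd c (pd d f) X
      = fderiv ℝ (fderiv ℝ f) X (Pi.single c 1) (Pi.single d 1) := by
    intro c d
    simp only [pd]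
    change fderiv ℝ (fun Y => fderiv ℝ f Y (Pi.single d 1)) X _ = _
    rw [fderiv_clm_apply hd (differentiableAt_const _)]
    simp
  rw [key, key]
  exact hs _ _

theorem fderiv_apply_eq (f : (Fin 2 → ℝ) → ℝ) (X v : Fin 2 → ℝ) :
    fderiv ℝ f X v = pd 0 f X * v 0 + pd 1 f X * v 1 := by
  have : v = v 0 • Pi.single 0 1 + v 1 • Pi.single 1 1 := by
    ext i; fin_cases i <;> simp
  conv_lhs => rw [this]
  simp only [map_add, map_smul, pd, smul_eq_mul]
  ring

/-- The chain rule along a curve. -/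
theorem hasDerivAt_along {γ : ℝ → Fin 2 → ℝ} {v : Fin 2 → ℝ} {t : ℝ}
    (hf : DifferentiableAt ℝ f (γ t)) (hγ : HasDerivAt γ v t) :
    HasDerivAt (fun s => f (γ s)) (pd 0 f (γ t) * v 0 + pd 1 f (γ t) * v 1) t := by
  have := hf.hasFDerivAt.comp_hasDerivAt t hγ
  rwa [fderiv_apply_eq] at this

theorem smooth_of_pd (hV : IsOpen V) (hd : ∀ X ∈ V, DifferentiableAt ℝ f X)
    (h : ∀ a, ContDiffOn ℝ ∞ (pd a f) V) : ContDiffOn ℝ ∞ f V := by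
  rw [contDiffOn_infty_iff_fderiv_of_isOpen hV]
  refine ⟨fun X hX => (hd X hX).differentiableWithinAt, ?_⟩
  rw [contDiffOn_clm_apply]
  intro v
  refine ((((h 0).mul contDiffOn_const).add ((h 1).mul contDiffOn_const)) :
    ContDiffOn ℝ ∞ (fun X => pd 0 f X * v 0 + pd 1 f X * v 1) V).congr ?_
  intro X _
  exact fderiv_apply_eq f X v

/-- The Poincaré lemma for smooth one-forms on a convex open subset of the plane. -/
theorem exists_potential (hV : IsOpen V) (hc : Convex ℝ V) {P Q : (Fin 2 → ℝ) → ℝ}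
    (hP : ContDiffOn ℝ ∞ P V) (hQ : ContDiffOn ℝ ∞ Q V)
    (hPQ : ∀ X ∈ V, pd 1 P X = pd 0 Q X) :
    ∃ h : (Fin 2 → ℝ) → ℝ, ContDiffOn ℝ ∞ h V ∧ (∀ X ∈ V, pd 0 h X = P X) ∧
      ∀ X ∈ V, pd 1 h X = Q X := by
  let p : Fin 2 → (Fin 2 → ℝ) →L[ℝ] ℝ := fun i => ContinuousLinearMap.proj i
  let w : (Fin 2 → ℝ) → (Fin 2 → ℝ) →L[ℝ] ℝ := fun X => P X • p 0 + Q X • p 1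
  have hw : ∀ X ∈ V, HasFDerivAt w
      ((fderiv ℝ P X).smulRight (p 0) + (fderiv ℝ Q X).smulRight (p 1)) X := fun X hX =>
    ((smooth_diffAt hV hP hX).hasFDerivAt.smul_const (p 0)).add
      ((smooth_diffAt hV hQ hX).hasFDerivAt.smul_const (p 1))
  obtain ⟨h, hh⟩ := hc.exists_forall_hasFDerivAt_of_fderiv_symmetric hV
    (fun X hX => (hw X hX).differentiableAt.differentiableWithinAt) (by
      intro X hX x y
      rw [(hw X hX).fderiv]
      simp only [_root_.add_apply, ContinuousLinearMap.smulRight_apply,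
        _root_.smul_apply, p, ContinuousLinearMap.proj_apply, smul_eq_mul,
        fderiv_apply_eq, hPQ X hX]
      ring)
  have h0 : ∀ X ∈ V, pd 0 h X = P X := fun X hX => by
    simp [pd, (hh X hX).fderiv, w, p]
  have h1 : ∀ X ∈ V, pd 1 h X = Q X := fun X hX => by
    simp [pd, (hh X hX).fderiv, w, p]
  refine ⟨h, smooth_of_pd hV (fun X hX => (hh X hX).differentiableAt) ?_, h0, h1⟩
  intro a
  fin_cases a
  · exact hP.congr h0
  · exact hQ.congr h1

end Hydro
end

noncomputable section

namespace Hydro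

/-! ### The fundamental lemma of the calculus of variations -/

/-- Integration by parts moves the derivative from α to p; the fundamental lemma gives equality
almost everywhere, and continuity gives it everywhere. This turns each integrated bracket identity
into a pointwise one. -/
theorem deriv_eq_of_integral_eq_zero {p q : ℝ → ℝ} (hp : ContDiff ℝ ∞ p) (hq : ContDiff ℝ ∞ q)
    (h : ∀ α : ℝ → ℝ, ContDiff ℝ ∞ α → HasCompactSupport α →
      ∫ x, (p x * deriv α x + q x * α x) = 0) (x : ℝ) : q x = deriv p x := by
  have hp' : Continuous (deriv p) := hp.continuous_deriv (by simp)
  have hc : Continuous fun x => q x - deriv p x := hq.continuous.sub hp'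
  have key : ∀ᵐ x, q x - deriv p x = 0 := by
    refine ae_eq_zero_of_integral_contDiff_smul_eq_zero hc.locallyIntegrable ?_
    intro α hα hcs
    have hα' : Continuous (deriv α) := hα.continuous_deriv (by simp)
    have i1 : MeasureTheory.Integrable fun x => p x * deriv α x :=
      (hp.continuous.mul hα').integrable_of_hasCompactSupport hcs.deriv.mul_left
    have i2 : MeasureTheory.Integrable fun x => q x * α x :=
      (hq.continuous.mul hα.continuous).integrable_of_hasCompactSupport hcs.mul_left
    have i3 : MeasureTheory.Integrable fun x => deriv p x * α x :=
      (hp'.mul hα.continuous).integrable_of_hasCompactSupport hcs.mul_left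
    have i4 : MeasureTheory.Integrable fun x => p x * α x :=
      (hp.continuous.mul hα.continuous).integrable_of_hasCompactSupport hcs.mul_left
    have e := MeasureTheory.integral_mul_deriv_eq_deriv_mul_of_integrable
      (u := p) (v := α) (u' := deriv p) (v' := deriv α)
      (fun x _ => (hp.differentiable (by simp) x).hasDerivAt)
      (fun x _ => (hα.differentiable (by simp) x).hasDerivAt) i1 i3 i4
    have h0 := h α hα hcs
    rw [MeasureTheory.integral_add i1 i2, e] at h0
    have : (fun x => α x • (q x - deriv p x)) = fun x => q x * α x - deriv p x * α x := by
      funext x; simp only [smul_eq_mul]; ring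
    rw [this, MeasureTheory.integral_sub i2 i3]
    linarith
  have := MeasureTheory.Measure.eq_of_ae_eq (μ := MeasureTheory.volume) key hc continuous_const
  linarith [congrFun this x]

/-- Test functions with a prescribed jet at 0 pick out single coefficients of the pointwise
identities. -/
theorem exists_test_germ (k : ℕ) : ∃ β : ℝ → ℝ, ContDiff ℝ ∞ β ∧ HasCompactSupport β ∧
    β =ᶠ[𝓝 0] fun x => x ^ k := by
  let c : ContDiffBump (0 : ℝ) := ⟨1, 2, by norm_num, by norm_num⟩
  refine ⟨fun x => c x * x ^ k, c.contDiff.mul (contDiff_id.pow k), c.hasCompactSupport.mul_right, ?_⟩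
  filter_upwards [c.eventuallyEq_one] with x hx
  simp [hx]

theorem deriv_mul_of_eq_zero {u v : ℝ → ℝ} {x : ℝ} (hu : ContDiff ℝ ∞ u) (hv : ContDiff ℝ ∞ v)
    (h : u x = 0) : deriv (fun s => u s * v s) x = deriv u x * v x := by
  rw [deriv_fun_mul (hu.differentiable (by simp) x) (hv.differentiable (by simp) x), h]
  ring

variable {V : Set (Fin 2 → ℝ)} {g : Fin 2 → Fin 2 → (Fin 2 → ℝ) → ℝ}
  {b : Fin 2 → Fin 2 → Fin 2 → (Fin 2 → ℝ) → ℝ}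

/-! ### Curves and test covectors -/

/-- A straight line may leave V, and curves are defined on all of ℝ. The oscillation δ sin(s/δ) v
has velocity v at 0 and stays within δ‖v‖ < r of u. -/
theorem exists_curve_velocity (hV : IsOpen V) {u : Fin 2 → ℝ} (hu : u ∈ V) (v : Fin 2 → ℝ) :
    ∃ X, IsCurveIn V X ∧ X 0 = u ∧ ∀ c, deriv (fun s => X s c) 0 = v c := by
  obtain ⟨r, hr, hball⟩ := Metric.isOpen_iff.1 hV u hu
  set δ : ℝ := r / (2 * (‖v‖ + 1)) with hδ
  have hn : 0 ≤ ‖v‖ := norm_nonneg v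
  have hδ0 : 0 < δ := by positivity
  refine ⟨fun s => u + (δ * Real.sin (s / δ)) • v, ⟨?_, fun s => hball ?_⟩, by simp, fun c => ?_⟩
  · exact contDiff_const.add ((contDiff_const.mul
      (Real.contDiff_sin.comp (contDiff_id.div_const δ))).smul contDiff_const)
  · rw [Metric.mem_ball, dist_eq_norm, add_sub_cancel_left, norm_smul, Real.norm_eq_abs, abs_mul,
      abs_of_pos hδ0]
    have h1 : |Real.sin (s / δ)| ≤ 1 := Real.abs_sin_le_one _
    have h2 : δ * (2 * (‖v‖ + 1)) = r := by rw [hδ]; field_simp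
    have h3 : δ * |Real.sin (s / δ)| * ‖v‖ ≤ δ * 1 * ‖v‖ := by gcongr
    nlinarith
  · have h1 : HasDerivAt (fun s : ℝ => s / δ) (1 / δ) 0 := (hasDerivAt_id 0).div_const δ
    have h2 := (((h1.sin).const_mul δ).mul_const (v c)).const_add (u c)
    have : (fun s => (u + (δ * Real.sin (s / δ)) • v) c)
        = fun s => u c + δ * Real.sin (s / δ) * v c := by funext s; simp
    rw [this, h2.deriv]
    simp only [zero_div, Real.cos_zero]
    field_simp

/-- The motion (r/2) sin² s along the axis d stays in the ball of radius r; at 0 it has velocity 0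
and acceleration r. Zero velocity removes all terms that are products of first derivatives. -/
theorem exists_curve_acceleration (hV : IsOpen V) {u : Fin 2 → ℝ} (hu : u ∈ V) (d : Fin 2) :
    ∃ X, IsCurveIn V X ∧ X 0 = u ∧ (∀ c, deriv (fun s => X s c) 0 = 0) ∧
      ∃ k : ℝ, k ≠ 0 ∧ ∀ c, deriv (deriv fun s => X s c) 0 = k * Pi.single (M := fun _ => ℝ) d 1 c := by
  obtain ⟨r, hr, hball⟩ := Metric.isOpen_iff.1 hV u hu
  have hd : ∀ c : Fin 2, deriv (fun s => (u + (r / 2 * Real.sin s ^ 2) • (Pi.single d 1 : Fin 2 → ℝ)) c)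
      = fun s => r * Real.sin s * Real.cos s * (Pi.single d 1 : Fin 2 → ℝ) c := by
    intro c
    funext s
    have h2 := ((((Real.hasDerivAt_sin s).pow 2).const_mul (r / 2)).mul_const
      ((Pi.single d 1 : Fin 2 → ℝ) c)).const_add (u c)
    have : (fun s => (u + (r / 2 * Real.sin s ^ 2) • (Pi.single d 1 : Fin 2 → ℝ)) c)
        = fun s => u c + r / 2 * Real.sin s ^ 2 * (Pi.single d 1 : Fin 2 → ℝ) c := by
      funext s; simp
    rw [this]
    refine h2.deriv.trans ?_
    norm_num
    left; ring
  refine ⟨fun s => u + (r / 2 * Real.sin s ^ 2) • (Pi.single d 1 : Fin 2 → ℝ),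
    ⟨?_, fun s => hball ?_⟩, by simp, fun c => ?_, r, hr.ne', fun c => ?_⟩
  · exact contDiff_const.add ((contDiff_const.mul (Real.contDiff_sin.pow 2)).smul contDiff_const)
  · rw [Metric.mem_ball, dist_eq_norm, add_sub_cancel_left, norm_smul, Real.norm_eq_abs, abs_mul,
      abs_of_pos (by positivity : 0 < r / 2), abs_of_nonneg (sq_nonneg _)]
    have h1 : Real.sin s ^ 2 ≤ 1 := Real.sin_sq_le_one s
    have h2 : ‖(Pi.single d 1 : Fin 2 → ℝ)‖ = 1 := by
      rw [Pi.norm_single]; simp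
    rw [h2]
    nlinarith
  · rw [hd]; simp
  · rw [hd]
    have h2 := (((Real.hasDerivAt_sin 0).mul (Real.hasDerivAt_cos 0)).const_mul r).mul_const
      ((Pi.single d 1 : Fin 2 → ℝ) c)
    have : (fun s => r * Real.sin s * Real.cos s * (Pi.single d 1 : Fin 2 → ℝ) c)
        = fun s => r * (Real.sin s * Real.cos s) * (Pi.single d 1 : Fin 2 → ℝ) c := by
      funext s; ring
    rw [this]
    refine h2.deriv.trans ?_
    simp

/-- The covector field `α dX^i`. -/
def testAlong (i : Fin 2) (α : ℝ → ℝ) (x : ℝ) : Fin 2 → ℝ := Pi.single i (α x)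

theorem isTest_testAlong (i : Fin 2) {α : ℝ → ℝ} (hα : ContDiff ℝ ∞ α) (hc : HasCompactSupport α) :
    IsTest (testAlong i α) := by
  refine ⟨contDiff_pi.2 fun c => ?_, ?_⟩
  · by_cases h : c = i
    · subst h; simpa [testAlong] using hα
    · simpa [testAlong, h] using contDiff_const
  · exact hc.comp_left (g := fun r => (Pi.single i r : Fin 2 → ℝ)) (by simp)

theorem testAlong_apply (i c : Fin 2) (α : ℝ → ℝ) (x : ℝ) :
    testAlong i α x c = if c = i then α x else 0 := by
  simp [testAlong, Pi.single_apply]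

theorem deriv_testAlong (i c : Fin 2) (α : ℝ → ℝ) (x : ℝ) :
    deriv (fun s => testAlong i α s c) x = if c = i then deriv α x else 0 := by
  by_cases h : c = i <;> simp [testAlong_apply, h]

/-! ### Smoothness along a curve -/

theorem smooth_along {X : ℝ → Fin 2 → ℝ} (hV : IsOpen V) (hX : IsCurveIn V X)
    {f : (Fin 2 → ℝ) → ℝ} (hf : ContDiffOn ℝ ∞ f V) : ContDiff ℝ ∞ fun s => f (X s) := by
  rw [contDiff_iff_contDiffAt]
  intro s
  exact (hf.contDiffAt (hV.mem_nhds (hX.2 s))).comp s hX.1.contDiffAt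

theorem smooth_coord {X : ℝ → Fin 2 → ℝ} (hX : ContDiff ℝ ∞ X) (c : Fin 2) :
    ContDiff ℝ ∞ fun s => X s c := contDiff_pi.1 hX c

theorem smooth_deriv {α : ℝ → ℝ} (hα : ContDiff ℝ ∞ α) : ContDiff ℝ ∞ (deriv α) :=
  (contDiff_infty_iff_deriv.1 hα).2

theorem hasDerivAt_coord {α : ℝ → ℝ} (hα : ContDiff ℝ ∞ α) (x : ℝ) : HasDerivAt α (deriv α x) x :=
  (hα.differentiable (by simp) x).hasDerivAt

theorem deriv_curve {X : ℝ → Fin 2 → ℝ} (hX : ContDiff ℝ ∞ X) (x : ℝ) (c : Fin 2) :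
    deriv X x c = deriv (fun s => X s c) x := by
  rw [deriv_pi fun i => (smooth_coord hX i).differentiable (by simp) x]

theorem hasDerivAt_field {X : ℝ → Fin 2 → ℝ} (hV : IsOpen V) (hX : IsCurveIn V X)
    {f : (Fin 2 → ℝ) → ℝ} (hf : ContDiffOn ℝ ∞ f V) (x : ℝ) :
    HasDerivAt (fun s => f (X s)) (∑ d, pd d f (X x) * deriv (fun s => X s d) x) x := by
  have h1 : HasDerivAt X (deriv X x) x := (hX.1.differentiable (by simp) x).hasDerivAt
  have := hasDerivAt_along (smooth_diffAt hV hf (hX.2 x)) h1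
  simpa [Fin.sum_univ_two, deriv_curve hX.1] using this

/-! ### The variational derivative of a bracket of coordinates -/

/-- `∂_c b^{ae}_d - ∂_d b^{ae}_c`. -/
def curl (b : Fin 2 → Fin 2 → Fin 2 → (Fin 2 → ℝ) → ℝ) (a e c d : Fin 2) (X : Fin 2 → ℝ) : ℝ :=
  pd c (b a e d) X - pd d (b a e c) X

theorem smooth_curl (hV : IsOpen V) (hb : ∀ a e c, ContDiffOn ℝ ∞ (b a e c) V) (a e c d : Fin 2) :
    ContDiffOn ℝ ∞ (curl b a e c d) V :=
  (smooth_pd hV (hb a e d) c).sub (smooth_pd hV (hb a e c) d)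

theorem hasFDerivAt_pd {f : (Fin 2 → ℝ) → ℝ} {f' : (Fin 2 → ℝ) →L[ℝ] ℝ} {X : Fin 2 → ℝ}
    (h : HasFDerivAt f f' X) (c : Fin 2) : pd c f X = f' (Pi.single c 1) := by
  rw [pd, h.fderiv]

theorem pd_density_position (hV : IsOpen V) (hg : ∀ a e, ContDiffOn ℝ ∞ (g a e) V)
    (hb : ∀ a e c, ContDiffOn ℝ ∞ (b a e c) V) (ξ η : ℝ → Fin 2 → ℝ) (x : ℝ) (w : Fin 2 → ℝ)
    {u : Fin 2 → ℝ} (hu : u ∈ V) (c : Fin 2) :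
    pd c (fun u => bracketDensity g b ξ η x u w) u = ∑ a, ∑ e, ξ x a *
      (pd c (g a e) u * deriv (fun s => η s e) x + ∑ d, pd c (b a e d) u * w d * η x e) := by
  have h : HasFDerivAt (fun u => bracketDensity g b ξ η x u w)
      (∑ a, ∑ e, ξ x a • (deriv (fun s => η s e) x • fderiv ℝ (g a e) u
        + ∑ d, η x e • w d • fderiv ℝ (b a e d) u)) u := by
    unfold bracketDensity
    refine HasFDerivAt.fun_sum fun a _ => HasFDerivAt.fun_sum fun e _ => ?_
    refine HasFDerivAt.const_mul ?_ _
    refine ((smooth_diffAt hV (hg a e) hu).hasFDerivAt.mul_const _).add ?_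
    refine HasFDerivAt.fun_sum fun d _ => ?_
    exact ((smooth_diffAt hV (hb a e d) hu).hasFDerivAt.mul_const _).mul_const _
  rw [hasFDerivAt_pd h]
  simp only [_root_.sum_apply, _root_.smul_apply, _root_.add_apply, smul_eq_mul, pd]
  refine Finset.sum_congr rfl fun a _ => Finset.sum_congr rfl fun e _ => ?_
  congr 1
  congr 1
  · ring
  · exact Finset.sum_congr rfl fun d _ => by ring

theorem pd_density_velocity (ξ η : ℝ → Fin 2 → ℝ) (x : ℝ) (u w : Fin 2 → ℝ) (c : Fin 2) :
    pd c (bracketDensity g b ξ η x u) w = ∑ a, ∑ e, ξ x a * b a e c u * η x e := by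
  have hp : ∀ d : Fin 2, HasFDerivAt (fun w : Fin 2 → ℝ => w d)
      (ContinuousLinearMap.proj d : (Fin 2 → ℝ) →L[ℝ] ℝ) w := fun d =>
    (ContinuousLinearMap.proj (R := ℝ) (φ := fun _ : Fin 2 => ℝ) d).hasFDerivAt
  have h : HasFDerivAt (fun w => ∑ a, ∑ e, ξ x a * (g a e u * deriv (fun s => η s e) x
      + ∑ c, b a e c u * w c * η x e))
      (∑ a, ∑ e, ξ x a • (∑ d, η x e • b a e d u •
        (ContinuousLinearMap.proj d : (Fin 2 → ℝ) →L[ℝ] ℝ))) w :=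
    HasFDerivAt.fun_sum fun a _ => HasFDerivAt.fun_sum fun e _ =>
      HasFDerivAt.const_mul (HasFDerivAt.const_add _ (HasFDerivAt.fun_sum fun d _ =>
        ((hp d).const_mul _).mul_const _)) _
  change pd c (fun w => ∑ a, ∑ e, ξ x a * (g a e u * deriv (fun s => η s e) x
      + ∑ c, b a e c u * w c * η x e)) w = _
  rw [hasFDerivAt_pd h]
  simp only [_root_.sum_apply, _root_.smul_apply, smul_eq_mul, ContinuousLinearMap.proj_apply]
  refine Finset.sum_congr rfl fun a _ => Finset.sum_congr rfl fun e _ => ?_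
  rw [mul_assoc]
  congr 1
  simp [Pi.single_apply, mul_comm]

/-- The density is affine in the velocity, so no second derivative of X survives: the terms with ∂b
combine into the curl, and differentiating ξ and η in the total derivative gives the rest. -/
theorem varDeriv_density (hV : IsOpen V) (hg : ∀ a e, ContDiffOn ℝ ∞ (g a e) V)
    (hb : ∀ a e c, ContDiffOn ℝ ∞ (b a e c) V) {X ξ η : ℝ → Fin 2 → ℝ} (hX : IsCurveIn V X)
    (hξ : ContDiff ℝ ∞ ξ) (hη : ContDiff ℝ ∞ η) (x : ℝ) (c : Fin 2) :
    varDeriv (bracketDensity g b ξ η) X x c = ∑ a, ∑ e,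
      (ξ x a * ((pd c (g a e) (X x) - b a e c (X x)) * deriv (fun s => η s e) x)
        - deriv (fun s => ξ s a) x * b a e c (X x) * η x e
        + ξ x a * η x e * ∑ d, curl b a e c d (X x) * deriv (fun s => X s d) x) := by
  have h : HasDerivAt (fun s => pd c (bracketDensity g b ξ η s (X s)) (deriv X s))
      (∑ a, ∑ e, ((deriv (fun s => ξ s a) x * b a e c (X x)
        + ξ x a * ∑ d, pd d (b a e c) (X x) * deriv (fun s => X s d) x) * η x e
        + ξ x a * b a e c (X x) * deriv (fun s => η s e) x)) x := by
    simp only [pd_density_velocity]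
    refine HasDerivAt.fun_sum fun a _ => HasDerivAt.fun_sum fun e _ => ?_
    exact ((hasDerivAt_coord (smooth_coord hξ a) x).mul (hasDerivAt_field hV hX (hb a e c) x)).mul
      (hasDerivAt_coord (smooth_coord hη e) x)
  rw [varDeriv, h.deriv, pd_density_position hV hg hb ξ η x _ (hX.2 x)]
  simp only [deriv_curve hX.1, ← Finset.sum_sub_distrib]
  refine Finset.sum_congr rfl fun a _ => Finset.sum_congr rfl fun e _ => ?_
  simp only [curl, Fin.sum_univ_two]
  ring

theorem varDeriv_function (h : (Fin 2 → ℝ) → ℝ) (X : ℝ → Fin 2 → ℝ) (x : ℝ) (c : Fin 2) :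
    varDeriv (fun _ u _ => h u) X x c = pd c h (X x) := by
  simp [varDeriv, pd]

end Hydro
end

noncomputable section

namespace Hydro

variable {V : Set (Fin 2 → ℝ)} {g : Fin 2 → Fin 2 → (Fin 2 → ℝ) → ℝ}
  {b : Fin 2 → Fin 2 → Fin 2 → (Fin 2 → ℝ) → ℝ}

/-! ### Integrability of the bracket densities -/

theorem smooth_applyOp (hV : IsOpen V) (hg : ∀ a e, ContDiffOn ℝ ∞ (g a e) V)
    (hb : ∀ a e c, ContDiffOn ℝ ∞ (b a e c) V) {X η : ℝ → Fin 2 → ℝ} (hX : IsCurveIn V X)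
    (hη : ContDiff ℝ ∞ η) (a : Fin 2) : ContDiff ℝ ∞ fun x => applyOp g b X η x a := by
  unfold applyOp
  refine ContDiff.sum fun e _ => ContDiff.add ?_ (ContDiff.sum fun c _ => ?_)
  · exact (smooth_along hV hX (hg a e)).mul (smooth_deriv (smooth_coord hη e))
  · exact ((smooth_along hV hX (hb a e c)).mul (smooth_deriv (smooth_coord hX.1 c))).mul
      (smooth_coord hη e)

theorem applyOp_eq_zero (X : ℝ → Fin 2 → ℝ) {η : ℝ → Fin 2 → ℝ} {x : ℝ} (hx : x ∉ tsupport η)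
    (a : Fin 2) : applyOp g b X η x a = 0 := by
  have h0 : η =ᶠ[𝓝 x] 0 := notMem_tsupport_iff_eventuallyEq.1 hx
  have h1 : ∀ e, deriv (fun s => η s e) x = 0 := fun e => by
    have : (fun s => η s e) =ᶠ[𝓝 x] fun _ => 0 := by
      filter_upwards [h0] with s hs
      simp [hs]
    rw [this.deriv_eq]; simp
  simp [applyOp, h1, h0.self_of_nhds]

theorem integrable_bracket (hV : IsOpen V) (hg : ∀ a e, ContDiffOn ℝ ∞ (g a e) V)
    (hb : ∀ a e c, ContDiffOn ℝ ∞ (b a e c) V) {X φ η : ℝ → Fin 2 → ℝ} (hX : IsCurveIn V X)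
    (hφ : ∀ a, Continuous fun x => φ x a) (hη : IsTest η) :
    MeasureTheory.Integrable fun x => ∑ a, φ x a * applyOp g b X η x a := by
  refine Continuous.integrable_of_hasCompactSupport ?_ ?_
  · exact continuous_finsetSum _ fun a _ =>
      (hφ a).mul (smooth_applyOp hV hg hb hX hη.1 a).continuous
  · refine HasCompactSupport.intro hη.2.isCompact fun x hx => ?_
    simp [applyOp_eq_zero X hx]

theorem continuous_varDeriv (hV : IsOpen V) (hg : ∀ a e, ContDiffOn ℝ ∞ (g a e) V)
    (hb : ∀ a e c, ContDiffOn ℝ ∞ (b a e c) V) {X ξ η : ℝ → Fin 2 → ℝ} (hX : IsCurveIn V X)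
    (hξ : IsTest ξ) (hη : IsTest η) (c : Fin 2) :
    Continuous fun x => varDeriv (bracketDensity g b ξ η) X x c := by
  simp only [varDeriv_density hV hg hb hX hξ.1 hη.1]
  have h1 := fun a => (smooth_coord hξ.1 a).continuous
  have h2 := fun a => (smooth_coord hη.1 a).continuous
  have h3 := fun a => (smooth_deriv (smooth_coord hξ.1 a)).continuous
  have h4 := fun a => (smooth_deriv (smooth_coord hη.1 a)).continuous
  have h5 := fun a => (smooth_deriv (smooth_coord hX.1 a)).continuous
  have h6 := fun a e c => (smooth_along hV hX (hb a e c)).continuous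
  have h7 := fun a e => (smooth_along hV hX (smooth_pd hV (hg a e) c)).continuous
  have h8 := fun a e d => (smooth_along hV hX (smooth_curl hV hb a e c d)).continuous
  refine continuous_finsetSum _ fun a _ => continuous_finsetSum _ fun e _ => ?_
  refine (((h1 a).mul (((h7 a e).sub (h6 a e c)).mul (h4 e))).sub
    (((h3 a).mul (h6 a e c)).mul (h2 e))).add (((h1 a).mul (h2 e)).mul ?_)
  exact continuous_finsetSum _ fun d _ => (h8 a e d).mul (h5 d)

theorem jacobi_eq_integral (hV : IsOpen V) (hg : ∀ a e, ContDiffOn ℝ ∞ (g a e) V)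
    (hb : ∀ a e c, ContDiffOn ℝ ∞ (b a e c) V) {X ξ η ζ : ℝ → Fin 2 → ℝ} (hX : IsCurveIn V X)
    (hξ : IsTest ξ) (hη : IsTest η) (hζ : IsTest ζ) :
    bracket g b X (varDeriv (bracketDensity g b ξ η) X) ζ
      + bracket g b X (varDeriv (bracketDensity g b η ζ) X) ξ
      + bracket g b X (varDeriv (bracketDensity g b ζ ξ) X) η
    = ∫ x, ((∑ c, varDeriv (bracketDensity g b ξ η) X x c * applyOp g b X ζ x c)
      + (∑ c, varDeriv (bracketDensity g b η ζ) X x c * applyOp g b X ξ x c)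
      + ∑ c, varDeriv (bracketDensity g b ζ ξ) X x c * applyOp g b X η x c) := by
  have i1 := integrable_bracket hV hg hb hX (continuous_varDeriv hV hg hb hX hξ hη) hζ
  have i2 := integrable_bracket hV hg hb hX (continuous_varDeriv hV hg hb hX hη hζ) hξ
  have i3 := integrable_bracket hV hg hb hX (continuous_varDeriv hV hg hb hX hζ hξ) hη
  exact ((MeasureTheory.integral_add (i1.add i2) i3).trans
    (congrArg (· + _) (MeasureTheory.integral_add i1 i2))).symm

/-! ### Local conditions implied by a Poisson bracket -/

theorem applyOp_testAlong (X : ℝ → Fin 2 → ℝ) (k : Fin 2) (γ : ℝ → ℝ) (x : ℝ) (a : Fin 2) :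
    applyOp g b X (testAlong k γ) x a = g a k (X x) * deriv γ x
      + (∑ d, b a k d (X x) * deriv (fun s => X s d) x) * γ x := by
  simp only [applyOp, deriv_testAlong]
  simp only [testAlong_apply, mul_ite, mul_zero, Finset.sum_add_distrib,
    Finset.sum_mul]
  rw [Finset.sum_comm]
  simp

/-- Skew-symmetry is tested on α dXⁱ and β dXʲ, and the arbitrary α is eliminated by
`deriv_eq_of_integral_eq_zero`. -/
theorem IsPoisson.skew_testAlong (h : IsPoisson V g b) (hV : IsOpen V) {X : ℝ → Fin 2 → ℝ}
    (hX : IsCurveIn V X) (i j : Fin 2) {β : ℝ → ℝ} (hβ : ContDiff ℝ ∞ β)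
    (hβc : HasCompactSupport β) (x : ℝ) :
    g i j (X x) * deriv β x + (∑ d, b i j d (X x) * deriv (fun s => X s d) x) * β x
      + (∑ d, b j i d (X x) * deriv (fun s => X s d) x) * β x
      = deriv (fun s => g j i (X s) * β s) x := by
  have hs : ∀ a e, ContDiff ℝ ∞ fun s => ∑ d, b a e d (X s) * deriv (fun s => X s d) s := fun a e =>
    ContDiff.sum fun d _ => (smooth_along hV hX (h.smooth_b a e d)).mul
      (smooth_deriv (smooth_coord hX.1 d))
  refine deriv_eq_of_integral_eq_zero (p := fun s => g j i (X s) * β s)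
    (q := fun x => g i j (X x) * deriv β x
      + (∑ d, b i j d (X x) * deriv (fun s => X s d) x) * β x
      + (∑ d, b j i d (X x) * deriv (fun s => X s d) x) * β x)
    ((smooth_along hV hX (h.smooth_g j i)).mul hβ)
    ((((smooth_along hV hX (h.smooth_g i j)).mul (smooth_deriv hβ)).add ((hs i j).mul hβ)).add
      ((hs j i).mul hβ)) (fun α hα hαc => ?_) x
  have t1 := isTest_testAlong i hα hαc
  have t2 := isTest_testAlong j hβ hβc
  have e := h.skew X _ _ hX t1 t2
  have i1 := integrable_bracket hV h.smooth_g h.smooth_b hX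
    (fun a => (smooth_coord t1.1 a).continuous) t2
  have i2 := integrable_bracket hV h.smooth_g h.smooth_b hX
    (fun a => (smooth_coord t2.1 a).continuous) t1
  rw [eq_neg_iff_add_eq_zero, bracket, bracket, ← MeasureTheory.integral_add i1 i2] at e
  rw [← e]
  congr 1
  funext x
  simp only [testAlong_apply, applyOp_testAlong, ite_mul, zero_mul, Finset.sum_ite_eq',
    Finset.mem_univ, if_true]
  ring

theorem IsPoisson.symm_g (h : IsPoisson V g b) (hV : IsOpen V) {u : Fin 2 → ℝ} (hu : u ∈ V)
    (i j : Fin 2) : g i j u = g j i u := by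
  obtain ⟨X, hX, hX0, hX1⟩ := exists_curve_velocity hV hu 0
  -- With β(0) = 0 and β'(0) = 1 only the metric terms survive at 0.
  obtain ⟨β, hβ, hβc, hg⟩ := exists_test_germ 1
  have hs := h.skew_testAlong hV hX i j hβ hβc 0
  have hd : deriv β 0 = 1 := by rw [hg.deriv_eq]; simp
  have h0 : β 0 = 0 := by rw [hg.self_of_nhds]; simp
  rw [((smooth_along hV hX (h.smooth_g j i)).differentiable (by simp) 0 |>.hasDerivAt.fun_mul
    (hasDerivAt_coord hβ 0)).deriv, hd, h0, hX0] at hs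
  simpa using hs

theorem IsPoisson.pd_g (h : IsPoisson V g b) (hV : IsOpen V) {u : Fin 2 → ℝ} (hu : u ∈ V)
    (i j c : Fin 2) : pd c (g i j) u = b i j c u + b j i c u := by
  obtain ⟨X, hX, hX0, hX1⟩ := exists_curve_velocity hV hu (Pi.single c 1)
  -- With β = 1 near 0 only the zeroth-order terms survive, and the velocity chosen for X selects
  -- the index c.
  obtain ⟨β, hβ, hβc, hg⟩ := exists_test_germ 0
  have hs := h.skew_testAlong hV hX j i hβ hβc 0
  have hd : deriv β 0 = 0 := by rw [hg.deriv_eq]; simp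
  have h0 : β 0 = 1 := by rw [hg.self_of_nhds]; simp
  rw [((hasDerivAt_field hV hX (h.smooth_g i j) 0).fun_mul (hasDerivAt_coord hβ 0)).deriv, hd, h0,
    hX0] at hs
  simp only [hX1, Pi.single_apply, mul_ite, mul_one, mul_zero, Finset.sum_ite_eq',
    Finset.mem_univ, if_true] at hs
  linarith

theorem IsPoisson.varDeriv_testAlong (h : IsPoisson V g b) (hV : IsOpen V) {X : ℝ → Fin 2 → ℝ}
    (hX : IsCurveIn V X) (i j : Fin 2) {α β : ℝ → ℝ} (hα : IsTest (testAlong i α))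
    (hβ : IsTest (testAlong j β)) (x : ℝ) (c : Fin 2) :
    varDeriv (bracketDensity g b (testAlong i α) (testAlong j β)) X x c =
      b j i c (X x) * α x * deriv β x - b i j c (X x) * deriv α x * β x
        + α x * β x * ∑ d, curl b i j c d (X x) * deriv (fun s => X s d) x := by
  rw [varDeriv_density hV h.smooth_g h.smooth_b hX hα.1 hβ.1]
  simp only [deriv_testAlong]
  simp only [testAlong_apply, ite_mul, mul_ite, zero_mul, mul_zero,
    Finset.sum_add_distrib, Finset.sum_sub_distrib, Finset.sum_ite_eq', Finset.mem_univ, if_true]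
  rw [h.pd_g hV (hX.2 x)]
  ring

/-- The Jacobi identity for α dXⁱ, β dXʲ, γ dXᵏ has an integrand p α' + q α, so q = p' pointwise.
The jets of β, γ and X at 0 are chosen so that only the coefficients of β'' and X'' remain: the
torsion and the curvature expressions. -/
theorem IsPoisson.jacobi_germ (h : IsPoisson V g b) (hV : IsOpen V) {X : ℝ → Fin 2 → ℝ}
    (hX : IsCurveIn V X) (hX1 : ∀ c, deriv (fun s => X s c) 0 = 0) (i j k : Fin 2) {β γ : ℝ → ℝ}
    (hβ : ContDiff ℝ ∞ β) (hβc : HasCompactSupport β)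
    (hγ : ContDiff ℝ ∞ γ) (hγc : HasCompactSupport γ) (hβ1 : deriv β 0 = 0) (hγ0 : γ 0 = 1)
    (hγ1 : deriv γ 0 = 0) (hγ2 : deriv (deriv γ) 0 = 0) :
    deriv (deriv β) 0 * ∑ c, (b i k c (X 0) * g c j (X 0) - b j k c (X 0) * g c i (X 0))
      + β 0 * ∑ d, deriv (deriv fun s => X s d) 0 * ∑ c, (curl b j k c d (X 0) * g c i (X 0)
        + b i k c (X 0) * b c j d (X 0) - b i j c (X 0) * b c k d (X 0)) = 0 := by
  have sg := fun a e => smooth_along hV hX (h.smooth_g a e)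
  have sb := fun a e c => smooth_along hV hX (h.smooth_b a e c)
  have sc := fun a e c d => smooth_along hV hX (smooth_curl hV h.smooth_b a e c d)
  have sX := fun d => smooth_deriv (smooth_coord hX.1 d)
  have sβ := smooth_deriv hβ
  have sγ := smooth_deriv hγ
  let B : Fin 2 → Fin 2 → ℝ → ℝ := fun a e x => ∑ d, b a e d (X x) * deriv (fun s => X s d) x
  let C : Fin 2 → Fin 2 → Fin 2 → ℝ → ℝ := fun a e c x =>
    ∑ d, curl b a e c d (X x) * deriv (fun s => X s d) x
  have sB : ∀ a e, ContDiff ℝ ∞ (B a e) := fun a e =>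
    ContDiff.sum fun d _ => (sb a e d).mul (sX d)
  have sC : ∀ a e c, ContDiff ℝ ∞ (C a e c) := fun a e c =>
    ContDiff.sum fun d _ => (sc a e c d).mul (sX d)
  -- The coefficient p of α' is sorted by the derivative it carries: r goes with β', t with γ', and
  -- w d with the derivative of the d-th coordinate of X.
  let r : ℝ → ℝ := fun s => (∑ c, (b i k c (X s) * g c j (X s) - b j k c (X s) * g c i (X s))) * γ s
  let t : ℝ → ℝ := fun s => (∑ c, (b k j c (X s) * g c i (X s) - b i j c (X s) * g c k (X s))) * β s
  let w : Fin 2 → ℝ → ℝ := fun d s => (∑ c, (curl b j k c d (X s) * g c i (X s)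
        + b i k c (X s) * b c j d (X s) - b i j c (X s) * b c k d (X s))) * (β s * γ s)
  have sr : ContDiff ℝ ∞ r := (ContDiff.sum fun c _ =>
    ((sb i k c).mul (sg c j)).sub ((sb j k c).mul (sg c i))).mul hγ
  have st : ContDiff ℝ ∞ t := (ContDiff.sum fun c _ =>
    ((sb k j c).mul (sg c i)).sub ((sb i j c).mul (sg c k))).mul hβ
  have sw : ∀ d, ContDiff ℝ ∞ (w d) := fun d => (ContDiff.sum fun c _ =>
    (((sc j k c d).mul (sg c i)).add ((sb i k c).mul (sb c j d))).sub
      ((sb i j c).mul (sb c k d))).mul (hβ.mul hγ)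
  let p : ℝ → ℝ := fun s => deriv β s * r s + deriv γ s * t s
    + ∑ d, deriv (fun s => X s d) s * w d s
  let q : ℝ → ℝ := fun s => ∑ c,
    ((b j i c (X s) * deriv β s + β s * C i j c s) * (g c k (X s) * deriv γ s + B c k s * γ s)
    + (b k j c (X s) * β s * deriv γ s - b j k c (X s) * deriv β s * γ s + β s * γ s * C j k c s)
      * B c i s
    + (γ s * C k i c s - b k i c (X s) * deriv γ s) * (g c j (X s) * deriv β s + B c j s * β s))
  have sp : ContDiff ℝ ∞ p := ((sβ.mul sr).add (sγ.mul st)).add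
    (ContDiff.sum fun d _ => (sX d).mul (sw d))
  have sq : ContDiff ℝ ∞ q := ContDiff.sum fun c _ =>
    (((((sb j i c).mul sβ).add (hβ.mul (sC i j c))).mul (((sg c k).mul sγ).add ((sB c k).mul hγ))).add
      ((((((sb k j c).mul hβ).mul sγ).sub (((sb j k c).mul sβ).mul hγ)).add
        ((hβ.mul hγ).mul (sC j k c))).mul (sB c i))).add
      (((hγ.mul (sC k i c)).sub ((sb k i c).mul sγ)).mul
        (((sg c j).mul sβ).add ((sB c j).mul hβ)))
  have key := deriv_eq_of_integral_eq_zero sp sq (fun α hα hαc => by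
    have t1 := isTest_testAlong i hα hαc
    have t2 := isTest_testAlong j hβ hβc
    have t3 := isTest_testAlong k hγ hγc
    have e := h.jacobi X _ _ _ hX t1 t2 t3
    rw [jacobi_eq_integral hV h.smooth_g h.smooth_b hX t1 t2 t3] at e
    rw [← e]
    congr 1
    funext x
    simp only [h.varDeriv_testAlong hV hX _ _ t1 t2, h.varDeriv_testAlong hV hX _ _ t2 t3,
      h.varDeriv_testAlong hV hX _ _ t3 t1, applyOp_testAlong, p, q, r, t, w, B, C,
      Fin.sum_univ_two]
    ring) 0
  -- Every summand of q is a product of two factors, both linear in β', γ' and X', which all vanish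
  -- at 0.
  have hq : q 0 = 0 := by simp [q, B, C, hX1, hβ1, hγ1]
  have hdp : deriv p 0 = deriv (deriv β) 0 * r 0 + deriv (deriv γ) 0 * t 0
      + ∑ d, deriv (deriv fun s => X s d) 0 * w d 0 := by
    have d1 := (sβ.mul sr).differentiable (by simp) 0
    have d2 := (sγ.mul st).differentiable (by simp) 0
    have d3 := fun d => ((sX d).mul (sw d)).differentiable (by simp) 0
    simp only [p, Fin.sum_univ_two]
    rw [deriv_fun_add (d1.fun_add d2) ((d3 0).fun_add (d3 1)), deriv_fun_add d1 d2,
      deriv_fun_add (d3 0) (d3 1), deriv_mul_of_eq_zero sβ sr hβ1, deriv_mul_of_eq_zero sγ st hγ1,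
      deriv_mul_of_eq_zero (sX 0) (sw 0) (hX1 0), deriv_mul_of_eq_zero (sX 1) (sw 1) (hX1 1)]
  rw [hq, hdp, hγ2] at key
  simp only [r, w, hγ0] at key
  simp only [Fin.sum_univ_two] at key ⊢
  linear_combination -key

/-- Taking β = x² near 0 gives β(0) = 0 and β''(0) = 2, which isolates the first sum of
`jacobi_germ`. For b^{ij}_k = -g^{is}Γ^j_{sk} with `g` invertible, this says that Γ is torsion-free.
-/
theorem IsPoisson.jacobi_symm (h : IsPoisson V g b) (hV : IsOpen V) {u : Fin 2 → ℝ} (hu : u ∈ V)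
    (i j k : Fin 2) : ∑ c, (b i k c u * g c j u - b j k c u * g c i u) = 0 := by
  obtain ⟨X, hX, hX0, hX1, -⟩ := exists_curve_acceleration hV hu 0
  obtain ⟨β, hβ, hβc, hgβ⟩ := exists_test_germ 2
  obtain ⟨γ, hγ, hγc, hgγ⟩ := exists_test_germ 0
  have e1 : deriv β =ᶠ[𝓝 0] fun x => 2 * x := hgβ.deriv.trans (.of_forall fun x => by simp)
  have e2 : deriv γ =ᶠ[𝓝 0] fun _ => 0 := hgγ.deriv.trans (.of_forall fun x => by simp)
  have := h.jacobi_germ hV hX hX1 i j k hβ hβc hγ hγc (by rw [e1.self_of_nhds]; simp)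
    (by rw [hgγ.self_of_nhds]; simp) e2.self_of_nhds (by rw [e2.deriv_eq]; simp)
  rw [e1.deriv_eq, hgβ.self_of_nhds, hX0, deriv_const_mul _ differentiableAt_fun_id] at this
  simpa using this

/-- Taking β = γ = 1 near 0 leaves the second sum of `jacobi_germ`, and the acceleration along the
axis d selects one term. This is the contravariant form of zero curvature. -/
theorem IsPoisson.jacobi_curvature (h : IsPoisson V g b) (hV : IsOpen V) {u : Fin 2 → ℝ}
    (hu : u ∈ V) (i j k d : Fin 2) : ∑ c, (curl b j k c d u * g c i u
        + b i k c u * b c j d u - b i j c u * b c k d u) = 0 := by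
  obtain ⟨X, hX, hX0, hX1, m, hm, hX2⟩ := exists_curve_acceleration hV hu d
  obtain ⟨γ, hγ, hγc, hgγ⟩ := exists_test_germ 0
  have e2 : deriv γ =ᶠ[𝓝 0] fun _ => 0 := hgγ.deriv.trans (.of_forall fun x => by simp)
  have := h.jacobi_germ hV hX hX1 i j k hγ hγc hγ hγc e2.self_of_nhds
    (by rw [hgγ.self_of_nhds]; simp) e2.self_of_nhds (by rw [e2.deriv_eq]; simp)
  rw [e2.deriv_eq, hgγ.self_of_nhds, hX0] at this
  simp only [hX2, Pi.single_apply, mul_ite, mul_one, mul_zero, ite_mul, zero_mul,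
    Finset.sum_ite_eq', Finset.mem_univ, if_true, deriv_const, pow_zero, one_mul, zero_add] at this
  exact (mul_eq_zero.1 this).resolve_left hm

end Hydro
end

noncomputable section

namespace Hydro

variable {V : Set (Fin 2 → ℝ)} {g : Fin 2 → Fin 2 → (Fin 2 → ℝ) → ℝ}
  {b : Fin 2 → Fin 2 → Fin 2 → (Fin 2 → ℝ) → ℝ} {l : Fin 2 → (Fin 2 → ℝ) → ℝ}

/-! ### From a Hamiltonian formulation to a pair of functions -/

theorem sum_pair {i j : Fin 2} (hij : i ≠ j) (f : Fin 2 → ℝ) : ∑ c, f c = f i + f j := by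
  have : (Finset.univ : Finset (Fin 2)) = {i, j} := by
    fin_cases i <;> fin_cases j <;> simp_all <;> decide
  rw [this, Finset.sum_pair hij]

/-- `∂_j λ^i / (λ^j - λ^i)`, which is `A` for `(i, j) = (1, 2)` and `B` for `(i, j) = (2, 1)`. -/
def coef (l : Fin 2 → (Fin 2 → ℝ) → ℝ) (i j : Fin 2) (X : Fin 2 → ℝ) : ℝ :=
  pd j (l i) X / (l j X - l i X)

/-- The equations satisfied by the diagonal components of the metric of a Hamiltonian
formulation: its compatibility with the system, and its flatness. -/
structure IsFlatPair (l : Fin 2 → (Fin 2 → ℝ) → ℝ) (i j : Fin 2) (gi gj : (Fin 2 → ℝ) → ℝ)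
    (X : Fin 2 → ℝ) : Prop where
  pd_fst : pd j gi X = -2 * coef l i j X * gi X
  pd_snd : pd i gj X = -2 * coef l j i X * gj X
  flat : (pd i (coef l j i) X + coef l j i X ^ 2) * gi X + 1 / 2 * coef l j i X * pd i gi X
    + ((pd j (coef l i j) X + coef l i j X ^ 2) * gj X + 1 / 2 * coef l i j X * pd j gj X) = 0

theorem IsFlatPair.swap {i j : Fin 2} {gi gj : (Fin 2 → ℝ) → ℝ} {X : Fin 2 → ℝ}
    (h : IsFlatPair l i j gi gj X) : IsFlatPair l j i gj gi X :=
  ⟨h.pd_snd, h.pd_fst, by rw [add_comm]; exact h.flat⟩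

theorem smooth_coef (hV : IsOpen V) (hl : ∀ a, ContDiffOn ℝ ∞ (l a) V)
    (hne : ∀ X ∈ V, l 0 X ≠ l 1 X) {i j : Fin 2} (hij : i ≠ j) :
    ContDiffOn ℝ ∞ (coef l i j) V := by
  refine (smooth_pd hV (hl i) j).div ((hl j).sub (hl i)) fun X hX h => hne X hX ?_
  fin_cases i <;> fin_cases j <;> simp_all [sub_eq_zero]

/-- Here ρ and σ play the role of Christoffel symbols of the metric. Differentiating `hii` in
direction j and eliminating the third derivatives of h by the mixed equation leaves ρ (λʲ - λⁱ) plus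
∂ⱼh times the flatness expression. So ρ is forced to be the coefficient computed from the
velocities. -/
theorem pd_velocity (hV : IsOpen V) {i j : Fin 2} {li lj gi gj ρ σ h : (Fin 2 → ℝ) → ℝ}
    (si : ContDiffOn ℝ ∞ gi V) (sj : ContDiffOn ℝ ∞ gj V) (sρ : ContDiffOn ℝ ∞ ρ V)
    (sσ : ContDiffOn ℝ ∞ σ V) (sh : ContDiffOn ℝ ∞ h V)
    (h1 : ∀ X ∈ V, pd j gi X = -2 * (ρ X * gi X))
    (hij : ∀ X ∈ V, pd j (pd i h) X = ρ X * pd i h X + σ X * pd j h X)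
    (hii : ∀ X ∈ V, li X = gi X * pd i (pd i h) X + 1 / 2 * pd i gi X * pd i h X
      + ρ X * gj X * pd j h X)
    (hjj : ∀ X ∈ V, lj X = gj X * pd j (pd j h) X + 1 / 2 * pd j gj X * pd j h X
      + σ X * gi X * pd i h X)
    (hF : ∀ X ∈ V, (pd i σ X + σ X ^ 2) * gi X + 1 / 2 * σ X * pd i gi X
      + ((pd j ρ X + ρ X ^ 2) * gj X + 1 / 2 * ρ X * pd j gj X) = 0)
    {X : Fin 2 → ℝ} (hX : X ∈ V) : pd j li X = ρ X * (lj X - li X) := by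
  have sdi := smooth_pd hV sh i
  have sdj := smooth_pd hV sh j
  have sdii := smooth_pd hV sdi i
  have e1 : pd j (pd i (pd i h)) X = pd i ρ X * pd i h X + ρ X * pd i (pd i h) X
      + (pd i σ X * pd j h X + σ X * pd j (pd i h) X) := by
    rw [pd_comm hV sdi hX j i, pd_congr hV hij hX, pd_add hV (sρ.mul sdi) (sσ.mul sdj) hX,
      pd_mul hV sρ sdi hX, pd_mul hV sσ sdj hX, pd_comm hV sh hX i j]
  have e2 : pd j (pd i gi) X = -2 * (pd i ρ X * gi X + ρ X * pd i gi X) := by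
    rw [pd_comm hV si hX j i, pd_congr hV h1 hX, pd_const_mul hV _ (sρ.mul si) hX,
      pd_mul hV sρ si hX]
  have sdg := smooth_pd hV si i
  have e3 : pd j li X = (pd j gi X * pd i (pd i h) X + gi X * pd j (pd i (pd i h)) X)
      + (1 / 2 * pd j (pd i gi) X * pd i h X + 1 / 2 * pd i gi X * pd j (pd i h) X)
      + ((pd j ρ X * gj X + ρ X * pd j gj X) * pd j h X + ρ X * gj X * pd j (pd j h) X) := by
    have s1 : ContDiffOn ℝ ∞ (fun Y => 1 / 2 * pd i gi Y) V := contDiffOn_const.mul sdg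
    rw [pd_congr hV hii hX, pd_add hV ((si.mul sdii).add (s1.mul sdi)) ((sρ.mul sj).mul sdj) hX,
      pd_add hV (si.mul sdii) (s1.mul sdi) hX, pd_mul hV si sdii hX, pd_mul hV s1 sdi hX,
      pd_const_mul hV _ sdg hX, pd_mul (f := fun Y => ρ Y * gj Y) hV (sρ.mul sj) sdj hX,
      pd_mul hV sρ sj hX]
  rw [e3, e1, e2, h1 X hX, hij X hX, hii X hX, hjj X hX]
  linear_combination (pd j h X) * hF X hX

/-- Both sides of the evolution equation are linear in the velocity of the curve, so curves with
velocity along the axis c give one matrix entry each. -/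
theorem IsHamiltonianFormulation.exists_density (hH : IsHamiltonianFormulation l V g b)
    (hV : IsOpen V) : ∃ h : (Fin 2 → ℝ) → ℝ, ContDiffOn ℝ ∞ h V ∧ ∀ u ∈ V, ∀ a c,
      (if a = c then l a u else 0) = ∑ e, (g a e u * pd c (pd e h) u + b a e c u * pd e h u) := by
  obtain ⟨-, h, sh, hh⟩ := hH
  refine ⟨h, sh, fun u hu a c => ?_⟩
  obtain ⟨X, hX, hX0, hX1⟩ := exists_curve_velocity hV hu (Pi.single c 1)
  have e := hh X hX 0 a
  simp only [applyOp, varDeriv_function] at e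
  have hd : ∀ i, deriv (fun s => pd i h (X s)) 0 = pd c (pd i h) u := fun i => by
    rw [(hasDerivAt_field hV hX (smooth_pd hV sh i) 0).deriv, hX0]
    simp [hX1, Pi.single_apply]
  simp only [hd, hX1, hX0, Pi.single_apply, mul_ite, ite_mul, mul_one, mul_zero, zero_mul,
    Finset.sum_ite_eq', Finset.mem_univ, if_true] at e
  exact e

/-- Contract the identity of `exists_density` with `g`: by symmetry of the Hessian of h and
`jacobi_symm` the result is symmetric, so (λ⁰ - λ¹) g⁰¹ = 0. No inverse of `g` is needed. -/
theorem IsHamiltonianFormulation.diagonal (hH : IsHamiltonianFormulation l V g b)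
    (hV : IsOpen V) (hne : ∀ X ∈ V, l 0 X ≠ l 1 X) {i j : Fin 2} (hij : i ≠ j)
    {u : Fin 2 → ℝ} (hu : u ∈ V) : g i j u = 0 := by
  obtain ⟨h, sh, hh⟩ := hH.exists_density hV
  have hP := hH.1
  have key : g 0 1 u = 0 := by
    have s := hP.symm_g hV hu 1 0
    have e00 := hh u hu 0 0
    have e01 := hh u hu 0 1
    have e10 := hh u hu 1 0
    have e11 := hh u hu 1 1
    have c := pd_comm hV sh hu 1 0
    have j0 := hP.jacobi_symm hV hu 0 1 0
    have j1 := hP.jacobi_symm hV hu 0 1 1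
    simp only [Fin.sum_univ_two, Fin.isValue, if_true, zero_ne_one, one_ne_zero, if_false]
      at e00 e01 e10 e11 j0 j1
    rw [s] at e10 e11 j0 j1
    rw [c] at e01 e11
    have : g 0 1 u * (l 0 u - l 1 u) = 0 := by
      linear_combination g 0 1 u * e00 - g 0 1 u * e11 + g 1 1 u * e01 - g 0 0 u * e10
        + pd 0 h u * j0 + pd 1 h u * j1
    exact (mul_eq_zero.1 this).resolve_right (sub_ne_zero.2 (hne u hu))
  fin_cases i <;> fin_cases j
  · exact absurd rfl hij
  · exact key
  · exact (hP.symm_g hV hu 1 0).trans key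
  · exact absurd rfl hij

theorem eqOn_of_meets {W : Set (Fin 2 → ℝ)} {F G : (Fin 2 → ℝ) → ℝ} (hV : IsOpen V)
    (hF : ContinuousOn F V) (hG : ContinuousOn G V) (hFG : ∀ X ∈ V, X ∈ W → F X = G X)
    (hW : ∀ O : Set (Fin 2 → ℝ), IsOpen O → O ⊆ V → O.Nonempty → (O ∩ W).Nonempty) :
    ∀ X ∈ V, F X = G X := by
  intro X hX
  by_contra hne
  have hO : IsOpen (V ∩ (fun Y => F Y - G Y) ⁻¹' {0}ᶜ) :=
    (hF.sub hG).isOpen_inter_preimage hV isOpen_compl_singleton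
  obtain ⟨Y, ⟨hYV, hY⟩, hYW⟩ := hW _ hO Set.inter_subset_left ⟨X, hX, by simpa [sub_eq_zero] using hne⟩
  exact hY (by simp [hFG Y hYV hYW])

/-- What a Hamiltonian formulation `g, b` amounts to: `g` is diagonal, its diagonal entries
form a flat pair, and `b` is determined by `g`. -/
structure IsDiagonalData (l : Fin 2 → (Fin 2 → ℝ) → ℝ) (i j : Fin 2)
    (g : Fin 2 → Fin 2 → (Fin 2 → ℝ) → ℝ) (b : Fin 2 → Fin 2 → Fin 2 → (Fin 2 → ℝ) → ℝ)
    (X : Fin 2 → ℝ) : Prop extends IsFlatPair l i j (g i i) (g j j) X where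
  off_fst : b i j i X = coef l i j X * g j j X
  off_snd : b i j j X = -(coef l j i X * g i i X)

/-- A single nonzero diagonal entry suffices: all relations are written without dividing by `g j j`,
which may vanish. -/
theorem IsHamiltonianFormulation.diagonalData_of_ne (hH : IsHamiltonianFormulation l V g b)
    (hV : IsOpen V) (hne : ∀ X ∈ V, l 0 X ≠ l 1 X) {i j : Fin 2} (hij : i ≠ j)
    {u : Fin 2 → ℝ} (hu : u ∈ V) (h0 : g i i u ≠ 0) : IsDiagonalData l i j g b u := by
  obtain ⟨h, sh, hh⟩ := hH.exists_density hV
  have hP := hH.1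
  set W : Set (Fin 2 → ℝ) := V ∩ g i i ⁻¹' {0}ᶜ with hWdef
  have hW : IsOpen W := (hP.smooth_g i i).continuousOn.isOpen_inter_preimage hV isOpen_compl_singleton
  have hWV : W ⊆ V := Set.inter_subset_left
  have hW0 : ∀ X ∈ W, g i i X ≠ 0 := fun X hX => hX.2
  have huW : u ∈ W := ⟨hu, h0⟩
  have sg := fun a e => (hP.smooth_g a e).mono hWV
  have sb := fun a e c => (hP.smooth_b a e c).mono hWV
  have sh' := sh.mono hWV
  -- In the nondegenerate case these are Γⁱ_{ij} and Γʲ_{ij}. Both can be read off by dividing by `g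
  -- i i` alone.
  let ρ : (Fin 2 → ℝ) → ℝ := fun X => -(b i i j X / g i i X)
  let σ : (Fin 2 → ℝ) → ℝ := fun X => -(b i j j X / g i i X)
  have sρ : ContDiffOn ℝ ∞ ρ W := ((sb i i j).div (sg i i) hW0).neg
  have sσ : ContDiffOn ℝ ∞ σ W := ((sb i j j).div (sg i i) hW0).neg
  have dg : ∀ X ∈ W, ∀ a c, pd c (g a a) X = 2 * b a a c X := fun X hX a c => by
    rw [hP.pd_g hV (hWV hX)]; ring
  have bskew : ∀ X ∈ W, ∀ c, b j i c X = -b i j c X := fun X hX c => by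
    have e1 := hP.pd_g hV (hWV hX) i j c
    have e2 : pd c (g i j) X = 0 := by
      rw [pd_congr (g := fun _ => 0) hW (fun Y hY => hH.diagonal hV hne hij (hWV hY)) hX, pd_const]
    linarith
  have b1 : ∀ X ∈ W, b i i j X = -(ρ X * g i i X) := fun X hX => by
    have := hW0 X hX; simp only [ρ]; field_simp
  have b2 : ∀ X ∈ W, b i j j X = -(σ X * g i i X) := fun X hX => by
    have := hW0 X hX; simp only [σ]; field_simp
  have d1 : ∀ X ∈ W, g i j X = 0 := fun X hX => hH.diagonal hV hne hij (hWV hX)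
  have d2 : ∀ X ∈ W, g j i X = 0 := fun X hX => hH.diagonal hV hne hij.symm (hWV hX)
  have b3 : ∀ X ∈ W, b i j i X = ρ X * g j j X := fun X hX => by
    have e := hP.jacobi_symm hV (hWV hX) i j i
    rw [sum_pair hij, d1 X hX, d2 X hX, b1 X hX, bskew X hX] at e
    have := hW0 X hX
    apply mul_right_cancel₀ this
    linear_combination e
  have b4 : ∀ X ∈ W, b j j i X = -(σ X * g j j X) := fun X hX => by
    have e := hP.jacobi_symm hV (hWV hX) i j j
    rw [sum_pair hij, d1 X hX, d2 X hX, b2 X hX] at e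
    have := hW0 X hX
    apply mul_right_cancel₀ this
    linear_combination -e
  have k1 : ∀ X ∈ W, pd j (g i i) X = -2 * (ρ X * g i i X) := fun X hX => by
    rw [dg X hX, b1 X hX]; ring
  have k2 : ∀ X ∈ W, pd i (g j j) X = -2 * (σ X * g j j X) := fun X hX => by
    rw [dg X hX, b4 X hX]; ring
  have kij : ∀ X ∈ W, pd j (pd i h) X = ρ X * pd i h X + σ X * pd j h X := fun X hX => by
    have e := hh X (hWV hX) i j
    rw [if_neg hij, sum_pair hij, d1 X hX, b1 X hX, b2 X hX] at e
    have := hW0 X hX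
    apply mul_left_cancel₀ this
    linear_combination -e
  have kji : ∀ X ∈ W, pd i (pd j h) X = σ X * pd j h X + ρ X * pd i h X := fun X hX => by
    rw [pd_comm hW sh' hX, kij X hX, add_comm]
  have kii : ∀ X ∈ W, l i X = g i i X * pd i (pd i h) X + 1 / 2 * pd i (g i i) X * pd i h X
      + ρ X * g j j X * pd j h X := fun X hX => by
    have e := hh X (hWV hX) i i
    rw [if_pos rfl, sum_pair hij, d1 X hX, b3 X hX] at e
    rw [dg X hX]
    linear_combination e
  have kjj : ∀ X ∈ W, l j X = g j j X * pd j (pd j h) X + 1 / 2 * pd j (g j j) X * pd j h X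
      + σ X * g i i X * pd i h X := fun X hX => by
    have e := hh X (hWV hX) j j
    rw [if_pos rfl, sum_pair hij, d2 X hX, bskew X hX, b2 X hX] at e
    rw [dg X hX]
    linear_combination e
  have kF : ∀ X ∈ W, (pd i σ X + σ X ^ 2) * g i i X + 1 / 2 * σ X * pd i (g i i) X
      + ((pd j ρ X + ρ X ^ 2) * g j j X + 1 / 2 * ρ X * pd j (g j j) X) = 0 := fun X hX => by
    have e := hP.jacobi_curvature hV (hWV hX) i i j j
    have c1 : pd i (b i j j) X = -(pd i σ X * g i i X + σ X * pd i (g i i) X) := by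
      rw [pd_congr hW b2 hX, pd_neg, pd_mul hW sσ (sg i i) hX]
    have c2 : pd j (b i j i) X = pd j ρ X * g j j X + ρ X * pd j (g j j) X := by
      rw [pd_congr hW b3 hX, pd_mul hW sρ (sg j j) hX]
    rw [sum_pair hij, d2 X hX, bskew X hX, curl, c1, c2, b3 X hX, b1 X hX, b2 X hX] at e
    have f1 := dg X hX i i
    have f2 := dg X hX j j
    have := hW0 X hX
    apply mul_left_cancel₀ this
    linear_combination -e - 1 / 2 * g i i X * σ X * f1 - 1 / 2 * g i i X * ρ X * f2
  have lne : ∀ X ∈ W, l j X - l i X ≠ 0 := fun X hX e => by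
    have := hne X (hWV hX)
    fin_cases i <;> fin_cases j <;> simp_all [sub_eq_zero]
  -- The compatibility conditions identify the symbols with the data of the system; exchanging i and
  -- j handles σ.
  have vρ : ∀ X ∈ W, coef l i j X = ρ X := fun X hX => by
    rw [coef, pd_velocity hW (sg i i) (sg j j) sρ sσ sh' k1 kij kii kjj kF hX]
    exact mul_div_cancel_right₀ _ (lne X hX)
  have vσ : ∀ X ∈ W, coef l j i X = σ X := fun X hX => by
    rw [coef, pd_velocity hW (sg j j) (sg i i) sσ sρ sh' k2 kji kjj kii
      (fun Y hY => by rw [add_comm]; exact kF Y hY) hX]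
    exact mul_div_cancel_right₀ _ (fun e => lne X hX (by linarith))
  refine ⟨⟨?_, ?_, ?_⟩, ?_, ?_⟩
  · rw [k1 u huW, vρ u huW]; ring
  · rw [k2 u huW, vσ u huW]; ring
  · rw [pd_congr hW vρ huW, pd_congr hW vσ huW, vρ u huW, vσ u huW]; exact kF u huW
  · rw [b3 u huW, vρ u huW]
  · rw [b2 u huW, vσ u huW]

/-- If `g` vanished on O, then `b` would be skew in its upper indices, leaving λ⁰ = b⁰¹₀ ∂₁h, b⁰¹₁
∂₁h = 0 and λ¹ = -b⁰¹₁ ∂₀h. So λ¹ = 0 wherever λ⁰ ≠ 0, and one velocity vanishes on a nonempty open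
set, against A ≠ 0 or B ≠ 0. -/
theorem IsHamiltonianFormulation.not_vanishing (hH : IsHamiltonianFormulation l V g b)
    (hV : IsOpen V) (hA : ∀ X ∈ V, coefA l X ≠ 0) (hB : ∀ X ∈ V, coefB l X ≠ 0)
    {O : Set (Fin 2 → ℝ)} (hO : IsOpen O) (hOV : O ⊆ V) (hne : O.Nonempty)
    (hl : ∀ a, ContDiffOn ℝ ∞ (l a) V) (h01 : ∀ X ∈ V, g 0 1 X = 0) :
    ∃ X ∈ O, g 0 0 X ≠ 0 ∨ g 1 1 X ≠ 0 := by
  by_contra! hcon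
  obtain ⟨h, sh, hh⟩ := hH.exists_density hV
  have hP := hH.1
  have dz : ∀ X ∈ O, ∀ a c, b a a c X = 0 := fun X hX a c => by
    have e1 := hP.pd_g hV (hOV hX) a a c
    have e2 : pd c (g a a) X = 0 := by
      rw [pd_congr (g := fun _ => 0) hO (fun Y hY => ?_) hX, pd_const]
      fin_cases a
      exacts [(hcon Y hY).1, (hcon Y hY).2]
    linarith
  have bskew : ∀ X ∈ O, ∀ c, b 1 0 c X = -b 0 1 c X := fun X hX c => by
    have e1 := hP.pd_g hV (hOV hX) 0 1 c
    have e2 : pd c (g 0 1) X = 0 := by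
      rw [pd_congr (g := fun _ => 0) hO (fun Y hY => h01 Y (hOV hY)) hX, pd_const]
    linarith
  have hr : ∀ X ∈ O, l 0 X = b 0 1 0 X * pd 1 h X ∧ b 0 1 1 X * pd 1 h X = 0
      ∧ l 1 X = -(b 0 1 1 X * pd 0 h X) := fun X hX => by
    have e00 := hh X (hOV hX) 0 0
    have e01 := hh X (hOV hX) 0 1
    have e11 := hh X (hOV hX) 1 1
    have s := hP.symm_g hV (hOV hX) 1 0
    simp only [Fin.sum_univ_two, Fin.isValue, if_true, zero_ne_one, if_false, s,
      dz X hX, bskew X hX, (hcon X hX).1, (hcon X hX).2, h01 X (hOV hX)] at e00 e01 e11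
    refine ⟨by linarith, by linarith, by linarith⟩
  by_cases hz : ∀ X ∈ O, l 0 X = 0
  · obtain ⟨X, hX⟩ := hne
    refine hA X (hOV hX) ?_
    rw [coefA, pd_congr (g := fun _ => 0) hO hz hX, pd_const, zero_div]
  · push Not at hz
    obtain ⟨X, hX, hlX⟩ := hz
    have hO' : IsOpen (O ∩ l 0 ⁻¹' {0}ᶜ) :=
      ((hl 0).mono hOV).continuousOn.isOpen_inter_preimage hO isOpen_compl_singleton
    have hz1 : ∀ Y ∈ O ∩ l 0 ⁻¹' {0}ᶜ, l 1 Y = 0 := fun Y hY => by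
      obtain ⟨r1, r2, r3⟩ := hr Y hY.1
      have : pd 1 h Y ≠ 0 := fun e => hY.2 (by simp [r1, e])
      rw [r3, (mul_eq_zero.1 r2).resolve_right this]; simp
    refine hB X (hOV hX) ?_
    rw [coefB, pd_congr (g := fun _ => 0) hO' hz1 ⟨hX, hlX⟩, pd_const, zero_div]

/-- All the relations are equalities of continuous functions. They hold where some diagonal entry is
nonzero, which is a dense set by `not_vanishing`, hence everywhere. -/
theorem IsHamiltonianFormulation.diagonalData (hH : IsHamiltonianFormulation l V g b)
    (hV : IsOpen V) (hl : ∀ a, ContDiffOn ℝ ∞ (l a) V) (hne : ∀ X ∈ V, l 0 X ≠ l 1 X)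
    (hA : ∀ X ∈ V, coefA l X ≠ 0) (hB : ∀ X ∈ V, coefB l X ≠ 0)
    {u : Fin 2 → ℝ} (hu : u ∈ V) : IsDiagonalData l 0 1 g b u := by
  have hP := hH.1
  have h01 : ∀ X ∈ V, g 0 1 X = 0 := fun X hX => hH.diagonal hV hne (by decide) hX
  let W : Set (Fin 2 → ℝ) := {X | g 0 0 X ≠ 0 ∨ g 1 1 X ≠ 0}
  have hW : ∀ O : Set (Fin 2 → ℝ), IsOpen O → O ⊆ V → O.Nonempty → (O ∩ W).Nonempty :=
    fun O hO hOV hOne => by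
      obtain ⟨X, hX, hXW⟩ := hH.not_vanishing hV hA hB hO hOV hOne hl h01
      exact ⟨X, hX, hXW⟩
  have hD : ∀ X ∈ V, X ∈ W → IsDiagonalData l 0 1 g b X := fun X hX hXW => by
    rcases hXW with h0 | h1
    · exact hH.diagonalData_of_ne hV hne (by decide) hX h0
    · have d := hH.diagonalData_of_ne (i := 1) (j := 0) hV hne (by decide) hX h1
      have e : ∀ c, b 1 0 c X = -b 0 1 c X := fun c => by
        have e1 := hP.pd_g hV hX 0 1 c
        have e2 : pd c (g 0 1) X = 0 := by
          rw [pd_congr (g := fun _ => 0) hV h01 hX, pd_const]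
        linarith
      have f1 := d.off_fst
      have f2 := d.off_snd
      rw [e] at f1 f2
      exact ⟨d.toIsFlatPair.swap, by linarith, by linarith⟩
  have sA := smooth_coef hV hl hne (i := 0) (j := 1) (by decide)
  have sB := smooth_coef hV hl hne (i := 1) (j := 0) (by decide)
  have cA := sA.continuousOn
  have cB := sB.continuousOn
  have cg := fun a => (hP.smooth_g a a).continuousOn
  have cdg := fun a c => (smooth_pd hV (hP.smooth_g a a) c).continuousOn
  have cdA := fun c => (smooth_pd hV sA c).continuousOn
  have cdB := fun c => (smooth_pd hV sB c).continuousOn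
  refine ⟨⟨?_, ?_, ?_⟩, ?_, ?_⟩
  · exact eqOn_of_meets hV (cdg 0 1) ((continuousOn_const.mul cA).mul (cg 0))
      (fun X hX hXW => (hD X hX hXW).pd_fst) hW u hu
  · exact eqOn_of_meets hV (cdg 1 0) ((continuousOn_const.mul cB).mul (cg 1))
      (fun X hX hXW => (hD X hX hXW).pd_snd) hW u hu
  · exact eqOn_of_meets hV (((((cdB 0).add (cB.pow 2)).mul (cg 0)).add
      ((continuousOn_const.mul cB).mul (cdg 0 0))).add ((((cdA 1).add (cA.pow 2)).mul (cg 1)).add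
      ((continuousOn_const.mul cA).mul (cdg 1 1)))) continuousOn_const
      (fun X hX hXW => (hD X hX hXW).flat) hW u hu
  · exact eqOn_of_meets hV (hP.smooth_b 0 1 0).continuousOn (cA.mul (cg 1))
      (fun X hX hXW => (hD X hX hXW).off_fst) hW u hu
  · exact eqOn_of_meets hV (hP.smooth_b 0 1 1).continuousOn (cB.mul (cg 0)).neg
      (fun X hX hXW => (hD X hX hXW).off_snd) hW u hu

end Hydro
end

noncomputable section

namespace Hydro

variable {V : Set (Fin 2 → ℝ)} {l : Fin 2 → (Fin 2 → ℝ) → ℝ} {g1 g2 : (Fin 2 → ℝ) → ℝ}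

/-! ### The Poisson operator of a flat pair -/

/-- The diagonal metric with entries `g1`, `g2`. -/
def diagMetric (g1 g2 : (Fin 2 → ℝ) → ℝ) (a e : Fin 2) : (Fin 2 → ℝ) → ℝ :=
  match a, e with
  | 0, 0 => g1
  | 1, 1 => g2
  | 0, 1 => fun _ => 0
  | 1, 0 => fun _ => 0

/-- The coefficients `b^{ae}_c` of the operator attached to a flat pair `g1`, `g2`. -/
def diagSymbol (l : Fin 2 → (Fin 2 → ℝ) → ℝ) (g1 g2 : (Fin 2 → ℝ) → ℝ) (a e c : Fin 2) :
    (Fin 2 → ℝ) → ℝ :=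
  match a, e, c with
  | 0, 0, c => fun X => 1 / 2 * pd c g1 X
  | 1, 1, c => fun X => 1 / 2 * pd c g2 X
  | 0, 1, 0 => fun X => coef l 0 1 X * g2 X
  | 0, 1, 1 => fun X => -(coef l 1 0 X * g1 X)
  | 1, 0, 0 => fun X => -(coef l 0 1 X * g2 X)
  | 1, 0, 1 => fun X => coef l 1 0 X * g1 X

theorem smooth_diagMetric (h1 : ContDiffOn ℝ ∞ g1 V) (h2 : ContDiffOn ℝ ∞ g2 V) (a e : Fin 2) :
    ContDiffOn ℝ ∞ (diagMetric g1 g2 a e) V := by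
  fin_cases a <;> fin_cases e
  exacts [h1, contDiffOn_const, contDiffOn_const, h2]

theorem smooth_diagSymbol (hV : IsOpen V) (hl : ∀ a, ContDiffOn ℝ ∞ (l a) V)
    (hne : ∀ X ∈ V, l 0 X ≠ l 1 X) (h1 : ContDiffOn ℝ ∞ g1 V) (h2 : ContDiffOn ℝ ∞ g2 V)
    (a e c : Fin 2) : ContDiffOn ℝ ∞ (diagSymbol l g1 g2 a e c) V := by
  have sA := smooth_coef hV hl hne (i := 0) (j := 1) (by decide)
  have sB := smooth_coef hV hl hne (i := 1) (j := 0) (by decide)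
  fin_cases a <;> fin_cases e
  · exact contDiffOn_const.mul (smooth_pd hV h1 c)
  · fin_cases c
    exacts [sA.mul h2, (sB.mul h1).neg]
  · fin_cases c
    exacts [(sA.mul h2).neg, sB.mul h1]
  · exact contDiffOn_const.mul (smooth_pd hV h2 c)

theorem pd_diagMetric (X : Fin 2 → ℝ) (a e c : Fin 2) : pd c (diagMetric g1 g2 a e) X
      = diagSymbol l g1 g2 a e c X + diagSymbol l g1 g2 e a c X := by
  fin_cases a <;> fin_cases e
  · change pd c g1 X = 1 / 2 * pd c g1 X + 1 / 2 * pd c g1 X; ring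
  · change pd c (fun _ => 0) X = _
    rw [pd_const]; fin_cases c <;> simp [diagSymbol]
  · change pd c (fun _ => 0) X = _
    rw [pd_const]; fin_cases c <;> simp [diagSymbol]
  · change pd c g2 X = 1 / 2 * pd c g2 X + 1 / 2 * pd c g2 X; ring

/-- The sum of the two integrands is the total derivative of the compactly supported function g^{ae}
ξ_a η_e. -/
theorem skew_of_pd {g : Fin 2 → Fin 2 → (Fin 2 → ℝ) → ℝ}
    {b : Fin 2 → Fin 2 → Fin 2 → (Fin 2 → ℝ) → ℝ} (hV : IsOpen V)
    (hg : ∀ a e, ContDiffOn ℝ ∞ (g a e) V) (hb : ∀ a e c, ContDiffOn ℝ ∞ (b a e c) V)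
    (hs : ∀ X ∈ V, ∀ a e, g a e X = g e a X)
    (hd : ∀ X ∈ V, ∀ a e c, pd c (g a e) X = b a e c X + b e a c X)
    {X ξ η : ℝ → Fin 2 → ℝ} (hX : IsCurveIn V X) (hξ : IsTest ξ) (hη : IsTest η) :
    bracket g b X ξ η = -bracket g b X η ξ := by
  have i1 := integrable_bracket hV hg hb hX (fun a => (smooth_coord hξ.1 a).continuous) hη
  have i2 := integrable_bracket hV hg hb hX (fun a => (smooth_coord hη.1 a).continuous) hξ
  have sm : ContDiff ℝ ∞ fun s => ∑ a, ∑ e, g a e (X s) * ξ s a * η s e :=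
    ContDiff.sum fun a _ => ContDiff.sum fun e _ =>
      ((smooth_along hV hX (hg a e)).mul (smooth_coord hξ.1 a)).mul (smooth_coord hη.1 e)
  have hc : HasCompactSupport fun s => ∑ a, ∑ e, g a e (X s) * ξ s a * η s e := by
    refine HasCompactSupport.intro hξ.2.isCompact fun x hx => ?_
    simp [image_eq_zero_of_notMem_tsupport hx]
  have hder : ∀ x, HasDerivAt (fun s => ∑ a, ∑ e, g a e (X s) * ξ s a * η s e)
      (∑ a, ξ x a * applyOp g b X η x a + ∑ a, η x a * applyOp g b X ξ x a) x := fun x => by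
    have h1 := HasDerivAt.fun_sum (u := Finset.univ) fun (a : Fin 2) _ =>
      HasDerivAt.fun_sum (u := Finset.univ) fun (e : Fin 2) _ =>
      ((hasDerivAt_field hV hX (hg a e) x).fun_mul (hasDerivAt_coord (smooth_coord hξ.1 a) x)).fun_mul
        (hasDerivAt_coord (smooth_coord hη.1 e) x)
    refine h1.congr_deriv ?_
    have s := hs _ (hX.2 x) 1 0
    simp only [hd _ (hX.2 x), applyOp, Fin.sum_univ_two, s]
    ring
  rw [eq_neg_iff_add_eq_zero, bracket, bracket, ← MeasureTheory.integral_add i1 i2]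
  exact MeasureTheory.integral_eq_zero_of_hasDerivAt_of_integrable hder (i1.add i2)
    (sm.continuous.integrable_of_hasCompactSupport hc)

theorem curl_diagSymbol (hV : IsOpen V) (hl : ∀ a, ContDiffOn ℝ ∞ (l a) V)
    (hne : ∀ X ∈ V, l 0 X ≠ l 1 X) (h1 : ContDiffOn ℝ ∞ g1 V) (h2 : ContDiffOn ℝ ∞ g2 V)
    (hF : ∀ X ∈ V, IsFlatPair l 0 1 g1 g2 X) {X : Fin 2 → ℝ} (hX : X ∈ V) :
    curl (diagSymbol l g1 g2) 0 1 0 1 X = coef l 0 1 X ^ 2 * g2 X + coef l 1 0 X ^ 2 * g1 X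
      - 1 / 2 * coef l 1 0 X * pd 0 g1 X - 1 / 2 * coef l 0 1 X * pd 1 g2 X := by
  have sA := smooth_coef hV hl hne (i := 0) (j := 1) (by decide)
  have sB := smooth_coef hV hl hne (i := 1) (j := 0) (by decide)
  change pd 0 (fun X => -(coef l 1 0 X * g1 X)) X - pd 1 (fun X => coef l 0 1 X * g2 X) X = _
  rw [pd_neg, pd_mul hV sB h1 hX, pd_mul hV sA h2 hX]
  linear_combination -(hF X hX).flat

theorem curl_diagSymbol_symm (hV : IsOpen V) (h1 : ContDiffOn ℝ ∞ g1 V)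
    (h2 : ContDiffOn ℝ ∞ g2 V) {X : Fin 2 → ℝ} (hX : X ∈ V) (a : Fin 2) :
    curl (diagSymbol l g1 g2) a a 0 1 X = 0 := by
  have aux : ∀ g : (Fin 2 → ℝ) → ℝ, ContDiffOn ℝ ∞ g V →
      pd 0 (fun X => 1 / 2 * pd 1 g X) X - pd 1 (fun X => 1 / 2 * pd 0 g X) X = 0 := fun g hg => by
    rw [pd_const_mul hV _ (smooth_pd hV hg 1) hX, pd_const_mul hV _ (smooth_pd hV hg 0) hX,
      pd_comm hV hg hX 1 0]
    ring
  fin_cases a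
  exacts [aux g1 h1, aux g2 h2]

theorem curl_diagSymbol_skew {X : Fin 2 → ℝ} :
    curl (diagSymbol l g1 g2) 1 0 0 1 X = -curl (diagSymbol l g1 g2) 0 1 0 1 X := by
  change pd 0 (fun X => coef l 1 0 X * g1 X) X - pd 1 (fun X => -(coef l 0 1 X * g2 X)) X
    = -(pd 0 (fun X => -(coef l 1 0 X * g1 X)) X - pd 1 (fun X => coef l 0 1 X * g2 X) X)
  rw [pd_neg, pd_neg]; ring

/-- The cyclic sum in the Jacobi identity vanishes pointwise, before integration. Flatness enters
only through `curl_diagSymbol`. Neither entry need be nonzero. -/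
theorem isPoisson_diag (hV : IsOpen V) (hl : ∀ a, ContDiffOn ℝ ∞ (l a) V)
    (hne : ∀ X ∈ V, l 0 X ≠ l 1 X) (h1 : ContDiffOn ℝ ∞ g1 V) (h2 : ContDiffOn ℝ ∞ g2 V)
    (hF : ∀ X ∈ V, IsFlatPair l 0 1 g1 g2 X) :
    IsPoisson V (diagMetric g1 g2) (diagSymbol l g1 g2) := by
  have hg := smooth_diagMetric (V := V) h1 h2
  have hb := smooth_diagSymbol hV hl hne h1 h2
  refine ⟨hg, hb, fun X ξ η hX hξ hη => skew_of_pd hV hg hb ?_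
    (fun X _ => pd_diagMetric X) hX hξ hη, fun X ξ η ζ hX hξ hη hζ => ?_⟩
  · intro X _ a e
    fin_cases a <;> fin_cases e <;> rfl
  · rw [jacobi_eq_integral hV hg hb hX hξ hη hζ]
    refine (MeasureTheory.integral_congr_ae (.of_forall fun x => ?_)).trans
      (MeasureTheory.integral_zero ℝ ℝ)
    have hXx := hX.2 x
    have c01 := curl_diagSymbol hV hl hne h1 h2 hF hXx
    have c10 := curl_diagSymbol_skew (l := l) (g1 := g1) (g2 := g2) (X := X x)
    have c00 := curl_diagSymbol_symm (l := l) hV h1 h2 hXx 0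
    have c11 := curl_diagSymbol_symm (l := l) hV h1 h2 hXx 1
    have cs : ∀ a e, curl (diagSymbol l g1 g2) a e 1 0 (X x)
        = -curl (diagSymbol l g1 g2) a e 0 1 (X x) := fun a e => by simp only [curl]; ring
    have cz : ∀ a e c, curl (diagSymbol l g1 g2) a e c c (X x) = 0 := fun a e c => by
      simp only [curl]; ring
    have p1 := (hF _ hXx).pd_fst
    have p2 := (hF _ hXx).pd_snd
    simp only [varDeriv_density hV hg hb hX hξ.1 hη.1, varDeriv_density hV hg hb hX hη.1 hζ.1,
      varDeriv_density hV hg hb hX hζ.1 hξ.1, applyOp, Fin.sum_univ_two, Fin.isValue,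
      pd_diagMetric (l := l), cs, cz, c10, c00, c11, c01]
    simp only [diagMetric, diagSymbol, p1, p2]
    ring

end Hydro
end

noncomputable section

namespace Hydro

variable {V : Set (Fin 2 → ℝ)} {l : Fin 2 → (Fin 2 → ℝ) → ℝ} {g1 g2 : (Fin 2 → ℝ) → ℝ}

/-! ### Hamiltonian densities -/

theorem isHamiltonianFormulation_diag (hV : IsOpen V) (hl : ∀ a, ContDiffOn ℝ ∞ (l a) V)
    (hne : ∀ X ∈ V, l 0 X ≠ l 1 X) (h1 : ContDiffOn ℝ ∞ g1 V) (h2 : ContDiffOn ℝ ∞ g2 V)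
    (hF : ∀ X ∈ V, IsFlatPair l 0 1 g1 g2 X) {h : (Fin 2 → ℝ) → ℝ} (sh : ContDiffOn ℝ ∞ h V)
    (h01 : ∀ X ∈ V, pd 1 (pd 0 h) X = coef l 0 1 X * pd 0 h X + coef l 1 0 X * pd 1 h X)
    (h00 : ∀ X ∈ V, l 0 X = g1 X * pd 0 (pd 0 h) X + 1 / 2 * pd 0 g1 X * pd 0 h X
      + coef l 0 1 X * g2 X * pd 1 h X)
    (h11 : ∀ X ∈ V, l 1 X = g2 X * pd 1 (pd 1 h) X + 1 / 2 * pd 1 g2 X * pd 1 h X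
      + coef l 1 0 X * g1 X * pd 0 h X) :
    IsHamiltonianFormulation l V (diagMetric g1 g2) (diagSymbol l g1 g2) := by
  refine ⟨isPoisson_diag hV hl hne h1 h2 hF, h, sh, fun X hX x a => ?_⟩
  have hXx := hX.2 x
  have p1 := (hF _ hXx).pd_fst
  have p2 := (hF _ hXx).pd_snd
  have hd : ∀ i, deriv (fun s => pd i h (X s)) x
      = pd 0 (pd i h) (X x) * deriv (fun s => X s 0) x
        + pd 1 (pd i h) (X x) * deriv (fun s => X s 1) x := fun i => by
    rw [(hasDerivAt_field hV hX (smooth_pd hV sh i) x).deriv, Fin.sum_univ_two]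
  simp only [applyOp, varDeriv_function, hd, Fin.sum_univ_two, pd_comm hV sh hXx 0 1, h01 _ hXx]
  fin_cases a
  · simp only [diagMetric, diagSymbol, Fin.zero_eta, Fin.isValue, p1]
    linear_combination (deriv (fun s => X s 0) x) * h00 _ hXx
  · simp only [diagMetric, diagSymbol, Fin.mk_one, Fin.isValue, p2]
    linear_combination (deriv (fun s => X s 1) x) * h11 _ hXx

theorem exists_potential_pair (hV : IsOpen V) (hc : Convex ℝ V) {i j : Fin 2} (hij : i ≠ j)
    {P Q : (Fin 2 → ℝ) → ℝ} (hP : ContDiffOn ℝ ∞ P V) (hQ : ContDiffOn ℝ ∞ Q V)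
    (hPQ : ∀ X ∈ V, pd j P X = pd i Q X) :
    ∃ h : (Fin 2 → ℝ) → ℝ, ContDiffOn ℝ ∞ h V ∧ (∀ X ∈ V, pd i h X = P X) ∧
      ∀ X ∈ V, pd j h X = Q X := by
  fin_cases i <;> fin_cases j
  · exact absurd rfl hij
  · exact exists_potential hV hc hP hQ hPQ
  · obtain ⟨h, sh, e1, e2⟩ := exists_potential hV hc hQ hP fun X hX => (hPQ X hX).symm
    exact ⟨h, sh, e2, e1⟩
  · exact absurd rfl hij

theorem pd_eq_coef {i j : Fin 2} {X : Fin 2 → ℝ} (h : l j X - l i X ≠ 0) :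
    pd j (l i) X = coef l i j X * (l j X - l i X) := by
  rw [coef, div_mul_cancel₀ _ h]

theorem velocity_sub_ne {X : Fin 2 → ℝ} (h : l 0 X ≠ l 1 X) {i j : Fin 2} (hij : i ≠ j) :
    l j X - l i X ≠ 0 := by
  fin_cases i <;> fin_cases j
  exacts [absurd rfl hij, sub_ne_zero.2 h.symm, sub_ne_zero.2 h, absurd rfl hij]

/-- With gⱼ = 0 the equation for λʲ reads λʲ = B gᵢ ∂ᵢh and gives P = ∂ᵢh algebraically; the mixed
equation then gives Q = ∂ⱼh, since B ≠ 0. It remains to check that P dXⁱ + Q dXʲ is closed. -/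
theorem exists_density_degenerate (hV : IsOpen V) (hc : Convex ℝ V)
    (hl : ∀ a, ContDiffOn ℝ ∞ (l a) V) (hne : ∀ X ∈ V, l 0 X ≠ l 1 X) {i j : Fin 2}
    (hij : i ≠ j) (hB : ∀ X ∈ V, coef l j i X ≠ 0) {gi gj : (Fin 2 → ℝ) → ℝ}
    (si : ContDiffOn ℝ ∞ gi V) (hi : ∀ X ∈ V, gi X ≠ 0) (hj : ∀ X ∈ V, gj X = 0)
    (hF : ∀ X ∈ V, IsFlatPair l i j gi gj X) :
    ∃ h : (Fin 2 → ℝ) → ℝ, ContDiffOn ℝ ∞ h V ∧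
      (∀ X ∈ V, pd j (pd i h) X = coef l i j X * pd i h X + coef l j i X * pd j h X) ∧
      (∀ X ∈ V, l i X = gi X * pd i (pd i h) X + 1 / 2 * pd i gi X * pd i h X
        + coef l i j X * gj X * pd j h X) ∧
      (∀ X ∈ V, l j X = gj X * pd j (pd j h) X + 1 / 2 * pd j gj X * pd j h X
        + coef l j i X * gi X * pd i h X) := by
  have lne : ∀ X ∈ V, l j X - l i X ≠ 0 := fun X hX => velocity_sub_ne (hne X hX) hij
  have lne' : ∀ X ∈ V, l i X - l j X ≠ 0 := fun X hX e => lne X hX (by linarith)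
  set A := coef l i j with hAdef
  set B := coef l j i with hBdef
  have sA : ContDiffOn ℝ ∞ A V := smooth_coef hV hl hne hij
  have sB : ContDiffOn ℝ ∞ B V := smooth_coef hV hl hne hij.symm
  have sBi := smooth_pd hV sB i
  have hgj : ∀ X ∈ V, pd j gj X = 0 := fun X hX => by
    rw [pd_congr (g := fun _ => 0) hV hj hX, pd_const]
  -- With gⱼ = 0 flatness becomes ∂ᵢgᵢ = -2u gᵢ. Since also ∂ⱼgᵢ = -2A gᵢ, equality of mixed
  -- derivatives gives ∂ⱼu = ∂ᵢA.
  let u : (Fin 2 → ℝ) → ℝ := fun X => pd i B X / B X + B X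
  have su : ContDiffOn ℝ ∞ u V := (sBi.div sB hB).add sB
  have uB : ∀ X ∈ V, pd i B X = (u X - B X) * B X := fun X hX => by
    have := hB X hX
    simp only [u]; field_simp; ring
  have gu : ∀ X ∈ V, pd i gi X = -2 * (u X * gi X) := fun X hX => by
    have e := (hF X hX).flat
    rw [hgj X hX, hj X hX, ← hBdef, uB X hX] at e
    apply mul_left_cancel₀ (hB X hX)
    linear_combination 2 * e
  have gA : ∀ X ∈ V, pd j gi X = -2 * (A X * gi X) := fun X hX => by
    rw [(hF X hX).pd_fst]; ring
  have compat : ∀ X ∈ V, pd j u X = pd i A X := fun X hX => by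
    have e := pd_comm hV si hX j i
    rw [pd_congr hV gu hX, pd_congr hV gA hX, pd_const_mul hV _ (su.mul si) hX,
      pd_const_mul hV _ (sA.mul si) hX, pd_mul hV su si hX, pd_mul hV sA si hX, gu X hX,
      gA X hX] at e
    apply mul_right_cancel₀ (hi X hX)
    linear_combination -1 / 2 * e
  have hw : ∀ X ∈ V, B X * gi X ≠ 0 := fun X hX => mul_ne_zero (hB X hX) (hi X hX)
  let P : (Fin 2 → ℝ) → ℝ := fun X => l j X / (B X * gi X)
  have sP : ContDiffOn ℝ ∞ P V := (hl j).div (sB.mul si) hw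
  have hP : ∀ X ∈ V, l j X = B X * gi X * P X := fun X hX => by
    rw [mul_comm, div_mul_cancel₀ _ (hw X hX)]
  let m : (Fin 2 → ℝ) → ℝ := fun X => l i X / gi X
  have sm : ContDiffOn ℝ ∞ m V := (hl i).div si hi
  have hm : ∀ X ∈ V, l i X = m X * gi X := fun X hX => by
    have := hi X hX
    simp only [m]; field_simp
  -- This is the equation for λⁱ in terms of P; it follows from ∂ᵢλʲ = B (λⁱ - λʲ).
  have dPi : ∀ X ∈ V, pd i P X = m X + P X * u X := fun X hX => by
    have e := pd_eq_coef (lne' X hX)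
    rw [pd_congr hV hP hX, pd_mul (f := fun X => B X * gi X) hV (sB.mul si) sP hX,
      pd_mul hV sB si hX, gu X hX, uB X hX, ← hBdef, hP X hX, hm X hX] at e
    apply mul_left_cancel₀ (hw X hX)
    linear_combination e
  have mj : ∀ X ∈ V, pd j m X = A X * P X * B X + A X * m X := fun X hX => by
    have e := pd_eq_coef (lne X hX)
    rw [pd_congr hV hm hX, pd_mul hV sm si hX, gA X hX, ← hAdef, hP X hX, hm X hX] at e
    apply mul_right_cancel₀ (hi X hX)
    linear_combination e
  have sPj := smooth_pd hV sP j
  let Q : (Fin 2 → ℝ) → ℝ := fun X => (pd j P X - A X * P X) / B X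
  have sQ : ContDiffOn ℝ ∞ Q V := (sPj.sub (sA.mul sP)).div sB hB
  have hQ : ∀ X ∈ V, pd j P X = Q X * B X + A X * P X := fun X hX => by
    have := hB X hX
    simp only [Q]; field_simp; ring
  have closed : ∀ X ∈ V, pd j P X = pd i Q X := fun X hX => by
    have e1 : pd i (pd j P) X = pd i Q X * B X + Q X * pd i B X + (pd i A X * P X + A X * pd i P X) := by
      rw [pd_congr hV hQ hX, pd_add hV (sQ.mul sB) (sA.mul sP) hX, pd_mul hV sQ sB hX,
        pd_mul hV sA sP hX]
    have e2 : pd j (pd i P) X = pd j m X + (pd j P X * u X + P X * pd j u X) := by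
      rw [pd_congr hV dPi hX, pd_add hV sm (sP.mul su) hX, pd_mul hV sP su hX]
    rw [pd_comm hV sP hX i j, e2, mj X hX, compat X hX, dPi X hX, uB X hX] at e1
    apply mul_right_cancel₀ (hB X hX)
    have e3 := hQ X hX
    linear_combination e1 - (u X - B X) * e3
  obtain ⟨h, sh, hhi, hhj⟩ := exists_potential_pair hV hc hij sP sQ closed
  refine ⟨h, sh, fun X hX => ?_, fun X hX => ?_, fun X hX => ?_⟩
  · rw [pd_congr hV hhi hX, hQ X hX, hhi X hX, hhj X hX]; ring
  · rw [pd_congr hV hhi hX, hhi X hX, dPi X hX, gu X hX, hj X hX, hm X hX]; ring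
  · rw [hj X hX, hgj X hX, hhi X hX, hP X hX]; ring

/-- The Lamé coefficient `|g|^{-1/2}`. -/
theorem exists_lame (hV : IsOpen V) (hc : Convex ℝ V) (s : ContDiffOn ℝ ∞ g1 V)
    (h0 : ∀ X ∈ V, g1 X ≠ 0) : ∃ (H : (Fin 2 → ℝ) → ℝ) (ε : ℝ), ContDiffOn ℝ ∞ H V ∧
      (∀ X, H X ≠ 0) ∧ ε ^ 2 = 1 ∧ (∀ X ∈ V, H X ^ 2 * g1 X = ε) ∧
      ∀ X ∈ V, ∀ a, pd a g1 X * H X = -2 * (g1 X * pd a H X) := by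
  let L : (Fin 2 → ℝ) → ℝ := fun X => Real.log (g1 X)
  have sL : ContDiffOn ℝ ∞ L V := s.log h0
  let H : (Fin 2 → ℝ) → ℝ := fun X => Real.exp (-1 / 2 * L X)
  have sH : ContDiffOn ℝ ∞ H V := (contDiffOn_const.mul sL).exp
  have hsq : ∀ X ∈ V, (H X ^ 2 * g1 X) ^ 2 = 1 := fun X hX => by
    have e : H X ^ 2 = |g1 X|⁻¹ := by
      rw [← Real.exp_log (abs_pos.2 (h0 X hX)), Real.log_abs, ← Real.exp_neg, ← Real.exp_nat_mul]
      simp only [L]; congr 1; push_cast; ring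
    rw [e, mul_pow, ← sq_abs (g1 X), ← mul_pow, inv_mul_cancel₀ (abs_ne_zero.2 (h0 X hX)), one_pow]
  have hpd : ∀ X ∈ V, ∀ a, pd a g1 X * H X = -2 * (g1 X * pd a H X) := fun X hX a => by
    have e : pd a H X = H X * (-1 / 2 * (pd a g1 X / g1 X)) := by
      rw [pd_comp (φ := Real.exp) hV (contDiffOn_const.mul sL) hX (Real.hasDerivAt_exp _),
        pd_const_mul hV _ sL hX, pd_log hV s hX (h0 X hX)]
    rw [e]
    have := h0 X hX
    field_simp
  have hpc : IsPreconnected V := hc.isPreconnected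
  have hcont : ContinuousOn (fun X => H X ^ 2 * g1 X) V :=
    ((sH.pow 2).mul s).continuousOn
  rcases hpc.eq_or_eq_neg_of_sq_eq hcont (continuousOn_const (c := (1 : ℝ)))
    (fun X hX => by simpa using hsq X hX) (fun _ => one_ne_zero) with e | e
  · exact ⟨H, 1, sH, fun X => (Real.exp_pos _).ne', by norm_num, fun X hX => e hX, hpd⟩
  · exact ⟨H, -1, sH, fun X => (Real.exp_pos _).ne', by norm_num, fun X hX => e hX, hpd⟩

/-- Circular or hyperbolic functions, according to the sign `ε`. -/
theorem exists_rotation {ε : ℝ} (hε : ε ^ 2 = 1) : ∃ C S : ℝ → ℝ, ContDiff ℝ ∞ C ∧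
    ContDiff ℝ ∞ S ∧ (∀ t, HasDerivAt C (-ε * S t) t) ∧ (∀ t, HasDerivAt S (C t) t) ∧
    ∀ t, C t ^ 2 + ε * S t ^ 2 = 1 := by
  rcases eq_or_eq_neg_of_sq_eq_sq ε 1 (by simpa using hε) with rfl | rfl
  · exact ⟨Real.cos, Real.sin, Real.contDiff_cos, Real.contDiff_sin,
      fun t => by simpa using Real.hasDerivAt_cos t, Real.hasDerivAt_sin,
      fun t => by simp⟩
  · exact ⟨Real.cosh, Real.sinh, Real.contDiff_cosh, Real.contDiff_sinh,
      fun t => by simpa using Real.hasDerivAt_cosh t, Real.hasDerivAt_sinh,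
      fun t => by linarith [Real.cosh_sq t]⟩

/-- The three equations prescribe the Hessian of h for a flat metric. In a parallel frame the
components p, q of dh have prescribed differentials, so h is obtained by applying the Poincaré lemma
four times: to the angle θ of the frame, to p, to q, and to h. -/
theorem exists_density_nondegenerate (hV : IsOpen V) (hc : Convex ℝ V)
    (hl : ∀ a, ContDiffOn ℝ ∞ (l a) V) (hne : ∀ X ∈ V, l 0 X ≠ l 1 X)
    (s1 : ContDiffOn ℝ ∞ g1 V) (s2 : ContDiffOn ℝ ∞ g2 V)
    (hg1 : ∀ X ∈ V, g1 X ≠ 0) (hg2 : ∀ X ∈ V, g2 X ≠ 0)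
    (hF : ∀ X ∈ V, IsFlatPair l 0 1 g1 g2 X) :
    ∃ h : (Fin 2 → ℝ) → ℝ, ContDiffOn ℝ ∞ h V ∧
      (∀ X ∈ V, pd 1 (pd 0 h) X = coef l 0 1 X * pd 0 h X + coef l 1 0 X * pd 1 h X) ∧
      (∀ X ∈ V, l 0 X = g1 X * pd 0 (pd 0 h) X + 1 / 2 * pd 0 g1 X * pd 0 h X
        + coef l 0 1 X * g2 X * pd 1 h X) ∧
      (∀ X ∈ V, l 1 X = g2 X * pd 1 (pd 1 h) X + 1 / 2 * pd 1 g2 X * pd 1 h X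
        + coef l 1 0 X * g1 X * pd 0 h X) := by
  obtain ⟨H1, ε1, sH1, hH1, hε1, hN1, hD1⟩ := exists_lame hV hc s1 hg1
  obtain ⟨H2, ε2, sH2, hH2, hε2, hN2, hD2⟩ := exists_lame hV hc s2 hg2
  have hε : (ε1 * ε2) ^ 2 = 1 := by rw [mul_pow, hε1, hε2, one_mul]
  have lA : ∀ X ∈ V, pd 1 (l 0) X = coef l 0 1 X * (l 1 X - l 0 X) := fun X hX =>
    pd_eq_coef (sub_ne_zero.2 (hne X hX).symm)
  have lB : ∀ X ∈ V, pd 0 (l 1) X = coef l 1 0 X * (l 0 X - l 1 X) := fun X hX =>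
    pd_eq_coef (sub_ne_zero.2 (hne X hX))
  set A := coef l 0 1 with hAdef
  set B := coef l 1 0 with hBdef
  have sA : ContDiffOn ℝ ∞ A V := smooth_coef hV hl hne (by decide)
  have sB : ContDiffOn ℝ ∞ B V := smooth_coef hV hl hne (by decide)
  have d1 : ∀ X ∈ V, pd 1 H1 X = A X * H1 X := fun X hX => by
    have e := hD1 X hX 1
    rw [(hF X hX).pd_fst, ← hAdef] at e
    apply mul_left_cancel₀ (hg1 X hX)
    linear_combination 1 / 2 * e
  have d2 : ∀ X ∈ V, pd 0 H2 X = B X * H2 X := fun X hX => by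
    have e := hD2 X hX 0
    rw [(hF X hX).pd_snd, ← hBdef] at e
    apply mul_left_cancel₀ (hg2 X hX)
    linear_combination 1 / 2 * e
  -- The rotation coefficients of the orthonormal coframe H₁ dX⁰, H₂ dX¹.
  let α : (Fin 2 → ℝ) → ℝ := fun X => A X * H1 X / H2 X
  let β : (Fin 2 → ℝ) → ℝ := fun X => B X * H2 X / H1 X
  have sα : ContDiffOn ℝ ∞ α V := (sA.mul sH1).div sH2 fun X _ => hH2 X
  have sβ : ContDiffOn ℝ ∞ β V := (sB.mul sH2).div sH1 fun X _ => hH1 X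
  have hα : ∀ X ∈ V, A X * H1 X = α X * H2 X := fun X _ => by
    have := hH2 X; simp only [α]; field_simp
  have hβ : ∀ X ∈ V, B X * H2 X = β X * H1 X := fun X _ => by
    have := hH1 X; simp only [β]; field_simp
  -- Flatness is precisely closedness of the connection form α dX⁰ - ε₁ε₂ β dX¹, whose potential θ
  -- is the angle of a parallel frame.
  have cθ : ∀ X ∈ V, pd 1 α X = pd 0 (fun Y => -(ε1 * ε2) * β Y) X := fun X hX => by
    rw [pd_const_mul hV _ sβ hX]
    have eα : pd 1 A X * H1 X + A X * pd 1 H1 X = pd 1 α X * H2 X + α X * pd 1 H2 X := by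
      rw [← pd_mul hV sA sH1 hX, ← pd_mul hV sα sH2 hX]; exact pd_congr hV hα hX
    have eβ : pd 0 B X * H2 X + B X * pd 0 H2 X = pd 0 β X * H1 X + β X * pd 0 H1 X := by
      rw [← pd_mul hV sB sH2 hX, ← pd_mul hV sβ sH1 hX]; exact pd_congr hV hβ hX
    rw [d1 X hX] at eα
    rw [d2 X hX] at eβ
    have f := (hF X hX).flat
    have n1 := hN1 X hX
    have n2 := hN2 X hX
    have q1 := hD1 X hX 0
    have q2 := hD2 X hX 1
    have a1 := hα X hX
    have b1 := hβ X hX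
    rw [← hAdef, ← hBdef] at f
    have k : ε1 * pd 0 β X + ε2 * pd 1 α X = 0 := by
      rw [← n1, ← n2]
      linear_combination H1 X * H2 X * f - H1 X * g1 X * eβ - H2 X * g2 X * eα
        - 1 / 2 * B X * H2 X * q1 - 1 / 2 * A X * H1 X * q2
        + g1 X * pd 0 H1 X * b1 + g2 X * pd 1 H2 X * a1
    linear_combination ε2 * k - (pd 1 α X) * hε2
  obtain ⟨θ, sθ, θ0, θ1⟩ := exists_potential hV hc sα (contDiffOn_const.mul sβ) cθ
  obtain ⟨C, S, sC, sS, hC, hS, hCS⟩ := exists_rotation hε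
  let c : (Fin 2 → ℝ) → ℝ := fun X => C (θ X)
  let s : (Fin 2 → ℝ) → ℝ := fun X => S (θ X)
  have sc : ContDiffOn ℝ ∞ c V := sC.comp_contDiffOn sθ
  have ss : ContDiffOn ℝ ∞ s V := sS.comp_contDiffOn sθ
  have dc : ∀ X ∈ V, ∀ a, pd a c X = -(ε1 * ε2) * s X * pd a θ X := fun X hX a =>
    pd_comp hV sθ hX (hC _)
  have ds : ∀ X ∈ V, ∀ a, pd a s X = c X * pd a θ X := fun X hX a =>
    pd_comp hV sθ hX (hS _)
  have hcs : ∀ X, c X ^ 2 + ε1 * ε2 * s X ^ 2 = 1 := fun X => hCS _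
  -- The prescribed diagonal Hessian terms in the orthonormal frame; `dr` and `dt` express the
  -- equations for ∂₁λ⁰ and ∂₀λ¹ in terms of them.
  let r : (Fin 2 → ℝ) → ℝ := fun X => ε1 * (l 0 X * H1 X)
  let t : (Fin 2 → ℝ) → ℝ := fun X => ε2 * (l 1 X * H2 X)
  have sr : ContDiffOn ℝ ∞ r V := contDiffOn_const.mul ((hl 0).mul sH1)
  have st : ContDiffOn ℝ ∞ t V := contDiffOn_const.mul ((hl 1).mul sH2)
  have dr : ∀ X ∈ V, pd 1 r X = ε1 * ε2 * α X * t X := fun X hX => by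
    rw [pd_const_mul hV _ ((hl 0).mul sH1) hX, pd_mul hV (hl 0) sH1 hX, lA X hX, d1 X hX]
    simp only [t]
    linear_combination ε1 * l 1 X * hα X hX - ε1 * α X * l 1 X * H2 X * hε2
  have dt : ∀ X ∈ V, pd 0 t X = ε1 * ε2 * β X * r X := fun X hX => by
    rw [pd_const_mul hV _ ((hl 1).mul sH2) hX, pd_mul hV (hl 1) sH2 hX, lB X hX, d2 X hX]
    simp only [r]
    linear_combination ε2 * l 0 X * hβ X hX - ε2 * β X * l 0 X * H1 X * hε1
  have cp : ∀ X ∈ V, pd 1 (fun Y => c Y * r Y) X = pd 0 (fun Y => ε1 * ε2 * (s Y * t Y)) X :=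
    fun X hX => by
      rw [pd_mul hV sc sr hX, pd_const_mul hV _ (ss.mul st) hX, pd_mul hV ss st hX, dc X hX,
        ds X hX, dr X hX, dt X hX, θ0 X hX, θ1 X hX]
      ring
  have cq : ∀ X ∈ V, pd 1 (fun Y => -(s Y * r Y)) X = pd 0 (fun Y => c Y * t Y) X :=
    fun X hX => by
      rw [pd_mul hV sc st hX, pd_neg, pd_mul hV ss sr hX, dc X hX,
        ds X hX, dr X hX, dt X hX, θ0 X hX, θ1 X hX]
      ring
  obtain ⟨p, sp, p0, p1⟩ := exists_potential hV hc (sc.mul sr)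
    (contDiffOn_const.mul (ss.mul st)) cp
  obtain ⟨q, sq, q0, q1⟩ := exists_potential hV hc (ss.mul sr).neg (sc.mul st) cq
  -- Rotating (p, q) back gives the components ∂₀h / H₁ and ∂₁h / H₂ of the density to be found.
  let u : (Fin 2 → ℝ) → ℝ := fun X => c X * p X - ε1 * ε2 * (s X * q X)
  let v : (Fin 2 → ℝ) → ℝ := fun X => s X * p X + c X * q X
  have su : ContDiffOn ℝ ∞ u V := (sc.mul sp).sub (contDiffOn_const.mul (ss.mul sq))
  have sv : ContDiffOn ℝ ∞ v V := (ss.mul sp).add (sc.mul sq)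
  have du : ∀ X ∈ V, ∀ a, pd a u X = -(ε1 * ε2) * pd a θ X * v X
      + (c X * pd a p X - ε1 * ε2 * (s X * pd a q X)) := fun X hX a => by
    rw [pd_sub hV (sc.mul sp) (contDiffOn_const.mul (ss.mul sq)) hX, pd_mul hV sc sp hX,
      pd_const_mul hV _ (ss.mul sq) hX, pd_mul hV ss sq hX, dc X hX, ds X hX]
    simp only [v]; ring
  have dv : ∀ X ∈ V, ∀ a, pd a v X = pd a θ X * u X + (s X * pd a p X + c X * pd a q X) :=
    fun X hX a => by
      rw [pd_add hV (ss.mul sp) (sc.mul sq) hX, pd_mul hV ss sp hX, pd_mul hV sc sq hX, dc X hX,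
        ds X hX]
      simp only [u]; ring
  have u0 : ∀ X ∈ V, pd 0 u X = -(ε1 * ε2) * α X * v X + r X := fun X hX => by
    rw [du X hX, θ0 X hX, p0 X hX, q0 X hX]
    linear_combination r X * hcs X
  have u1 : ∀ X ∈ V, pd 1 u X = β X * v X := fun X hX => by
    rw [du X hX, θ1 X hX, p1 X hX, q1 X hX]
    linear_combination β X * v X * hε
  have v0 : ∀ X ∈ V, pd 0 v X = α X * u X := fun X hX => by
    rw [dv X hX, θ0 X hX, p0 X hX, q0 X hX]
    ring
  have v1 : ∀ X ∈ V, pd 1 v X = -(ε1 * ε2) * β X * u X + t X := fun X hX => by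
    rw [dv X hX, θ1 X hX, p1 X hX, q1 X hX]
    linear_combination t X * hcs X
  have ch : ∀ X ∈ V, pd 1 (fun Y => H1 Y * u Y) X = pd 0 (fun Y => H2 Y * v Y) X := fun X hX => by
    rw [pd_mul hV sH1 su hX, pd_mul hV sH2 sv hX, d1 X hX, d2 X hX, u1 X hX, v0 X hX]
    linear_combination u X * hα X hX - v X * hβ X hX
  obtain ⟨h, sh, h0, h1⟩ := exists_potential hV hc (sH1.mul su) (sH2.mul sv) ch
  refine ⟨h, sh, fun X hX => ?_, fun X hX => ?_, fun X hX => ?_⟩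
  · rw [pd_congr hV h0 hX, h0 X hX, h1 X hX, pd_mul hV sH1 su hX, d1 X hX, u1 X hX]
    linear_combination -v X * hβ X hX
  · rw [pd_congr hV h0 hX, h0 X hX, h1 X hX, pd_mul hV sH1 su hX, u0 X hX]
    apply mul_right_cancel₀ (hH2 X)
    simp only [r]
    linear_combination -(1 / 2 * u X * H2 X) * hD1 X hX 0 - (A X * v X) * hN2 X hX
      - l 0 X * H2 X * ε1 * hN1 X hX - l 0 X * H2 X * hε1
      - (ε1 * ε2 * g1 X * H1 X * v X) * hα X hX + ε1 * ε2 * A X * v X * hN1 X hX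
      + ε2 * A X * v X * hε1
  · rw [pd_congr hV h1 hX, h0 X hX, h1 X hX, pd_mul hV sH2 sv hX, v1 X hX]
    apply mul_right_cancel₀ (hH1 X)
    simp only [t]
    linear_combination -(1 / 2 * v X * H1 X) * hD2 X hX 1 - (B X * u X) * hN1 X hX
      - l 1 X * H1 X * ε2 * hN2 X hX - l 1 X * H1 X * hε2
      - (ε1 * ε2 * g2 X * H2 X * u X) * hβ X hX + ε1 * ε2 * B X * u X * hN2 X hX
      + ε1 * B X * u X * hε2

end Hydro
end

noncomputable section

namespace Hydro

variable {U V : Set (Fin 2 → ℝ)} {l : Fin 2 → (Fin 2 → ℝ) → ℝ}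
  {Γ : Fin 2 → Fin 2 → Fin 2 → (Fin 2 → ℝ) → ℝ} {K : Fin 2 → (Fin 2 → ℝ) → ℝ}

/-! ### Linear first integrals and the Killing equations -/

theorem smooth_christoffel (hV : IsOpen V) (hl : ∀ a, ContDiffOn ℝ ∞ (l a) V)
    (hne : ∀ X ∈ V, l 0 X ≠ l 1 X) (hA : ∀ X ∈ V, coefA l X ≠ 0) (hB : ∀ X ∈ V, coefB l X ≠ 0)
    (c a b : Fin 2) : ContDiffOn ℝ ∞ (christoffel l c a b) V := by
  have sA : ContDiffOn ℝ ∞ (coefA l) V := smooth_coef hV hl hne (i := 0) (j := 1) (by decide)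
  have sB : ContDiffOn ℝ ∞ (coefB l) V := smooth_coef hV hl hne (i := 1) (j := 0) (by decide)
  have dA := fun a => smooth_pd hV (sA.log hA) a
  have dB := fun a => smooth_pd hV (sB.log hB) a
  have m0 := ((contDiffOn_const (c := (1 / 2 : ℝ))).mul (dA 1)).add sA |>.neg
  have m1 := ((contDiffOn_const (c := (1 / 2 : ℝ))).mul (dB 0)).add sB |>.neg
  fin_cases c <;> fin_cases a <;> fin_cases b
  exacts [(dA 0).sub (contDiffOn_const.mul sB), m0, m0, contDiffOn_const,
    contDiffOn_const, m1, m1, (dB 1).sub (contDiffOn_const.mul sA)]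

/-- The Killing equations for a one-form `K` at the point `X`. -/
structure IsKilling (l : Fin 2 → (Fin 2 → ℝ) → ℝ) (K : Fin 2 → (Fin 2 → ℝ) → ℝ)
    (X : Fin 2 → ℝ) : Prop where
  eq00 : pd 0 (K 0) X = christoffel l 0 0 0 X * K 0 X
  eq11 : pd 1 (K 1) X = christoffel l 1 1 1 X * K 1 X
  eq01 : pd 0 (K 1) X + pd 1 (K 0) X
    = 2 * (christoffel l 0 0 1 X * K 0 X + christoffel l 1 0 1 X * K 1 X)

theorem hasDerivAt_pairing (hV : IsOpen V) (hK : ∀ a, ContDiffOn ℝ ∞ (K a) V) {s t : ℝ}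
    {γ v : ℝ → Fin 2 → ℝ} (h : IsGeodesic (christoffel l) V s t γ v) {τ : ℝ}
    (hτ : τ ∈ Set.Ioo s t) : HasDerivAt (fun σ => ∑ a, K a (γ σ) * v σ a)
      ((pd 0 (K 0) (γ τ) - christoffel l 0 0 0 (γ τ) * K 0 (γ τ)) * v τ 0 ^ 2
        + (pd 1 (K 1) (γ τ) - christoffel l 1 1 1 (γ τ) * K 1 (γ τ)) * v τ 1 ^ 2
        + (pd 0 (K 1) (γ τ) + pd 1 (K 0) (γ τ) - 2 * (christoffel l 0 0 1 (γ τ) * K 0 (γ τ)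
          + christoffel l 1 0 1 (γ τ) * K 1 (γ τ))) * (v τ 0 * v τ 1)) τ := by
  obtain ⟨hin, h1, h2⟩ := h τ hτ
  have hd := HasDerivAt.fun_sum (u := Finset.univ) fun (a : Fin 2) _ =>
    (hasDerivAt_along (smooth_diffAt hV (hK a) hin) h1).fun_mul (hasDerivAt_pi.1 h2 a)
  refine hd.congr_deriv ?_
  simp only [Fin.sum_univ_two, show christoffel l 0 1 0 = christoffel l 0 0 1 from rfl,
    show christoffel l 1 1 0 = christoffel l 1 0 1 from rfl,
    show christoffel l 0 1 1 = fun _ => 0 from rfl, show christoffel l 1 0 0 = fun _ => 0 from rfl]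
  ring

theorem isLinearFirstIntegral_of_killing (hV : IsOpen V) (hK : ∀ a, ContDiffOn ℝ ∞ (K a) V)
    (h : ∀ X ∈ V, IsKilling l K X) : IsLinearFirstIntegral (christoffel l) V K := by
  refine ⟨hK, fun s t γ v hg τ hτ => (hasDerivAt_pairing hV hK hg hτ).congr_deriv ?_⟩
  have k := h _ (hg τ hτ).1
  rw [k.eq00, k.eq11, k.eq01]
  ring

/-- Picard–Lindelöf for the first-order system in position and velocity, with time shortened to keep
the curve in V. -/
theorem exists_geodesic (hV : IsOpen V) (hΓ : ∀ c a b, ContDiffOn ℝ ∞ (Γ c a b) V)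
    {X : Fin 2 → ℝ} (hX : X ∈ V) (w : Fin 2 → ℝ) : ∃ (ε : ℝ) (γ v : ℝ → Fin 2 → ℝ), 0 < ε ∧
      IsGeodesic Γ V (-ε) ε γ v ∧ γ 0 = X ∧ v 0 = w := by
  let F : (Fin 2 → ℝ) × (Fin 2 → ℝ) → (Fin 2 → ℝ) × (Fin 2 → ℝ) := fun z =>
    (z.2, fun c => -∑ a, ∑ b, Γ c a b z.1 * z.2 a * z.2 b)
  have hF : ContDiffAt ℝ 1 F (X, w) := by
    refine ContDiffAt.prodMk contDiffAt_snd (contDiffAt_pi.2 fun c => ContDiffAt.neg ?_)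
    refine ContDiffAt.sum fun a _ => ContDiffAt.sum fun b _ => ?_
    have h1 : ContDiffAt ℝ 1 (fun z : (Fin 2 → ℝ) × (Fin 2 → ℝ) => Γ c a b z.1) (X, w) :=
      (((hΓ c a b).contDiffAt (hV.mem_nhds hX)).of_le (by simp)).comp (X, w) contDiffAt_fst
    have h2 : ∀ i, ContDiffAt ℝ 1 (fun z : (Fin 2 → ℝ) × (Fin 2 → ℝ) => z.2 i) (X, w) := fun i =>
      contDiffAt_pi.1 contDiffAt_snd i
    exact (h1.mul (h2 a)).mul (h2 b)
  obtain ⟨α, hα0, ε, hε, hα⟩ :=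
    hF.exists_forall_mem_closedBall_exists_eq_forall_mem_Ioo_hasDerivAt₀ 0
  have hc : ContinuousAt (fun t => (α t).1) 0 :=
    continuous_fst.continuousAt.comp (hα 0 (by simp [hε])).continuousAt
  have hnhds : (fun t => (α t).1) ⁻¹' V ∈ 𝓝 (0 : ℝ) :=
    hc.preimage_mem_nhds (hV.mem_nhds (by simpa [hα0] using hX))
  obtain ⟨δ, hδ, hball⟩ := Metric.mem_nhds_iff.1 hnhds
  refine ⟨min ε δ, fun t => (α t).1, fun t => (α t).2, lt_min hε hδ, fun τ hτ => ⟨?_, ?_, ?_⟩,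
    by simp [hα0], by simp [hα0]⟩
  · refine hball ?_
    rw [Metric.mem_ball, Real.dist_0_eq_abs, abs_lt]
    exact ⟨by linarith [hτ.1, min_le_right ε δ], by linarith [hτ.2, min_le_right ε δ]⟩
  all_goals
    have hd := hα τ ⟨by linarith [hτ.1, min_le_left ε δ], by linarith [hτ.2, min_le_left ε δ]⟩
  · exact (hasFDerivAt_fst.comp_hasDerivAt τ hd :)
  · exact (hasFDerivAt_snd.comp_hasDerivAt τ hd :)

theorem IsLinearFirstIntegral.killing (hV : IsOpen V) (hl : ∀ a, ContDiffOn ℝ ∞ (l a) V)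
    (hne : ∀ X ∈ V, l 0 X ≠ l 1 X) (hA : ∀ X ∈ V, coefA l X ≠ 0) (hB : ∀ X ∈ V, coefB l X ≠ 0)
    (h : IsLinearFirstIntegral (christoffel l) V K) {X : Fin 2 → ℝ} (hX : X ∈ V) :
    IsKilling l K X := by
  have key : ∀ w : Fin 2 → ℝ,
      (pd 0 (K 0) X - christoffel l 0 0 0 X * K 0 X) * w 0 ^ 2
        + (pd 1 (K 1) X - christoffel l 1 1 1 X * K 1 X) * w 1 ^ 2
        + (pd 0 (K 1) X + pd 1 (K 0) X - 2 * (christoffel l 0 0 1 X * K 0 X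
          + christoffel l 1 0 1 X * K 1 X)) * (w 0 * w 1) = 0 := fun w => by
    obtain ⟨ε, γ, v, hε, hg, h0, h1⟩ :=
      exists_geodesic hV (smooth_christoffel hV hl hne hA hB) hX w
    have hm : (0 : ℝ) ∈ Set.Ioo (-ε) ε := by simp [hε]
    have e := (hasDerivAt_pairing hV h.1 hg hm).unique (h.2 _ _ _ _ hg 0 hm)
    rwa [h0, h1] at e
  -- Three directions determine the three coefficients of a binary quadratic form.
  have e0 := key ![1, 0]
  have e1 := key ![0, 1]
  have e2 := key ![1, 1]
  simp only [Matrix.cons_val_zero, Matrix.cons_val_one] at e0 e1 e2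
  exact ⟨by linarith, by linarith, by linarith⟩

/-- The heart of the correspondence; note the crossing of indices. The 00 equation is the one for
∂₀g², the 11 equation the one for ∂₁g¹, and the mixed equation is twice the flatness equation. The
logarithmic derivatives in the Christoffel symbols absorb the derivatives of the factors A and B. -/
theorem isKilling_iff_isFlatPair (hV : IsOpen V) (hl : ∀ a, ContDiffOn ℝ ∞ (l a) V)
    (hne : ∀ X ∈ V, l 0 X ≠ l 1 X) (hA : ∀ X ∈ V, coefA l X ≠ 0) (hB : ∀ X ∈ V, coefB l X ≠ 0)
    {g1 g2 : (Fin 2 → ℝ) → ℝ} (h1 : ContDiffOn ℝ ∞ g1 V) (h2 : ContDiffOn ℝ ∞ g2 V)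
    (hK0 : ∀ X ∈ V, K 0 X = coefA l X * g2 X) (hK1 : ∀ X ∈ V, K 1 X = coefB l X * g1 X)
    {X : Fin 2 → ℝ} (hX : X ∈ V) : IsKilling l K X ↔ IsFlatPair l 0 1 g1 g2 X := by
  have sA : ContDiffOn ℝ ∞ (coefA l) V := smooth_coef hV hl hne (i := 0) (j := 1) (by decide)
  have sB : ContDiffOn ℝ ∞ (coefB l) V := smooth_coef hV hl hne (i := 1) (j := 0) (by decide)
  have dK0 : ∀ a, pd a (K 0) X = pd a (coefA l) X * g2 X + coefA l X * pd a g2 X := fun a => by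
    rw [pd_congr hV hK0 hX, pd_mul hV sA h2 hX]
  have dK1 : ∀ a, pd a (K 1) X = pd a (coefB l) X * g1 X + coefB l X * pd a g1 X := fun a => by
    rw [pd_congr hV hK1 hX, pd_mul hV sB h1 hX]
  have a0 := hA X hX
  have b0 := hB X hX
  have c0 : christoffel l 0 0 0 X * coefA l X = pd 0 (coefA l) X - 2 * coefB l X * coefA l X := by
    change (pd 0 (fun Y => Real.log (coefA l Y)) X - 2 * coefB l X) * coefA l X = _
    rw [pd_log hV sA hX a0]; field_simp
  have c1 : christoffel l 1 1 1 X * coefB l X = pd 1 (coefB l) X - 2 * coefA l X * coefB l X := by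
    change (pd 1 (fun Y => Real.log (coefB l Y)) X - 2 * coefA l X) * coefB l X = _
    rw [pd_log hV sB hX b0]; field_simp
  have c2 : 2 * (christoffel l 0 0 1 X * coefA l X) = -(pd 1 (coefA l) X + 2 * coefA l X ^ 2) := by
    change 2 * (-(1 / 2 * pd 1 (fun Y => Real.log (coefA l Y)) X + coefA l X) * coefA l X) = _
    rw [pd_log hV sA hX a0]; field_simp
  have c3 : 2 * (christoffel l 1 0 1 X * coefB l X) = -(pd 0 (coefB l) X + 2 * coefB l X ^ 2) := by
    change 2 * (-(1 / 2 * pd 0 (fun Y => Real.log (coefB l Y)) X + coefB l X) * coefB l X) = _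
    rw [pd_log hV sB hX b0]; field_simp
  have hcA : coef l 0 1 = coefA l := rfl
  have hcB : coef l 1 0 = coefB l := rfl
  constructor
  · rintro ⟨e0, e1, e2⟩
    rw [dK0, hK0 X hX] at e0
    rw [dK1, hK1 X hX] at e1
    rw [dK0, dK1, hK0 X hX, hK1 X hX] at e2
    refine ⟨?_, ?_, ?_⟩
    · rw [hcA]; apply mul_left_cancel₀ b0
      linear_combination e1 + g1 X * c1
    · rw [hcB]; apply mul_left_cancel₀ a0
      linear_combination e0 + g2 X * c0
    · rw [hcA, hcB]
      linear_combination 1 / 2 * e2 + 1 / 2 * g2 X * c2 + 1 / 2 * g1 X * c3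
  · rintro ⟨e0, e1, e2⟩
    rw [hcA] at e0
    rw [hcB] at e1
    rw [hcA, hcB] at e2
    refine ⟨?_, ?_, ?_⟩
    · rw [dK0, hK0 X hX]
      linear_combination coefA l X * e1 - g2 X * c0
    · rw [dK1, hK1 X hX]
      linear_combination coefB l X * e0 - g1 X * c1
    · rw [dK0, dK1, hK0 X hX, hK1 X hX]
      linear_combination 2 * e2 - g2 X * c2 - g1 X * c3

/-! ### Unique continuation of Killing forms -/

/-- Grönwall's inequality, with the matrix bounded by the sum of the absolute values of its entries
on the compact interval. -/
theorem eq_zero_of_linear_ode {ι : Type*} [Fintype ι] {f : ℝ → ι → ℝ} {N : ℝ → ι → ι → ℝ}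
    (hf : ∀ t ∈ Set.Icc (0 : ℝ) 1, HasDerivAt f (fun i => ∑ j, N t i j * f t j) t)
    (hN : ∀ i j, ContinuousOn (fun t => N t i j) (Set.Icc 0 1)) (h0 : f 0 = 0) : f 1 = 0 := by
  have hc : ContinuousOn (fun t => ∑ i, ∑ j, |N t i j|) (Set.Icc 0 1) :=
    continuousOn_finsetSum _ fun i _ => continuousOn_finsetSum _ fun j _ => (hN i j).abs
  obtain ⟨M, hM⟩ := isCompact_Icc.exists_bound_of_continuousOn hc
  refine eq_zero_of_abs_deriv_le_mul_abs_self_of_eq_zero_right (K := M) (a := 0) (b := 1)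
    (fun t ht => (hf t ht).continuousAt.continuousWithinAt)
    (fun t ht => (hf t (Set.Ico_subset_Icc_self ht)).hasDerivWithinAt) h0 (fun t ht => ?_) 1
    (by simp)
  have hMt := hM t (Set.Ico_subset_Icc_self ht)
  rw [Real.norm_of_nonneg (Finset.sum_nonneg fun i _ => Finset.sum_nonneg fun j _ => abs_nonneg _)]
    at hMt
  have hM0 : 0 ≤ M := le_trans
    (Finset.sum_nonneg fun i _ => Finset.sum_nonneg fun j _ => abs_nonneg _) hMt
  rw [pi_norm_le_iff_of_nonneg (by positivity)]
  intro i
  calc ‖∑ j, N t i j * f t j‖ ≤ ∑ j, |N t i j| * ‖f t‖ := by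
        refine (norm_sum_le _ _).trans (Finset.sum_le_sum fun j _ => ?_)
        rw [norm_mul, Real.norm_eq_abs]
        gcongr
        exact norm_le_pi_norm (f t) j
    _ = (∑ j, |N t i j|) * ‖f t‖ := by rw [Finset.sum_mul]
    _ ≤ M * ‖f t‖ := by
        gcongr
        refine le_trans ?_ hMt
        exact Finset.single_le_sum (f := fun i => ∑ j, |N t i j|)
          (fun i _ => Finset.sum_nonneg fun j _ => abs_nonneg _) (Finset.mem_univ i)

/-- The common zero set is open, by the linear equation along segments in a ball, and relatively
closed; connectedness concludes. -/
theorem eq_zero_of_closed_system {ι : Type*} [Fintype ι] (hV : IsOpen V) (hVc : IsPreconnected V)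
    {z : ι → (Fin 2 → ℝ) → ℝ} (hz : ∀ i, ContDiffOn ℝ ∞ (z i) V)
    {N : Fin 2 → ι → ι → (Fin 2 → ℝ) → ℝ} (hN : ∀ a i j, ContinuousOn (N a i j) V)
    (h : ∀ X ∈ V, ∀ a i, pd a (z i) X = ∑ j, N a i j X * z j X) {X₀ : Fin 2 → ℝ} (hX₀ : X₀ ∈ V)
    (h0 : ∀ i, z i X₀ = 0) : ∀ X ∈ V, ∀ i, z i X = 0 := by
  let Z : Set (Fin 2 → ℝ) := {X | X ∈ V ∧ ∀ i, z i X = 0}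
  have hZ : IsOpen Z := by
    rw [Metric.isOpen_iff]
    rintro X ⟨hX, hXz⟩
    obtain ⟨r, hr, hball⟩ := Metric.isOpen_iff.1 hV X hX
    refine ⟨r, hr, fun Y hY => ⟨hball hY, ?_⟩⟩
    have hseg : ∀ t ∈ Set.Icc (0 : ℝ) 1, X + t • (Y - X) ∈ V := fun t ht => hball <|
      (convex_ball X r).add_smul_sub_mem (Metric.mem_ball_self hr) hY ht
    have hline : ∀ t : ℝ, HasDerivAt (fun t : ℝ => X + t • (Y - X)) (Y - X) t := fun t => by
      simpa using ((hasDerivAt_id t).smul_const (Y - X)).const_add X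
    have hcont : ContinuousOn (fun t : ℝ => X + t • (Y - X)) (Set.Icc 0 1) := by fun_prop
    have e := eq_zero_of_linear_ode (f := fun t i => z i (X + t • (Y - X)))
      (N := fun t i j => N 0 i j (X + t • (Y - X)) * (Y - X) 0
        + N 1 i j (X + t • (Y - X)) * (Y - X) 1) (fun t ht => hasDerivAt_pi.2 fun i => by
          refine (hasDerivAt_along (smooth_diffAt hV (hz i) (hseg t ht)) (hline t)).congr_deriv ?_
          rw [h _ (hseg t ht), h _ (hseg t ht), Finset.sum_mul, Finset.sum_mul,
            ← Finset.sum_add_distrib]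
          exact Finset.sum_congr rfl fun j _ => by ring)
      (fun i j => (((hN 0 i j).comp hcont hseg).mul continuousOn_const).add
        (((hN 1 i j).comp hcont hseg).mul continuousOn_const)) (by funext i; simpa using hXz i)
    intro i
    simpa using congrFun e i
  have hsub : V ⊆ Z := by
    refine hVc.subset_of_closure_inter_subset hZ ⟨X₀, hX₀, hX₀, h0⟩ ?_
    rintro X ⟨hXc, hX⟩
    refine ⟨hX, fun i => ?_⟩
    by_contra hne
    have hO : IsOpen (V ∩ z i ⁻¹' {0}ᶜ) :=
      (hz i).continuousOn.isOpen_inter_preimage hV isOpen_compl_singleton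
    obtain ⟨Y, hY, hYZ⟩ := mem_closure_iff.1 hXc _ hO ⟨hX, hne⟩
    exact hY.2 (hYZ.2 i)
  exact fun X hX => (hsub hX).2

/-- A Killing form on a connected open set vanishes if it vanishes at a point together with
the derivative `∂_2 K_1` there. -/
theorem eq_zero_of_killing (hV : IsOpen V) (hVc : IsPreconnected V)
    (hl : ∀ a, ContDiffOn ℝ ∞ (l a) V)
    (hne : ∀ X ∈ V, l 0 X ≠ l 1 X) (hA : ∀ X ∈ V, coefA l X ≠ 0) (hB : ∀ X ∈ V, coefB l X ≠ 0)
    (hK : ∀ a, ContDiffOn ℝ ∞ (K a) V) (h : ∀ X ∈ V, IsKilling l K X) {X₀ : Fin 2 → ℝ}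
    (hX₀ : X₀ ∈ V) (h0 : ∀ a, K a X₀ = 0) (h1 : pd 1 (K 0) X₀ = 0) :
    ∀ X ∈ V, ∀ a, K a X = 0 := by
  have sΓ := smooth_christoffel hV hl hne hA hB
  let a := christoffel l 0 0 0
  let b := christoffel l 1 1 1
  let p : (Fin 2 → ℝ) → ℝ := fun X => 2 * christoffel l 0 0 1 X
  let q : (Fin 2 → ℝ) → ℝ := fun X => 2 * christoffel l 1 0 1 X
  have sa : ContDiffOn ℝ ∞ a V := sΓ 0 0 0
  have sb : ContDiffOn ℝ ∞ b V := sΓ 1 1 1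
  have sp : ContDiffOn ℝ ∞ p V := contDiffOn_const.mul (sΓ 0 0 1)
  have sq : ContDiffOn ℝ ∞ q V := contDiffOn_const.mul (sΓ 1 0 1)
  have sy := smooth_pd hV (hK 0) 1
  have e00 : ∀ X ∈ V, pd 0 (K 0) X = a X * K 0 X := fun X hX => (h X hX).eq00
  have e11 : ∀ X ∈ V, pd 1 (K 1) X = b X * K 1 X := fun X hX => (h X hX).eq11
  have ey : ∀ X ∈ V, pd 1 (K 0) X = p X * K 0 X + q X * K 1 X - pd 0 (K 1) X := fun X hX => by
    have := (h X hX).eq01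
    simp only [p, q]; linarith
  have e10 : ∀ X ∈ V, pd 0 (K 1) X = p X * K 0 X + q X * K 1 X - pd 1 (K 0) X := fun X hX => by
    linarith [ey X hX]
  have y0 : ∀ X ∈ V, pd 0 (pd 1 (K 0)) X = pd 1 a X * K 0 X + a X * pd 1 (K 0) X := fun X hX => by
    rw [pd_comm hV (hK 0) hX, pd_congr hV e00 hX, pd_mul hV sa (hK 0) hX]
  -- Differentiating the mixed Killing equation in direction 1 produces ∂₁∂₀K₁ = ∂₀(b K₁), which has
  -- order one again. This closes the system.
  have y1 : ∀ X ∈ V, pd 1 (pd 1 (K 0)) X = (pd 1 p X - b X * p X) * K 0 X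
      + (pd 1 q X - pd 0 b X) * K 1 X + (p X + b X) * pd 1 (K 0) X := fun X hX => by
    rw [pd_congr hV ey hX, pd_sub hV ((sp.mul (hK 0)).add (sq.mul (hK 1))) (smooth_pd hV (hK 1) 0) hX,
      pd_add hV (sp.mul (hK 0)) (sq.mul (hK 1)) hX, pd_mul hV sp (hK 0) hX, pd_mul hV sq (hK 1) hX,
      pd_comm hV (hK 1) hX 1 0, pd_congr hV e11 hX, pd_mul hV sb (hK 1) hX, e11 X hX, e10 X hX]
    ring
  -- The prolonged unknown: both components of K and ∂₁K₀.
  let z : Fin 3 → (Fin 2 → ℝ) → ℝ := ![K 0, K 1, pd 1 (K 0)]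
  let N : Fin 2 → Fin 3 → Fin 3 → (Fin 2 → ℝ) → ℝ := ![
    ![![a, 0, 0], ![p, q, -1], ![pd 1 a, 0, a]],
    ![![0, 0, 1], ![0, b, 0], ![pd 1 p - b * p, pd 1 q - pd 0 b, p + b]]]
  have ca := sa.continuousOn
  have cb := sb.continuousOn
  have cp := sp.continuousOn
  have cq := sq.continuousOn
  have k0 : ContinuousOn (fun _ : Fin 2 → ℝ => (0 : ℝ)) V := continuousOn_const
  have key := eq_zero_of_closed_system (z := z) (N := N) hV hVc
    (fun i => by fin_cases i; exacts [hK 0, hK 1, sy])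
    (fun a i j => by
      fin_cases a <;> fin_cases i <;> fin_cases j
      exacts [ca, k0, k0, cp, cq, continuousOn_const (c := (-1 : ℝ)),
        (smooth_pd hV sa 1).continuousOn, k0, ca, k0, k0, continuousOn_const (c := (1 : ℝ)),
        k0, cb, k0, (smooth_pd hV sp 1).continuousOn.sub (cb.mul cp),
        (smooth_pd hV sq 1).continuousOn.sub (smooth_pd hV sb 0).continuousOn, cp.add cb])
    (fun X hX a i => by
      have f1 := e00 X hX
      have f2 := e11 X hX
      have f3 := e10 X hX
      have f4 := y0 X hX
      have f5 := y1 X hX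
      fin_cases a <;> fin_cases i <;> simp [z, N, Fin.sum_univ_three] <;> linarith)
    hX₀ (fun i => by fin_cases i; exacts [h0 0, h0 1, h1])
  intro X hX a
  fin_cases a
  exacts [key X hX 0, key X hX 1]

end Hydro
end

/-! ### Families of Killing forms and their correspondence with Hamiltonian formulations -/

noncomputable section

namespace Hydro

variable {U V : Set (Fin 2 → ℝ)} {l : Fin 2 → (Fin 2 → ℝ) → ℝ} {n : ℕ}

/-- The standing assumptions on the system, on the set `V`. -/
structure IsRegular (l : Fin 2 → (Fin 2 → ℝ) → ℝ) (V : Set (Fin 2 → ℝ)) : Prop where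
  smooth : ∀ a, ContDiffOn ℝ ∞ (l a) V
  ne : ∀ X ∈ V, l 0 X ≠ l 1 X
  coefA_ne : ∀ X ∈ V, coefA l X ≠ 0
  coefB_ne : ∀ X ∈ V, coefB l X ≠ 0

theorem IsRegular.mono (h : IsRegular l U) (hVU : V ⊆ U) : IsRegular l V :=
  ⟨fun a => (h.smooth a).mono hVU, fun X hX => h.ne X (hVU hX), fun X hX => h.coefA_ne X (hVU hX),
    fun X hX => h.coefB_ne X (hVU hX)⟩

theorem IsRegular.smooth_coefA (h : IsRegular l V) (hV : IsOpen V) :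
    ContDiffOn ℝ ∞ (coefA l) V := smooth_coef hV h.smooth h.ne (i := 0) (j := 1) (by decide)

theorem IsRegular.smooth_coefB (h : IsRegular l V) (hV : IsOpen V) :
    ContDiffOn ℝ ∞ (coefB l) V := smooth_coef hV h.smooth h.ne (i := 1) (j := 0) (by decide)

/-! ### Linear combinations of Killing forms -/

theorem smooth_combination {f : Fin n → (Fin 2 → ℝ) → ℝ} (hf : ∀ i, ContDiffOn ℝ ∞ (f i) V)
    (c : Fin n → ℝ) : ContDiffOn ℝ ∞ (fun X => ∑ i, c i * f i X) V :=
  ContDiffOn.sum fun i _ => contDiffOn_const.mul (hf i)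

theorem pd_combination (hV : IsOpen V) {f : Fin n → (Fin 2 → ℝ) → ℝ}
    (hf : ∀ i, ContDiffOn ℝ ∞ (f i) V) (c : Fin n → ℝ) {X : Fin 2 → ℝ} (hX : X ∈ V) (a : Fin 2) :
    pd a (fun Y => ∑ i, c i * f i Y) X = ∑ i, c i * pd a (f i) X := by
  have h : HasFDerivAt (fun Y => ∑ i, c i * f i Y) (∑ i, c i • fderiv ℝ (f i) X) X :=
    HasFDerivAt.fun_sum fun i _ => ((smooth_diffAt hV (hf i) hX).hasFDerivAt).const_mul _
  rw [hasFDerivAt_pd h]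
  simp [pd]

theorem isKilling_combination (hV : IsOpen V) {K : Fin n → Fin 2 → (Fin 2 → ℝ) → ℝ}
    (hK : ∀ i a, ContDiffOn ℝ ∞ (K i a) V) {X : Fin 2 → ℝ} (hX : X ∈ V)
    (h : ∀ i, IsKilling l (K i) X) (c : Fin n → ℝ) :
    IsKilling l (fun a Y => ∑ i, c i * K i a Y) X := by
  constructor
  · rw [pd_combination hV (fun i => hK i 0) c hX, Finset.mul_sum]
    exact Finset.sum_congr rfl fun i _ => by rw [(h i).eq00]; ring
  · rw [pd_combination hV (fun i => hK i 1) c hX, Finset.mul_sum]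
    exact Finset.sum_congr rfl fun i _ => by rw [(h i).eq11]; ring
  · rw [pd_combination hV (fun i => hK i 0) c hX, pd_combination hV (fun i => hK i 1) c hX]
    simp only [Finset.mul_sum, ← Finset.sum_add_distrib]
    exact Finset.sum_congr rfl fun i _ => by linear_combination c i * (h i).eq01

/-- A family of linearly independent Killing forms on a connected open set. -/
structure IsKillingFamily (l : Fin 2 → (Fin 2 → ℝ) → ℝ) (V : Set (Fin 2 → ℝ))
    (K : Fin n → Fin 2 → (Fin 2 → ℝ) → ℝ) : Prop where
  isOpen : IsOpen V
  isConnected : IsConnected V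
  regular : IsRegular l V
  smooth : ∀ i a, ContDiffOn ℝ ∞ (K i a) V
  killing : ∀ i, ∀ X ∈ V, IsKilling l (K i) X
  indep : IndepForms V K

theorem IsKillingFamily.eq_zero {K : Fin n → Fin 2 → (Fin 2 → ℝ) → ℝ}
    (h : IsKillingFamily l V K) {X : Fin 2 → ℝ} (hX : X ∈ V) (c : Fin n → ℝ)
    (h0 : ∀ a, ∑ i, c i * K i a X = 0) (h1 : ∑ i, c i * pd 1 (K i 0) X = 0) : c = 0 := by
  refine h.indep c (eq_zero_of_killing (K := fun a Y => ∑ i, c i * K i a Y) h.isOpen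
    h.isConnected.isPreconnected h.regular.smooth h.regular.ne h.regular.coefA_ne
    h.regular.coefB_ne (fun a => smooth_combination (fun i => h.smooth i a) c)
    (fun Y hY => isKilling_combination h.isOpen h.smooth hY (fun i => h.killing i Y hY) c) hX h0 ?_)
  rw [pd_combination h.isOpen (fun i => h.smooth i 0) c hX, h1]

/-- Evaluating (K₀, K₁, ∂₁K₀) at one point is injective on the span, by unique continuation. -/
theorem IsKillingFamily.le_three {K : Fin n → Fin 2 → (Fin 2 → ℝ) → ℝ}
    (h : IsKillingFamily l V K) : n ≤ 3 := by
  obtain ⟨X, hX⟩ := h.isConnected.nonempty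
  have hli : LinearIndependent ℝ fun i => (![K i 0 X, K i 1 X, pd 1 (K i 0) X] : Fin 3 → ℝ) := by
    rw [Fintype.linearIndependent_iff]
    intro c hc
    have e : ∀ k : Fin 3, ∑ i, c i * (![K i 0 X, K i 1 X, pd 1 (K i 0) X] : Fin 3 → ℝ) k = 0 :=
      fun k => (Finset.sum_apply k _ _).symm.trans (congrFun hc k)
    have := h.eq_zero hX c (fun a => by fin_cases a; exacts [e 0, e 1]) (e 2)
    exact fun i => congrFun this i
  simpa using hli.fintype_card_le_finrank

theorem IsKillingFamily.indep_of_subset {K : Fin n → Fin 2 → (Fin 2 → ℝ) → ℝ}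
    (h : IsKillingFamily l V K) {O : Set (Fin 2 → ℝ)} (hO : IsOpen O) (hOV : O ⊆ V)
    (hne : O.Nonempty) : IndepForms O K := by
  intro c hc
  obtain ⟨X, hX⟩ := hne
  refine h.eq_zero (hOV hX) c (hc X hX) ?_
  rw [← pd_combination hO (fun i => (h.smooth i 0).mono hOV) c hX,
    pd_congr (g := fun _ => 0) hO (fun Y hY => hc Y hY 0) hX, pd_const]

theorem IsKillingFamily.restrict {K : Fin n → Fin 2 → (Fin 2 → ℝ) → ℝ}
    (h : IsKillingFamily l V K) {O : Set (Fin 2 → ℝ)} (hO : IsOpen O) (hOc : IsConnected O)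
    (hOV : O ⊆ V) : IsKillingFamily l O K :=
  ⟨hO, hOc, h.regular.mono hOV, fun i a => (h.smooth i a).mono hOV,
    fun i X hX => h.killing i X (hOV hX), h.indep_of_subset hO hOV hOc.nonempty⟩

theorem hasFirstIntegrals_iff (hU : IsRegular l U) {p : Fin 2 → ℝ} :
    HasFirstIntegrals (christoffel l) U p n ↔ ∃ V, p ∈ V ∧ V ⊆ U ∧
      ∃ K : Fin n → Fin 2 → (Fin 2 → ℝ) → ℝ, IsKillingFamily l V K := by
  constructor
  · rintro ⟨V, hV, hVc, hp, hVU, K, hK, hi⟩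
    have r := hU.mono hVU
    exact ⟨V, hp, hVU, K, hV, hVc, r, fun i => (hK i).1,
      fun i X hX => (hK i).killing hV r.smooth r.ne r.coefA_ne r.coefB_ne hX, hi⟩
  · rintro ⟨V, hp, hVU, K, h⟩
    exact ⟨V, h.isOpen, h.isConnected, hp, hVU, K,
      fun i => isLinearFirstIntegral_of_killing h.isOpen (h.smooth i) (h.killing i), h.indep⟩

theorem hasFullFirstIntegrals_iff (hU : IsRegular l U) {p : Fin 2 → ℝ} :
    HasFullFirstIntegrals (christoffel l) U p n ↔ ∃ V, p ∈ V ∧ V ⊆ U ∧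
      ∃ K : Fin n → Fin 2 → (Fin 2 → ℝ) → ℝ, IsKillingFamily l V K ∧ ∀ i a, K i a p ≠ 0 := by
  constructor
  · rintro ⟨V, hV, hVc, hp, hVU, K, hK, h0, hi⟩
    have r := hU.mono hVU
    exact ⟨V, hp, hVU, K, ⟨hV, hVc, r, fun i => (hK i).1,
      fun i X hX => (hK i).killing hV r.smooth r.ne r.coefA_ne r.coefB_ne hX, hi⟩, h0⟩
  · rintro ⟨V, hp, hVU, K, h, h0⟩
    exact ⟨V, h.isOpen, h.isConnected, hp, hVU, K,
      fun i => isLinearFirstIntegral_of_killing h.isOpen (h.smooth i) (h.killing i), h0, h.indep⟩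

/-! ### Hamiltonian formulations give Killing forms -/

/-- For independence, a relation among the one-forms is a relation among the diagonal entries of the
metrics, as A and B are nonzero. It passes to the operators because `b` depends linearly on `g` and
its first derivatives. -/
theorem isKillingFamily_of_hamiltonian (hV : IsOpen V) (hVc : IsConnected V) (r : IsRegular l V)
    {g : Fin n → Fin 2 → Fin 2 → (Fin 2 → ℝ) → ℝ}
    {b : Fin n → Fin 2 → Fin 2 → Fin 2 → (Fin 2 → ℝ) → ℝ}
    (h : ∀ i, IsHamiltonianFormulation l V (g i) (b i)) (hi : IndepOps V g b) :
    IsKillingFamily l V fun i => ![fun X => coefA l X * g i 1 1 X, fun X => coefB l X * g i 0 0 X] := by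
  have D := fun i X (hX : X ∈ V) =>
    (h i).diagonalData hV r.smooth r.ne r.coefA_ne r.coefB_ne hX
  have sg := fun i a e => (h i).1.smooth_g a e
  refine ⟨hV, hVc, r, fun i a => ?_, fun i X hX => ?_, fun c hc => ?_⟩
  · fin_cases a
    exacts [(r.smooth_coefA hV).mul (sg i 1 1), (r.smooth_coefB hV).mul (sg i 0 0)]
  · exact (isKilling_iff_isFlatPair hV r.smooth r.ne r.coefA_ne r.coefB_ne (sg i 0 0) (sg i 1 1)
      (fun _ _ => rfl) (fun _ _ => rfl) hX).2 (D i X hX).toIsFlatPair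
  · have z1 : ∀ X ∈ V, ∑ i, c i * g i 1 1 X = 0 := fun X hX => by
      apply mul_left_cancel₀ (r.coefA_ne X hX)
      rw [mul_zero, Finset.mul_sum, ← hc X hX 0]
      exact Finset.sum_congr rfl fun i _ => by simp; ring
    have z0 : ∀ X ∈ V, ∑ i, c i * g i 0 0 X = 0 := fun X hX => by
      apply mul_left_cancel₀ (r.coefB_ne X hX)
      rw [mul_zero, Finset.mul_sum, ← hc X hX 1]
      exact Finset.sum_congr rfl fun i _ => by simp; ring
    have zd : ∀ X ∈ V, ∀ a, ∑ i, c i * g i a a X = 0 := fun X hX a => by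
      fin_cases a
      exacts [z0 X hX, z1 X hX]
    have off : ∀ X ∈ V, ∀ a e, a ≠ e → ∀ i, g i a e X = 0 := fun X hX a e hae i =>
      (h i).diagonal hV r.ne hae hX
    have zb : ∀ X ∈ V, ∀ d, ∑ i, c i * b i 0 1 d X = 0 := fun X hX d => by
      fin_cases d
      · have : ∑ i, c i * b i 0 1 0 X = coefA l X * ∑ i, c i * g i 1 1 X := by
          rw [Finset.mul_sum]
          refine Finset.sum_congr rfl fun i _ => ?_
          rw [(D i X hX).off_fst, show coef l 0 1 X = coefA l X from rfl]; ring
        exact this.trans (by rw [z1 X hX, mul_zero])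
      · have : ∑ i, c i * b i 0 1 1 X = -coefB l X * ∑ i, c i * g i 0 0 X := by
          rw [Finset.mul_sum]
          refine Finset.sum_congr rfl fun i _ => ?_
          rw [(D i X hX).off_snd, show coef l 1 0 X = coefB l X from rfl]; ring
        exact this.trans (by rw [z0 X hX, mul_zero])
    refine hi c (fun X hX a e => ?_) (fun X hX a e d => ?_)
    · by_cases hae : a = e
      · subst hae; exact zd X hX a
      · simp [off X hX a e hae]
    · have hdiag : ∀ a, ∑ i, c i * b i a a d X = 0 := fun a => by
        have e : pd d (fun Y => ∑ i, c i * g i a a Y) X = 0 := by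
          rw [pd_congr (g := fun _ => 0) hV (fun Y hY => zd Y hY a) hX, pd_const]
        rw [pd_combination hV (fun i => sg i a a) c hX] at e
        have : ∑ i, c i * pd d (g i a a) X = 2 * ∑ i, c i * b i a a d X := by
          rw [Finset.mul_sum]
          exact Finset.sum_congr rfl fun i _ => by rw [(h i).1.pd_g hV hX]; ring
        linarith
      have hskew : ∀ i, b i 1 0 d X = -b i 0 1 d X := fun i => by
        have e1 := (h i).1.pd_g hV hX 0 1 d
        have e2 : pd d (g i 0 1) X = 0 := by
          rw [pd_congr (g := fun _ => 0) hV (fun Y hY => off Y hY 0 1 (by decide) i) hX, pd_const]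
        linarith
      fin_cases a <;> fin_cases e
      · exact hdiag 0
      · exact zb X hX d
      · simp only [Fin.mk_one, Fin.zero_eta, hskew, mul_neg, Finset.sum_neg_distrib, zb X hX d,
          neg_zero]
      · exact hdiag 1

theorem HasHamiltonians.hasFirstIntegrals (hU : IsRegular l U) {p : Fin 2 → ℝ}
    (h : HasHamiltonians l U p n) : HasFirstIntegrals (christoffel l) U p n := by
  obtain ⟨V, hV, hVc, hp, hVU, g, b, hH, hi⟩ := h
  exact (hasFirstIntegrals_iff hU).2
    ⟨V, hp, hVU, _, isKillingFamily_of_hamiltonian hV hVc (hU.mono hVU) hH hi⟩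

theorem HasNondegHamiltonians.hasHamiltonians {p : Fin 2 → ℝ}
    (h : HasNondegHamiltonians l U p n) : HasHamiltonians l U p n := by
  obtain ⟨V, hV, hVc, hp, hVU, g, b, hH, -, hi⟩ := h
  exact ⟨V, hV, hVc, hp, hVU, g, b, hH, hi⟩

theorem HasNondegHamiltonians.hasFullFirstIntegrals (hU : IsRegular l U) {p : Fin 2 → ℝ}
    (h : HasNondegHamiltonians l U p n) : HasFullFirstIntegrals (christoffel l) U p n := by
  obtain ⟨V, hV, hVc, hp, hVU, g, b, hH, hdet, hi⟩ := h
  have r := hU.mono hVU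
  refine (hasFullFirstIntegrals_iff hU).2
    ⟨V, hp, hVU, _, isKillingFamily_of_hamiltonian hV hVc r hH hi, fun i a => ?_⟩
  have hd := hdet i p hp
  rw [Matrix.det_fin_two] at hd
  simp only [Matrix.of_apply, (hH i).diagonal hV r.ne (show (0 : Fin 2) ≠ 1 by decide) hp, zero_mul,
    sub_zero] at hd
  fin_cases a
  exacts [mul_ne_zero (r.coefA_ne p hp) (mul_ne_zero_iff.1 hd).2,
    mul_ne_zero (r.coefB_ne p hp) (mul_ne_zero_iff.1 hd).1]

/-! ### Killing forms give Hamiltonian formulations -/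

theorem indepOps_diag {K : Fin n → Fin 2 → (Fin 2 → ℝ) → ℝ} (h : IsKillingFamily l V K)
    {b : Fin n → Fin 2 → Fin 2 → Fin 2 → (Fin 2 → ℝ) → ℝ} : IndepOps V
      (fun i => diagMetric (fun X => K i 1 X / coefB l X) fun X => K i 0 X / coefA l X) b := by
  intro c hg _
  refine h.indep c fun X hX a => ?_
  have e0 := hg X hX 0 0
  have e1 := hg X hX 1 1
  simp only [diagMetric, ← mul_div_assoc, ← Finset.sum_div] at e0 e1
  fin_cases a
  exacts [(div_eq_zero_iff.1 e1).resolve_right (h.regular.coefA_ne X hX),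
    (div_eq_zero_iff.1 e0).resolve_right (h.regular.coefB_ne X hX)]

theorem isFlatPair_of_killing (hV : IsOpen V) (r : IsRegular l V) {K : Fin 2 → (Fin 2 → ℝ) → ℝ}
    (hK : ∀ a, ContDiffOn ℝ ∞ (K a) V) (h : ∀ X ∈ V, IsKilling l K X) :
    ∀ X ∈ V, IsFlatPair l 0 1 (fun X => K 1 X / coefB l X) (fun X => K 0 X / coefA l X) X :=
  fun X hX => (isKilling_iff_isFlatPair hV r.smooth r.ne r.coefA_ne r.coefB_ne
    ((hK 1).div (r.smooth_coefB hV) r.coefB_ne) ((hK 0).div (r.smooth_coefA hV) r.coefA_ne)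
    (fun Y hY => (mul_div_cancel₀ _ (r.coefA_ne Y hY)).symm)
    (fun Y hY => (mul_div_cancel₀ _ (r.coefB_ne Y hY)).symm) hX).1 (h X hX)

theorem exists_ball_subset {p : Fin 2 → ℝ} {O : Set (Fin 2 → ℝ)} (hO : IsOpen O) (hp : p ∈ O) :
    ∃ V, IsOpen V ∧ IsConnected V ∧ Convex ℝ V ∧ p ∈ V ∧ V ⊆ O := by
  obtain ⟨ε, hε, hb⟩ := Metric.isOpen_iff.1 hO p hp
  exact ⟨Metric.ball p ε, Metric.isOpen_ball,
    ⟨⟨p, Metric.mem_ball_self hε⟩, (convex_ball p ε).isPreconnected⟩, convex_ball p ε,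
    Metric.mem_ball_self hε, hb⟩

/-- On a small ball all components of the finitely many forms stay nonzero, and convexity makes the
density lemma applicable. -/
theorem HasFullFirstIntegrals.hasNondegHamiltonians (hU : IsRegular l U) {p : Fin 2 → ℝ}
    (h : HasFullFirstIntegrals (christoffel l) U p n) : HasNondegHamiltonians l U p n := by
  obtain ⟨V, hp, hVU, K, hF, h0⟩ := (hasFullFirstIntegrals_iff hU).1 h
  have hO : IsOpen (⋂ i, ⋂ a, V ∩ K i a ⁻¹' {0}ᶜ ∩ V) := by
    refine isOpen_iInter_of_finite fun i => isOpen_iInter_of_finite fun a => ?_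
    exact ((hF.smooth i a).continuousOn.isOpen_inter_preimage hF.isOpen
      isOpen_compl_singleton).inter hF.isOpen
  obtain ⟨B, hB, hBc, hBx, hpB, hBO⟩ := exists_ball_subset (hF.isOpen.inter hO)
    (p := p) ⟨hp, by simp [hp, h0]⟩
  have hBV : B ⊆ V := fun X hX => (hBO hX).1
  have hK : ∀ i a, ∀ X ∈ B, K i a X ≠ 0 := fun i a X hX => by
    have := (hBO hX).2
    simp only [Set.mem_iInter] at this
    exact (this i a).1.2
  have hF' := hF.restrict hB hBc hBV
  have r := hF'.regular
  have s0 : ∀ i, ContDiffOn ℝ ∞ (fun X => K i 0 X / coefA l X) B := fun i => (hF'.smooth i 0).div (r.smooth_coefA hB) r.coefA_ne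
  have s1 : ∀ i, ContDiffOn ℝ ∞ (fun X => K i 1 X / coefB l X) B := fun i => (hF'.smooth i 1).div (r.smooth_coefB hB) r.coefB_ne
  have n0 := fun i X hX => div_ne_zero (hK i 0 X hX) (r.coefA_ne X hX)
  have n1 := fun i X hX => div_ne_zero (hK i 1 X hX) (r.coefB_ne X hX)
  have hflat := fun i => isFlatPair_of_killing hB r (hF'.smooth i) (hF'.killing i)
  refine ⟨B, hB, hBc, hpB, hBV.trans hVU, _, fun i =>
    diagSymbol l (fun X => K i 1 X / coefB l X) fun X => K i 0 X / coefA l X, fun i => ?_, fun i X hX => ?_,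
    indepOps_diag hF'⟩
  · obtain ⟨h, sh, e01, e00, e11⟩ := exists_density_nondegenerate hB hBx r.smooth r.ne (s1 i) (s0 i)
      (n1 i) (n0 i) (hflat i)
    exact isHamiltonianFormulation_diag hB r.smooth r.ne (s1 i) (s0 i) (hflat i) sh e01 e00 e11
  · rw [Matrix.det_fin_two]
    simp only [Matrix.of_apply, diagMetric, mul_zero, sub_zero]
    exact mul_ne_zero (n1 i X hX) (n0 i X hX)

/-- A single Killing form one component of which vanishes identically gives a degenerate
Hamiltonian formulation. -/
theorem hasHamiltonians_of_component_zero {p : Fin 2 → ℝ}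
    (hVU : V ⊆ U) {K : Fin 1 → Fin 2 → (Fin 2 → ℝ) → ℝ} (hF : IsKillingFamily l V K)
    {O : Set (Fin 2 → ℝ)} (hO : IsOpen O) (hOV : O ⊆ V) (hp : p ∈ O) {i j : Fin 2} (hij : i ≠ j)
    (hi : ∀ X ∈ O, K 0 i X ≠ 0) (hj : ∀ X ∈ O, K 0 j X = 0) : HasHamiltonians l U p 1 := by
  obtain ⟨B, hB, hBc, hBx, hpB, hBO⟩ := exists_ball_subset hO hp
  have hF' := hF.restrict hB hBc (hBO.trans hOV)
  have r := hF'.regular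
  have s0 : ContDiffOn ℝ ∞ (fun X => K 0 0 X / coefA l X) B := (hF'.smooth 0 0).div (r.smooth_coefA hB) r.coefA_ne
  have s1 : ContDiffOn ℝ ∞ (fun X => K 0 1 X / coefB l X) B := (hF'.smooth 0 1).div (r.smooth_coefB hB) r.coefB_ne
  have hflat := isFlatPair_of_killing hB r (hF'.smooth 0) (hF'.killing 0)
  refine ⟨B, hB, hBc, hpB, (hBO.trans hOV).trans hVU, _, fun i =>
    diagSymbol l (fun X => K i 1 X / coefB l X) fun X => K i 0 X / coefA l X, fun k => ?_,
    indepOps_diag hF'⟩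
  obtain rfl : k = 0 := Subsingleton.elim _ _
  fin_cases i <;> fin_cases j
  · exact absurd rfl hij
  -- The crossing again: if K₁ vanishes, so does the entry K₁ / B of index 0, and the density lemma
  -- is applied with its indices exchanged.
  · obtain ⟨h, sh, e01, e11, e00⟩ := exists_density_degenerate (i := 1) (j := 0) hB hBx r.smooth r.ne
      (by decide) r.coefA_ne s0 (fun X hX => div_ne_zero (hi X (hBO hX)) (r.coefA_ne X hX))
      (fun X hX => by have := hj X (hBO hX); simp_all) (fun X hX => (hflat X hX).swap)
    refine isHamiltonianFormulation_diag hB r.smooth r.ne s1 s0 hflat sh (fun X hX => ?_) e00 e11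
    rw [pd_comm hB sh hX, e01 X hX, add_comm]
  · obtain ⟨h, sh, e01, e00, e11⟩ := exists_density_degenerate (i := 0) (j := 1) hB hBx r.smooth r.ne
      (by decide) r.coefB_ne s1 (fun X hX => div_ne_zero (hi X (hBO hX)) (r.coefB_ne X hX))
      (fun X hX => by have := hj X (hBO hX); simp_all) hflat
    exact isHamiltonianFormulation_diag hB r.smooth r.ne s1 s0 hflat sh e01 e00 e11
  · exact absurd rfl hij

/-! ### Subfamilies -/

theorem IndepOps.castLE {m : ℕ} (hnm : n ≤ m) {g : Fin m → Fin 2 → Fin 2 → (Fin 2 → ℝ) → ℝ}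
    {b : Fin m → Fin 2 → Fin 2 → Fin 2 → (Fin 2 → ℝ) → ℝ} (h : IndepOps V g b) :
    IndepOps V (fun i => g (Fin.castLE hnm i)) fun i => b (Fin.castLE hnm i) := by
  intro c hg hb
  have hinj : Function.Injective (Fin.castLE hnm) := Fin.castLE_injective hnm
  let c' : Fin m → ℝ := Function.extend (Fin.castLE hnm) c 0
  have hsum : ∀ f : Fin m → ℝ, ∑ k, c' k * f k = ∑ i, c i * f (Fin.castLE hnm i) := fun f => by
    have e : ∑ i, c i * f (Fin.castLE hnm i)
        = ∑ k ∈ Finset.univ.map ⟨Fin.castLE hnm, hinj⟩, c' k * f k := by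
      rw [Finset.sum_map]
      exact Finset.sum_congr rfl fun i _ => by simp [c', hinj.extend_apply]
    rw [e]
    refine (Finset.sum_subset (Finset.subset_univ _) fun k _ hk => ?_).symm
    have : ¬∃ i, Fin.castLE hnm i = k := fun ⟨i, hi⟩ => hk (by simp [← hi])
    simp [c', Function.extend_apply' _ _ _ this]
  have hz := h c' (fun X hX a e => by rw [hsum fun k => g k a e X]; exact hg X hX a e)
    (fun X hX a e d => by rw [hsum fun k => b k a e d X]; exact hb X hX a e d)
  funext i
  have := congrFun hz (Fin.castLE hnm i)
  simpa [c', hinj.extend_apply] using this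

theorem HasHamiltonians.mono {m : ℕ} {p : Fin 2 → ℝ} (h : HasHamiltonians l U p m) (hnm : n ≤ m) :
    HasHamiltonians l U p n := by
  obtain ⟨V, hV, hVc, hp, hVU, g, b, hH, hi⟩ := h
  exact ⟨V, hV, hVc, hp, hVU, _, _, fun i => hH (Fin.castLE hnm i), hi.castLE hnm⟩

theorem HasNondegHamiltonians.mono {m : ℕ} {p : Fin 2 → ℝ} (h : HasNondegHamiltonians l U p m)
    (hnm : n ≤ m) : HasNondegHamiltonians l U p n := by
  obtain ⟨V, hV, hVc, hp, hVU, g, b, hH, hd, hi⟩ := h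
  exact ⟨V, hV, hVc, hp, hVU, _, _, fun i => hH (Fin.castLE hnm i),
    fun i => hd (Fin.castLE hnm i), hi.castLE hnm⟩

end Hydro
end

noncomputable section

namespace Hydro

variable {U V : Set (Fin 2 → ℝ)} {l : Fin 2 → (Fin 2 → ℝ) → ℝ} {n : ℕ}

/-! ### Generic points -/

/-- In a family of at least two independent Killing forms, neither component can vanish
identically on an open set. -/
theorem IsKillingFamily.exists_component_ne {K : Fin n → Fin 2 → (Fin 2 → ℝ) → ℝ}
    (h : IsKillingFamily l V K) (hn : 2 ≤ n) {O : Set (Fin 2 → ℝ)} (hO : IsOpen O) (hOV : O ⊆ V)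
    (hne : O.Nonempty) (a : Fin 2) : ∃ X ∈ O, ∃ i, K i a X ≠ 0 := by
  by_contra! hz
  obtain ⟨X, hX⟩ := hne
  obtain ⟨a', ha'⟩ : ∃ a' : Fin 2, a' ≠ a := exists_ne a
  have hdz : ∀ i d, pd d (K i a) X = 0 := fun i d => by
    rw [pd_congr (g := fun _ => 0) hO (fun Y hY => hz Y hY i) hX, pd_const]
  -- If component a vanishes on O, then ∂₁K₀ at X is determined by the other component there:
  -- trivially if a = 0, by the mixed Killing equation if a = 1. So the single number K_{a'}(X)
  -- determines the form, leaving room for only one.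
  have main : ∀ c : Fin n → ℝ, ∑ i, c i * K i a' X = 0 → c = 0 := fun c hc => by
    have h0 : ∀ e, ∑ i, c i * K i e X = 0 := fun e => by
      by_cases hea : e = a
      · subst hea; simp [hz X hX]
      · rwa [show e = a' by fin_cases e <;> fin_cases a <;> fin_cases a' <;> simp_all]
    refine h.eq_zero (hOV hX) c h0 ?_
    by_cases ha : a = 0
    · subst ha; simp [hdz]
    · obtain rfl : a = 1 := by fin_cases a <;> simp_all
      have e : ∀ i, pd 1 (K i 0) X = 2 * (christoffel l 0 0 1 X * K i 0 X
          + christoffel l 1 0 1 X * K i 1 X) := fun i => by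
        rw [← (h.killing i X (hOV hX)).eq01, hdz, zero_add]
      have : ∑ i, c i * pd 1 (K i 0) X = 2 * christoffel l 0 0 1 X * ∑ i, c i * K i 0 X
          + 2 * christoffel l 1 0 1 X * ∑ i, c i * K i 1 X := by
        rw [Finset.mul_sum, Finset.mul_sum, ← Finset.sum_add_distrib]
        exact Finset.sum_congr rfl fun i _ => by rw [e]; ring
      rw [this, h0, h0]; ring
  let i₀ : Fin n := ⟨0, by omega⟩
  let i₁ : Fin n := ⟨1, by omega⟩
  have hi : i₀ ≠ i₁ := by simp [i₀, i₁]
  have e1 := main (Pi.single i₀ (K i₁ a' X) - Pi.single i₁ (K i₀ a' X)) (by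
    simp only [sub_mul, Pi.sub_apply, Pi.single_apply, ite_mul, zero_mul,
      Finset.sum_sub_distrib, Finset.sum_ite_eq', Finset.mem_univ, if_true]
    ring)
  have k1 : K i₁ a' X = 0 := by simpa [hi] using congrFun e1 i₀
  have e2 := main (Pi.single i₁ 1) (by simp [Pi.single_apply, k1])
  simpa using congrFun e2 i₁

/-- If neither component of a family of independent Killing forms vanishes at `p`, then there is
a family of the same length all of whose components are nonzero at `p`. -/
theorem IsKillingFamily.exists_full {K : Fin n → Fin 2 → (Fin 2 → ℝ) → ℝ}
    (h : IsKillingFamily l V K) {p : Fin 2 → ℝ} (h0 : ∀ a, ∃ i, K i a p ≠ 0) :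
    ∃ K' : Fin n → Fin 2 → (Fin 2 → ℝ) → ℝ, IsKillingFamily l V K' ∧ ∀ i a, K' i a p ≠ 0 := by
  -- One combination with both components nonzero at p; t times it is then added to each member of
  -- the family.
  obtain ⟨v, hv⟩ : ∃ v : Fin n → ℝ, ∀ a, ∑ i, v i * K i a p ≠ 0 := by
    obtain ⟨i, hi⟩ := h0 0
    obtain ⟨j, hj⟩ := h0 1
    by_cases hi1 : K i 1 p = 0
    · by_cases hj0 : K j 0 p = 0
      · refine ⟨Pi.single i 1 + Pi.single j 1, fun a => ?_⟩
        fin_cases a <;>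
          simp [add_mul, Finset.sum_add_distrib, Pi.single_apply, hi1, hj0, hi, hj]
      · refine ⟨Pi.single j 1, fun a => ?_⟩
        fin_cases a <;> simp [Pi.single_apply, hj0, hj]
    · refine ⟨Pi.single i 1, fun a => ?_⟩
      fin_cases a <;> simp [Pi.single_apply, hi1, hi]
  -- The first excluded value keeps 1 + t ∑ vᵢ ≠ 0, which preserves independence; the others would
  -- make a component vanish at p. If ∑ vᵢ = 0, division by zero merely excludes t = 0.
  obtain ⟨t, ht⟩ := Infinite.exists_notMem_finset
    (insert (-(1 / ∑ i, v i)) (Finset.univ.image fun q : Fin n × Fin 2 =>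
      -(K q.1 q.2 p / ∑ i, v i * K i q.2 p)))
  rw [Finset.mem_insert, not_or] at ht
  obtain ⟨ht1, ht2⟩ := ht
  let C : Fin n → Fin n → ℝ := fun k i => (if k = i then 1 else 0) + t * v i
  have hC : ∀ k a X, ∑ i, C k i * K i a X = K k a X + t * ∑ i, v i * K i a X := fun k a X => by
    simp [C, add_mul, Finset.sum_add_distrib, Finset.mul_sum, mul_assoc]
  refine ⟨fun k a X => ∑ i, C k i * K i a X, ⟨h.isOpen, h.isConnected, h.regular,
    fun k a => smooth_combination (fun i => h.smooth i a) _,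
    fun k X hX => isKilling_combination h.isOpen h.smooth hX (fun i => h.killing i X hX) _,
    fun c hc => ?_⟩, fun k a hz => ?_⟩
  · have e : ∀ i, c i + (t * ∑ k, c k) * v i = 0 := by
      refine congrFun (h.indep (fun i => c i + (t * ∑ k, c k) * v i) fun X hX a => ?_)
      rw [← hc X hX a]
      simp only [hC, add_mul, mul_add, Finset.sum_add_distrib, Finset.mul_sum, Finset.sum_mul]
      congr 1
      rw [Finset.sum_comm]
      exact Finset.sum_congr rfl fun k _ => Finset.sum_congr rfl fun i _ => by ring
    have hs : (∑ k, c k) * (1 + t * ∑ i, v i) = 0 := by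
      have : ∑ i, (c i + (t * ∑ k, c k) * v i) = 0 := Finset.sum_eq_zero fun i _ => e i
      rw [Finset.sum_add_distrib, ← Finset.mul_sum] at this
      linear_combination this
    have hs0 : ∑ k, c k = 0 := by
      refine (mul_eq_zero.1 hs).resolve_right fun hz => ht1 ?_
      have hv0 : ∑ i, v i ≠ 0 := fun h => by rw [h] at hz; norm_num at hz
      field_simp
      linarith
    funext i
    have := e i
    rw [hs0] at this
    simpa using this
  · have hz' : K k a p + t * ∑ i, v i * K i a p = 0 := (hC k a p).symm.trans hz
    refine ht2 (Finset.mem_image.2 ⟨(k, a), Finset.mem_univ _, ?_⟩)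
    have := hv a
    simp only
    field_simp
    linarith

theorem HasHamiltonians.eventually {p : Fin 2 → ℝ} (h : HasHamiltonians l U p n) :
    ∀ᶠ q in 𝓝 p, HasHamiltonians l U q n := by
  obtain ⟨V, hV, hVc, hp, hVU, h'⟩ := h
  filter_upwards [hV.mem_nhds hp] with q hq using ⟨V, hV, hVc, hq, hVU, h'⟩

theorem HasNondegHamiltonians.eventually {p : Fin 2 → ℝ} (h : HasNondegHamiltonians l U p n) :
    ∀ᶠ q in 𝓝 p, HasNondegHamiltonians l U q n := by
  obtain ⟨V, hV, hVc, hp, hVU, h'⟩ := h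
  filter_upwards [hV.mem_nhds hp] with q hq using ⟨V, hV, hVc, hq, hVU, h'⟩

theorem hasNondegHamiltonians_zero (hU : IsOpen U) {p : Fin 2 → ℝ} (hp : p ∈ U) :
    HasNondegHamiltonians l U p 0 := by
  obtain ⟨V, hV, hVc, -, hpV, hVU⟩ := exists_ball_subset hU hp
  exact ⟨V, hV, hVc, hpV, hVU, fun i => i.elim0, fun i => i.elim0, fun i => i.elim0,
    fun i => i.elim0, fun _ _ _ => Subsingleton.elim _ _⟩

/-- Arbitrarily near a point with `n` first integrals there are points with `n` Hamiltonian
formulations, which are non-degenerate if `n ≥ 2`. -/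
theorem exists_hasHamiltonians_near (hU : IsRegular l U) {W : Set (Fin 2 → ℝ)}
    (hW : IsOpen W) {p : Fin 2 → ℝ} (hpW : p ∈ W)
    (h : HasFirstIntegrals (christoffel l) U p n) (hn : n ≠ 0) :
    ∃ q ∈ W, HasHamiltonians l U q n ∧ (2 ≤ n → HasNondegHamiltonians l U q n) := by
  obtain ⟨V, hpV, hVU, K, hF⟩ := (hasFirstIntegrals_iff hU).1 h
  have full : ∀ q ∈ V ∩ W, (∀ a, ∃ i, K i a q ≠ 0) →
      ∃ q ∈ W, HasHamiltonians l U q n ∧ (2 ≤ n → HasNondegHamiltonians l U q n) :=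
    fun q hq h0 => by
      obtain ⟨K', hF', h0'⟩ := hF.exists_full h0
      have hN := ((hasFullFirstIntegrals_iff hU).2
        ⟨V, hq.1, hVU, K', hF', h0'⟩).hasNondegHamiltonians hU
      exact ⟨q, hq.2, hN.hasHamiltonians, fun _ => hN⟩
  have hVW : IsOpen (V ∩ W) := hF.isOpen.inter hW
  have hO : ∀ i a, IsOpen (V ∩ W ∩ K i a ⁻¹' {0}ᶜ) := fun i a =>
    ((hF.smooth i a).mono Set.inter_subset_left).continuousOn.isOpen_inter_preimage hVW
      isOpen_compl_singleton
  by_cases hn2 : 2 ≤ n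
  · obtain ⟨X, hX, i, hi⟩ := hF.exists_component_ne hn2 hVW Set.inter_subset_left ⟨p, hpV, hpW⟩ 0
    obtain ⟨Y, hY, j, hj⟩ := hF.exists_component_ne hn2 (hO i 0)
      (Set.inter_subset_left.trans Set.inter_subset_left) ⟨X, hX, hi⟩ 1
    refine full Y hY.1 fun a => ?_
    fin_cases a
    exacts [⟨i, hY.2⟩, ⟨j, hj⟩]
  · obtain rfl : n = 1 := by omega
    obtain ⟨X, hX, a, ha⟩ : ∃ X ∈ V ∩ W, ∃ a, K 0 a X ≠ 0 := by
      by_contra! hz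
      have := hF.indep_of_subset hVW Set.inter_subset_left ⟨p, hpV, hpW⟩ 1
        (fun X hX a => by simp [hz X hX a])
      simpa using congrFun this 0
    obtain ⟨a', ha'⟩ : ∃ a' : Fin 2, a' ≠ a := exists_ne a
    by_cases hz : ∃ Y ∈ V ∩ W ∩ K 0 a ⁻¹' {0}ᶜ, K 0 a' Y ≠ 0
    · obtain ⟨Y, hY, hne⟩ := hz
      refine full Y hY.1 fun e => ⟨0, ?_⟩
      by_cases he : e = a
      · subst he; exact hY.2
      · rwa [show e = a' by fin_cases e <;> fin_cases a <;> fin_cases a' <;> simp_all]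
    · push Not at hz
      exact ⟨X, hX.2, hasHamiltonians_of_component_zero hVU hF (hO 0 a)
        (Set.inter_subset_left.trans Set.inter_subset_left) ⟨hX, ha⟩ ha'.symm
        (fun Y hY => hY.2) hz, fun h2 => absurd h2 hn2⟩

/-- The equivalences of the first two parts of the theorem, at the point `p`. -/
def IsGeneric (l : Fin 2 → (Fin 2 → ℝ) → ℝ) (U : Set (Fin 2 → ℝ)) (p : Fin 2 → ℝ) : Prop :=
  ∀ n : ℕ, (HasHamiltonians l U p n ↔ HasFirstIntegrals (christoffel l) U p n) ∧
    (2 ≤ n → (HasNondegHamiltonians l U p n ↔ HasFirstIntegrals (christoffel l) U p n))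

/-- Let m be the largest number of first integrals at points of W. Wherever there are m Hamiltonian
formulations, nondegenerate ones if m ≥ 2, any n first integrals in W have n ≤ m, so a subfamily
provides n formulations. Such points form a neighbourhood of some q in W. -/
theorem exists_eventually_isGeneric (hUo : IsOpen U) (hU : IsRegular l U) {W : Set (Fin 2 → ℝ)}
    (hW : IsOpen W) (hWU : W ⊆ U) (hne : W.Nonempty) :
    ∃ q ∈ W, ∀ᶠ q' in 𝓝 q, IsGeneric l U q' := by
  obtain ⟨m, ⟨p, hpW, hp⟩, hmax⟩ : ∃ m, (∃ p ∈ W, HasFirstIntegrals (christoffel l) U p m) ∧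
      ∀ k, ∀ p ∈ W, HasFirstIntegrals (christoffel l) U p k → k ≤ m := by
    classical
    let P : ℕ → Prop := fun m => ∃ p ∈ W, HasFirstIntegrals (christoffel l) U p m
    have hP0 : P 0 := by
      obtain ⟨p, hp⟩ := hne
      exact ⟨p, hp, (hasNondegHamiltonians_zero hUo (hWU hp)).hasHamiltonians.hasFirstIntegrals hU⟩
    refine ⟨Nat.findGreatest P 3, Nat.findGreatest_spec (Nat.zero_le _) hP0, fun k p hp hk => ?_⟩
    refine Nat.le_findGreatest ?_ ⟨p, hp, hk⟩
    obtain ⟨V, -, -, K, hF⟩ := (hasFirstIntegrals_iff hU).1 hk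
    exact hF.le_three
  have generic : ∀ q ∈ W, HasHamiltonians l U q m → (2 ≤ m → HasNondegHamiltonians l U q m) →
      IsGeneric l U q := fun q hq hH hN n =>
    ⟨⟨fun h => h.hasFirstIntegrals hU, fun h => hH.mono (hmax n q hq h)⟩, fun hn =>
      ⟨fun h => h.hasHamiltonians.hasFirstIntegrals hU, fun h =>
        (hN (hn.trans (hmax n q hq h))).mono (hmax n q hq h)⟩⟩
  rcases eq_or_ne m 0 with rfl | hm
  · refine ⟨p, hpW, ?_⟩
    filter_upwards [hW.mem_nhds hpW] with q hq
    exact generic q hq (hasNondegHamiltonians_zero hUo (hWU hq)).hasHamiltonians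
      (fun h => absurd h (by norm_num))
  · obtain ⟨q, hqW, hH, hN⟩ := exists_hasHamiltonians_near hU hW hpW hp hm
    refine ⟨q, hqW, ?_⟩
    by_cases hm2 : 2 ≤ m
    · filter_upwards [hW.mem_nhds hqW, hH.eventually, (hN hm2).eventually] with r hr h1 h2
      exact generic r hr h1 fun _ => h2
    · filter_upwards [hW.mem_nhds hqW, hH.eventually] with r hr h1
      exact generic r hr h1 fun h => absurd h hm2

end Hydro

end

/-! ### The theorem -/

theorem theorem5p2 (U : Set (Fin 2 → ℝ)) (hU : IsOpen U) (l : Fin 2 → (Fin 2 → ℝ) → ℝ)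
    (hl : ∀ a, ContDiffOn ℝ ∞ (l a) U)
    (hne : ∀ X ∈ U, l 0 X ≠ l 1 X)
    (hA : ∀ X ∈ U, Hydro.coefA l X ≠ 0) (hB : ∀ X ∈ U, Hydro.coefB l X ≠ 0) :
    (∃ G : Set (Fin 2 → ℝ), IsOpen G ∧ G ⊆ U ∧ U ⊆ closure G ∧
      ∀ p ∈ G, ∀ n : ℕ,
        (Hydro.HasHamiltonians l U p n ↔
          Hydro.HasFirstIntegrals (Hydro.christoffel l) U p n) ∧
        (2 ≤ n → (Hydro.HasNondegHamiltonians l U p n ↔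
          Hydro.HasFirstIntegrals (Hydro.christoffel l) U p n))) ∧
    (∀ p ∈ U, ∀ n : ℕ,
      (Hydro.HasHamiltonians l U p n →
        Hydro.HasFirstIntegrals (Hydro.christoffel l) U p n) ∧
      (Hydro.HasNondegHamiltonians l U p n ↔
        Hydro.HasFullFirstIntegrals (Hydro.christoffel l) U p n)) := by
  have r : Hydro.IsRegular l U := ⟨hl, hne, hA, hB⟩
  -- The dense open set is the interior of the set of generic points; it is dense because each
  -- nonempty open part of U contains a point all of whose neighbours are generic.
  refine ⟨⟨U ∩ interior {p | Hydro.IsGeneric l U p}, hU.inter isOpen_interior,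
    Set.inter_subset_left, fun p hp => ?_, fun p hp => interior_subset hp.2⟩, fun p _ n =>
    ⟨fun h => h.hasFirstIntegrals r, fun h => h.hasFullFirstIntegrals r,
      fun h => h.hasNondegHamiltonians r⟩⟩
  rw [mem_closure_iff]
  intro O hO hpO
  obtain ⟨q, hq, hg⟩ := Hydro.exists_eventually_isGeneric hU r (hU.inter hO) Set.inter_subset_left
    ⟨p, hp, hpO⟩
  exact ⟨q, hq.2, hq.1, mem_interior_iff_mem_nhds.2 hg⟩
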